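/- Let $n\ge 1$, $s\ge 0$. Let $P_0\subset\mathbb R^n$ be an $n$-dimensional simple polytope (the convex hull of a finite set, with nonempty interior, every vertex of which lies on exactly $n$ facets), let $P_1,\dots,P_s$ be pairwise disjoint $n$-dimensional simple polytopes contained in the interior $P_0^\circ$, and let $P=P_0\setminus\bigcup_{k=1}^s P_k^\circ$, a polytope with simple holes. Its facets are the facets of $P_0,\dots,P_s$. Let $\lambda$ be a characteristic function on $P$: a map from the set of facets to $\mathbb Z^n$ such that whenever $k$ facets intersect in a face of dimension $n-k$, the span of their $\lambda$-values is a direct summand of rank $k$ of $\mathbb Z^n$. Write $\mathbb T^n=\mathbb R^n/\mathbb Z^n$ and let $M(P,\lambda)=(\mathbb T^n\times P)/\!\sim$ with the quotient topology, where $(t,x)\sim(u,x)$ if and only if $t-u$ lies in the image in $\mathbb T^n$ of the real span of the vectors $\lambda(F)$, $F$ a facet of $P$ containing $x$. Let $\mathbb T^n$ act on $M(P,\lambda)$ by translation of the first factor, let $\pi:M(P,\lambda)\to P$ be the orbit map, and let $M_k=M(P_k,\lambda_k)$ with orbit map $\pi_k$, where $\lambda_k$ is the restriction of $\lambda$ to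 the facets of $P_k$ ($0\le k\le s$); these are the quasitoric manifolds of the $P_k$. (1) $M(P,\lambda)$ is compact, Hausdorff and second countable, and it has the structure of a smooth orientable $2n$-manifold on which $\mathbb T^n$ acts smoothly. (2) $M(P,\lambda)$ is an equivariant fiber sum of the $M_k$, as follows. The spaces $M_k$ have structures of oriented smooth $2n$-manifolds with smooth $\mathbb T^n$-action, such that on $\pi_k^{-1}(P_k^\circ)=\mathbb T^n\times P_k^\circ$ the Cartesian coordinates $p$ of $\mathbb R^n$ and the angular coordinates $q$ of $\mathbb T^n$ are smooth coordinates, and the orientation there is that of $\partial_{p_1},\partial_{q_1},\dots,\partial_{p_n},\partial_{q_n}$ for $k=0$ and the opposite one for $k\ge1$. For all points $x_k\in P_k^\circ$ ($1\le k\le s$) there are an oriented smooth structure on $M(P,\lambda)$ with smooth $\mathbb T^n$-action and the following data. Let $B$ be the open unit ball of $\mathbb R^n$ and $B^-=B\setminus\{0\}$. For $1\le k\le s$ there are $\mathbb T^n$-invariant open neighborhoods $U_{0,k}$ of $\pi_0^{-1}(x_k)$ in $M_0$, pairwise disjoint, and $U_k$ of $\pi_k^{-1}(x_k)$ in $M_k$,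 and equivariant orientation-preserving diffeomorphisms $f_{0,k}:U_{0,k}\to\mathbb T^n\times B$ and $f_k:U_k\to\mathbb T^n\times B$ that take these orbits to $\mathbb T^n\times\{0\}$. There are equivariant orientation-preserving open smooth embeddings of $M_0\setminus\bigcup_{k\ge1}\pi_0^{-1}(x_k)$ and of $M_k\setminus\pi_k^{-1}(x_k)$, $1\le k\le s$, into $M(P,\lambda)$ whose images cover $M(P,\lambda)$, such that two distinct points of the disjoint union of these spaces have the same image if and only if they correspond under one of the identifications $$f_{0,k}^{-1}\circ(\mathrm{id}\times g)\circ f_k:\ U_k\setminus\pi_k^{-1}(x_k)\to U_{0,k}\setminus\pi_0^{-1}(x_k),\qquad 1\le k\le s,$$ where $g:B^-\to B^-$ is the orientation-preserving radial inversion $g(p)=\frac{1-|p|}{|p|}(p_1,\dots,p_{n-1},-p_n)$. For every $k$ and every facet $F$ of $P_k$, the embedding of the punctured $M_k$ takes exactly the points over $F$ to points of $\pi^{-1}(F)$. -/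

import Mathlib

open Set Topology
open scoped Manifold ContDiff

noncomputable section

namespace HoledPolytope

/-! ### Simple polytopes and polytopes with simple holes -/

/-- Euclidean space `ℝⁿ`. -/
abbrev E (n : ℕ) : Type := EuclideanSpace ℝ (Fin n)

/-- `F` is a facet of `P ⊆ ℝⁿ`: a nonempty (exposed) face of dimension `n - 1`. -/
def IsFacet {n : ℕ} (P F : Set (E n)) : Prop :=
  F.Nonempty ∧ IsExposed ℝ P F ∧ Module.finrank ℝ (vectorSpan ℝ F) + 1 = n

/-- An `n`-dimensional simple polytope in `ℝⁿ`: the convex hull of a finite set, with nonempty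
interior, such that every vertex lies on exactly `n` facets. -/
structure IsSimplePolytope {n : ℕ} (P : Set (E n)) : Prop where
  exists_finite : ∃ V : Set (E n), V.Finite ∧ P = convexHull ℝ V
  interior_nonempty : (interior P).Nonempty
  simple : ∀ v ∈ P.extremePoints ℝ, {F : Set (E n) | IsFacet P F ∧ v ∈ F}.ncard = n

/-- The data of an `n`-dimensional polytope with `s` simple holes: a simple polytope `piece 0` and
pairwise disjoint simple polytopes `piece 1, …, piece s` in its interior, the holes. -/
structure PolytopeWithHoles (n s : ℕ) where
  piece : Fin (s + 1) → Set (E n)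
  simple : ∀ k, IsSimplePolytope (piece k)
  hole_subset : ∀ k : Fin s, piece k.succ ⊆ interior (piece 0)
  hole_disjoint : Pairwise fun k l : Fin s => Disjoint (piece k.succ) (piece l.succ)

namespace PolytopeWithHoles

variable {n s : ℕ}

/-- The polytope with holes itself: `P = P₀ ∖ (P₁° ∪ … ∪ Pₛ°)`. -/
def body (P : PolytopeWithHoles n s) : Set (E n) :=
  P.piece 0 \ ⋃ k : Fin s, interior (P.piece k.succ)

/-- The facets of `P` are the facets of `P₀, …, Pₛ`. -/
def Facet (P : PolytopeWithHoles n s) : Type :=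
  {F : Set (E n) // ∃ k, IsFacet (P.piece k) F}

/-- The simple polytope `Pₖ`, as a polytope without holes. -/
def summand (P : PolytopeWithHoles n s) (k : Fin (s + 1)) : PolytopeWithHoles n 0 where
  piece := fun _ => P.piece k
  simple := fun _ => P.simple k
  hole_subset := fun l => l.elim0
  hole_disjoint := fun l => l.elim0

/-- The restriction `λₖ` of a function `λ` on the facets of `P` to the facets of `Pₖ`. -/
def restrict (P : PolytopeWithHoles n s) (lam : P.Facet → Fin n → ℤ) (k : Fin (s + 1)) :
    (P.summand k).Facet → Fin n → ℤ :=
  fun F => lam ⟨F.1, k, F.2.elim fun _ h => h⟩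

/-- Characteristic functions: whenever `k` facets intersect in an `(n - k)`-dimensional
face, the span of their characteristic vectors is a `k`-dimensional direct summand of `ℤⁿ`. -/
def IsCharacteristic (P : PolytopeWithHoles n s) (lam : P.Facet → Fin n → ℤ) : Prop :=
  ∀ S : Finset P.Facet, (⋂ F ∈ S, F.1).Nonempty →
    Module.finrank ℝ (vectorSpan ℝ (⋂ F ∈ S, F.1)) + S.card = n →
      Module.finrank ℤ (Submodule.span ℤ (lam '' (S : Set P.Facet))) = S.card ∧
        ∃ C : Submodule ℤ (Fin n → ℤ), IsCompl (Submodule.span ℤ (lam '' (S : Set P.Facet))) C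

end PolytopeWithHoles

/-! ### The identification space `M(P, λ)` -/

/-- The torus `𝕋ⁿ = ℝⁿ / ℤⁿ`, written additively. -/
abbrev Torus (n : ℕ) : Type := Fin n → UnitAddCircle

/-- The projection `ℝⁿ → 𝕋ⁿ`. -/
def torusProj (n : ℕ) : (Fin n → ℝ) →+ Torus n where
  toFun q := fun i => (q i : UnitAddCircle)
  map_zero' := by ext i; simp
  map_add' a b := by ext i; simp

/-- The subtorus `(N ⊗ ℝ) / N` of `𝕋ⁿ` given by a submodule `N` of `ℤⁿ`: the image in `𝕋ⁿ` of the
real span of `N`. -/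
def subtorus {n : ℕ} (N : Submodule ℤ (Fin n → ℤ)) : AddSubgroup (Torus n) :=
  (Submodule.span ℝ ((fun (v : Fin n → ℤ) (i : Fin n) => (v i : ℝ)) '' (N : Set (Fin n → ℤ)))
    ).toAddSubgroup.map (torusProj n)

namespace PolytopeWithHoles

variable {n s : ℕ}

/-- The submodule `N(F(x))` of `ℤⁿ`, where `F(x)` is the face of `P` with `x` in its relative
interior. The facets of which `F(x)` is the intersection are the facets that contain `x`. -/
def faceModule (P : PolytopeWithHoles n s) (lam : P.Facet → Fin n → ℤ) (x : E n) :
    Submodule ℤ (Fin n → ℤ) :=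
  Submodule.span ℤ (lam '' {F : P.Facet | x ∈ F.1})

/-- `(t, x) ∼ (u, y)` if `x = y` and `t - u` lies in the subtorus of the face `F(x)`. -/
def torusSetoid (P : PolytopeWithHoles n s) (lam : P.Facet → Fin n → ℤ) :
    Setoid (Torus n × P.body) where
  r a b := a.2 = b.2 ∧ a.1 - b.1 ∈ subtorus (P.faceModule lam a.2)
  iseqv :=
    { refl := fun a => ⟨rfl, by simp⟩
      symm := by
        rintro ⟨t, x⟩ ⟨u, y⟩ ⟨h, h'⟩
        obtain rfl : x = y := h
        exact ⟨rfl, by simpa using neg_mem h'⟩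
      trans := by
        rintro ⟨t, x⟩ ⟨u, y⟩ ⟨v, z⟩ ⟨h, h'⟩ ⟨k, k'⟩
        obtain rfl : x = y := h
        obtain rfl : x = z := k
        exact ⟨rfl, by simpa using add_mem h' k'⟩ }

/-- The space `M(P, λ) = (𝕋ⁿ × P) / ∼`, with the quotient topology. -/
def TorusSpace (P : PolytopeWithHoles n s) (lam : P.Facet → Fin n → ℤ) : Type :=
  Quotient (P.torusSetoid lam)

instance (P : PolytopeWithHoles n s) (lam : P.Facet → Fin n → ℤ) :
    TopologicalSpace (P.TorusSpace lam) :=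
  inferInstanceAs (TopologicalSpace (Quotient (P.torusSetoid lam)))

/-- The class `[t, x]` in `M(P, λ)`. -/
def cls (P : PolytopeWithHoles n s) (lam : P.Facet → Fin n → ℤ) (t : Torus n) (x : P.body) :
    P.TorusSpace lam :=
  Quotient.mk (P.torusSetoid lam) (t, x)

/-- The action of `𝕋ⁿ` on `M(P, λ)`, by `t + [u, x] = [t + u, x]`. -/
instance (P : PolytopeWithHoles n s) (lam : P.Facet → Fin n → ℤ) :
    AddAction (Torus n) (P.TorusSpace lam) where
  vadd t := Quotient.map (fun a : Torus n × P.body => (t + a.1, a.2)) (by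
    rintro ⟨u, x⟩ ⟨v, y⟩ ⟨h, h'⟩
    exact ⟨h, by simpa using h'⟩)
  zero_vadd m := by
    induction m using Quotient.inductionOn with
    | h a => exact congrArg (Quotient.mk _) (Prod.ext (zero_add _) rfl)
  add_vadd t u m := by
    induction m using Quotient.inductionOn with
    | h a => exact congrArg (Quotient.mk _) (Prod.ext (add_assoc _ _ _) rfl)

/-- The orbit map `π : M(P, λ) → P ⊆ ℝⁿ`. -/
def orbitMap (P : PolytopeWithHoles n s) (lam : P.Facet → Fin n → ℤ) :
    P.TorusSpace lam → E n :=
  Quotient.lift (fun a : Torus n × P.body => (a.2 : E n)) (fun _ _ h => congrArg Subtype.val h.1)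

end PolytopeWithHoles

/-! ### Oriented smooth manifolds of dimension `2n` with smooth torus action -/

/-- The model space `ℂⁿ = ℝ²ⁿ`, regarded as a real vector space. -/
abbrev Cn (n : ℕ) : Type := Fin n → ℂ

/-- The real part `p` of `w = p + i q`. -/
def rePart {n : ℕ} (w : Cn n) : E n := WithLp.toLp 2 fun i => (w i).re

/-- The class in `𝕋ⁿ` of the imaginary part `q` of `w = p + i q`. -/
def angle {n : ℕ} (w : Cn n) : Torus n := torusProj n fun i => (w i).im

/-- All coordinate changes of the atlas have positive Jacobian determinant. -/
def IsOrientedAtlas (n : ℕ) (M : Type) [TopologicalSpace M] [ChartedSpace (Cn n) M] : Prop :=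
  ∀ e ∈ atlas (Cn n) M, ∀ e' ∈ atlas (Cn n) M, ∀ w ∈ (e.symm ≫ₕ e').source,
    0 < (fderiv ℝ (e.symm ≫ₕ e') w).det

/-- The Jacobian determinant of a map `f` at `m`, in the preferred charts at `m` and at `f m`.
If both atlases are oriented, its sign tells whether `f` preserves orientation at `m`. -/
def jacobian (n : ℕ) {M N : Type} [TopologicalSpace M] [ChartedSpace (Cn n) M]
    [TopologicalSpace N] [ChartedSpace (Cn n) N] (f : M → N) (m : M) : ℝ :=
  ContinuousLinearMap.det
    (show Cn n →L[ℝ] Cn n from mfderiv 𝓘(ℝ, Cn n) 𝓘(ℝ, Cn n) f m)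

/-- The given charts form an oriented smooth atlas (thus a smooth structure together with an
orientation) on the space `M`, and `𝕋ⁿ` acts smoothly on `M`. As `ℝⁿ → 𝕋ⁿ` is a surjective local
diffeomorphism, smoothness of the action is smoothness of `ℝⁿ × M → M`. -/
structure IsOrientedSmoothTorusManifold (n : ℕ) (M : Type) [TopologicalSpace M]
    [ChartedSpace (Cn n) M] [AddAction (Torus n) M] : Prop where
  smooth : IsManifold 𝓘(ℝ, Cn n) ∞ M
  oriented : IsOrientedAtlas n M
  smooth_action : ContMDiff (𝓘(ℝ, Fin n → ℝ).prod 𝓘(ℝ, Cn n)) 𝓘(ℝ, Cn n) ∞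
    fun z : (Fin n → ℝ) × M => torusProj n z.1 +ᵥ z.2

/-! ### The fiber sum -/

/-- The radial inversion `g(p) = ((1 - r) / r) (p₁, …, pₙ₋₁, -pₙ)`, where `r = |p|`, of the
punctured open unit ball of `ℝⁿ`. -/
def radialInversion {n : ℕ} (p : E n) : E n :=
  ((1 - ‖p‖) / ‖p‖) • WithLp.toLp 2 fun i : Fin n => if (i : ℕ) + 1 = n then -p i else p i

namespace PolytopeWithHoles

variable {n s : ℕ}

/-- On the open set `π⁻¹(P°) = 𝕋ⁿ × P°` of `M(P, λ)` the Cartesian coordinates `p` and the angular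
coordinates `q` are smooth coordinates, and the orientation is `ε` times the one given by
`∂/∂p₁, ∂/∂q₁, …, ∂/∂pₙ, ∂/∂qₙ`. -/
def HasStandardInterior (Q : PolytopeWithHoles n s) (mu : Q.Facet → Fin n → ℤ)
    [ChartedSpace (Cn n) (Q.TorusSpace mu)] (ε : ℝ) : Prop :=
  ∃ ψ : Cn n → Q.TorusSpace mu,
    (∀ (w : Cn n) (hw : rePart w ∈ Q.body), ψ w = Q.cls mu (angle w) ⟨rePart w, hw⟩) ∧
    ContMDiffOn 𝓘(ℝ, Cn n) 𝓘(ℝ, Cn n) ∞ ψ {w | rePart w ∈ interior Q.body} ∧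
    ∀ w, rePart w ∈ interior Q.body → 0 < ε * jacobian n ψ w

/-- An equivariant orientation preserving diffeomorphism from `𝕋ⁿ × B`, with `B` the open unit
ball of `ℝⁿ`, onto a `𝕋ⁿ`-invariant open neighborhood of the orbit `π⁻¹(y)`; it takes `𝕋ⁿ × {0}` to
this orbit. Smoothness and orientation are expressed in the coordinates `(p, q)` of `B × ℝⁿ`. Values
of `toFun` outside `𝕋ⁿ × B` are irrelevant. -/
structure OrbitTube (Q : PolytopeWithHoles n s) (mu : Q.Facet → Fin n → ℤ)
    [ChartedSpace (Cn n) (Q.TorusSpace mu)] (y : E n) where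
  toFun : Torus n → E n → Q.TorusSpace mu
  injective : ∀ t u p q, ‖p‖ < 1 → ‖q‖ < 1 → toFun t p = toFun u q → t = u ∧ p = q
  equivariant : ∀ t u p, ‖p‖ < 1 → toFun (t + u) p = t +ᵥ toFun u p
  center : ∀ t, Q.orbitMap mu (toFun t 0) = y
  smooth : ContMDiffOn 𝓘(ℝ, Cn n) 𝓘(ℝ, Cn n) ∞ (fun w : Cn n => toFun (angle w) (rePart w))
    {w | ‖rePart w‖ < 1}
  orientation_preserving : ∀ w : Cn n, ‖rePart w‖ < 1 →
    0 < jacobian n (fun w : Cn n => toFun (angle w) (rePart w)) w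

/-- The complement in `M(Q, μ)` of the orbits over the points `x₁, …, xₛ`. (Points `xₗ` which do not
belong to `Q` play no role.) -/
def punctured {s' : ℕ} (Q : PolytopeWithHoles n s') (mu : Q.Facet → Fin n → ℤ)
    (x : Fin s → E n) : Set (Q.TorusSpace mu) :=
  {m | ∀ l, Q.orbitMap mu m ≠ x l}

/-- The presentation of `M = M(P, λ)` as the equivariant fiber sum of `M₀` with `M₁, …, Mₛ`, where
`Mₖ = M(Pₖ, λₖ)`. For `k = 1, …, s` there are tubes `𝕋ⁿ × B` around the orbit over `xₖ` in `M₀`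
and around the orbit over `xₖ` in `Mₖ`. These orbits are removed, and the punctured tubes are
identified by `id × g`, with `g` the radial inversion. That `M` is the result means: there are
equivariant, orientation preserving open smooth embeddings `incl k` of the punctured `Mₖ` into `M`,
which cover `M`, and in which two points have the same image exactly if they are identified.
Moreover, `incl k` takes the part of `Mₖ` over each facet of `Pₖ` to the part of `M` over this
facet. -/
structure FiberSum (P : PolytopeWithHoles n s) (lam : P.Facet → Fin n → ℤ)
    [∀ k, ChartedSpace (Cn n) ((P.summand k).TorusSpace (P.restrict lam k))]
    [ChartedSpace (Cn n) (P.TorusSpace lam)] (x : Fin s → E n) where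
  /-- the tubes in `M₀` -/
  baseTube : ∀ k : Fin s, OrbitTube (P.summand 0) (P.restrict lam 0) (x k)
  /-- the tubes in `Mₖ` -/
  holeTube : ∀ k : Fin s, OrbitTube (P.summand k.succ) (P.restrict lam k.succ) (x k)
  baseTube_disjoint : ∀ k l t u p q, k ≠ l → ‖p‖ < 1 → ‖q‖ < 1 →
    (baseTube k).toFun t p ≠ (baseTube l).toFun u q
  incl : ∀ k : Fin (s + 1), (P.summand k).TorusSpace (P.restrict lam k) → P.TorusSpace lam
  smooth : ∀ k, ContMDiffOn 𝓘(ℝ, Cn n) 𝓘(ℝ, Cn n) ∞ (incl k)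
    ((P.summand k).punctured (P.restrict lam k) x)
  orientation_preserving : ∀ k, ∀ m ∈ (P.summand k).punctured (P.restrict lam k) x,
    0 < jacobian n (incl k) m
  injective : ∀ k, InjOn (incl k) ((P.summand k).punctured (P.restrict lam k) x)
  equivariant : ∀ k, ∀ m ∈ (P.summand k).punctured (P.restrict lam k) x,
    ∀ t : Torus n, incl k (t +ᵥ m) = t +ᵥ incl k m
  facet_iff : ∀ k, ∀ m ∈ (P.summand k).punctured (P.restrict lam k) x,
    ∀ F : Set (E n), IsFacet (P.piece k) F →
      ((P.summand k).orbitMap (P.restrict lam k) m ∈ F ↔ P.orbitMap lam (incl k m) ∈ F)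
  cover : ∀ z : P.TorusSpace lam, ∃ k, ∃ m ∈ (P.summand k).punctured (P.restrict lam k) x,
    incl k m = z
  glue : ∀ (k : Fin s) (t : Torus n) (p : E n), 0 < ‖p‖ → ‖p‖ < 1 →
    incl 0 ((baseTube k).toFun t (radialInversion p)) = incl k.succ ((holeTube k).toFun t p)
  overlap : ∀ k : Fin s, ∀ m ∈ (P.summand 0).punctured (P.restrict lam 0) x,
    ∀ m' ∈ (P.summand k.succ).punctured (P.restrict lam k.succ) x,
      incl 0 m = incl k.succ m' → ∃ (t : Torus n) (p : E n), 0 < ‖p‖ ∧ ‖p‖ < 1 ∧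
        m = (baseTube k).toFun t (radialInversion p) ∧ m' = (holeTube k).toFun t p
  separate : ∀ k l : Fin s, k ≠ l →
    ∀ m ∈ (P.summand k.succ).punctured (P.restrict lam k.succ) x,
    ∀ m' ∈ (P.summand l.succ).punctured (P.restrict lam l.succ) x,
      incl k.succ m ≠ incl l.succ m'

end PolytopeWithHoles

end HoledPolytope

end

/-! The proof has two halves: smooth structures on the quasitoric pieces `M_k`, and a decomposition
of `M(P, λ)` into punctured pieces whose overlaps are explicit.

For the pieces, convexity shows that a polytope is cut out by the heights over its facets
(`mem_iff_facetHeight_nonneg`). At a vertex of a simple polytope exactly `n` facets meet. Their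
heights `hᵢ` are affine coordinates, and their characteristic vectors are a basis of `ℤⁿ`. With `θᵢ`
the angles in that basis, `zᵢ = √hᵢ exp(2πiθᵢ)` gives a chart of the part of `M_k` lying off the
facets that miss the vertex (`CornerFrame.Fits.param`). A change of vertex multiplies square roots
of heights by monomials in phases; a vanishing coordinate occurs in both charts, up to conjugation,
so the change is smooth (`contDiffAt_transition`). Over the interior the Jacobian sign is that of a
constant determinant, which reversing one basis vector adjusts (`exists_vertex_frame`). Continuity
and invertibility carry positivity to the faces (`Fits.orientedAt_transition`).

For the fiber sum, two radial maps act on the bases. The map `outer` pushes `P_0` without the points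
`x_k` out of the holes, while `inner` turns `P_k` without `x_k` inside out onto a collar of its
hole, fixing the boundary. Both respect the facets of their own piece and the modules attached to
faces, so they lift to the torus spaces (`BaseHomeo.lift`). They are only homeomorphisms, but this
does no harm: the smooth structure of `M(P, λ)` is transported through them, and only the
transitions between pieces have to be smooth. The point where `outer` starts on each ray is chosen
so that `outer` and `inner` overlap in exactly a round ball, where they differ by the radial
inversion (`CollarData.outer_eq_inner`, `CollarData.eq_of_outer_eq_inner`). The inversion reverses
radii and its reflection reverses orientation once more, so it is orientation preserving
(`det_fderiv_radialInversion`). The same reflection enters the tubes of the holes, whose orientation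
is opposite to the standard one. `exists_glued` then assembles the structure.

Compactness is inherited from the compact product. The Hausdorff property (`t2Space`) rests on the
closedness of the subtori. Second countability follows from compactness and the charts. -/

noncomputable section

namespace HoledPolytope

/-! ### Orientation preserving maps between oriented manifolds modelled on `ℂⁿ` -/

section Jacobian

variable {n : ℕ} {M N K : Type} [TopologicalSpace M] [ChartedSpace (Cn n) M]
  [TopologicalSpace N] [ChartedSpace (Cn n) N] [TopologicalSpace K] [ChartedSpace (Cn n) K]

/-- `f` is smooth at `m` and its Jacobian determinant in the preferred charts is positive there. -/
def OrientedAt (n : ℕ) {M N : Type} [TopologicalSpace M] [ChartedSpace (Cn n) M]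
    [TopologicalSpace N] [ChartedSpace (Cn n) N] (f : M → N) (m : M) : Prop :=
  ContMDiffAt 𝓘(ℝ, Cn n) 𝓘(ℝ, Cn n) ∞ f m ∧ 0 < jacobian n f m

theorem _root_.ContinuousLinearMap.det_comp' {V : Type*} [NormedAddCommGroup V] [NormedSpace ℝ V]
    (f g : V →L[ℝ] V) : (f.comp g).det = f.det * g.det := by
  simp only [ContinuousLinearMap.det, ContinuousLinearMap.toLinearMap_comp, LinearMap.det_comp]

theorem jacobian_comp {g : N → K} {f : M → N} {m : M}
    (hg : ContMDiffAt 𝓘(ℝ, Cn n) 𝓘(ℝ, Cn n) ∞ g (f m))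
    (hf : ContMDiffAt 𝓘(ℝ, Cn n) 𝓘(ℝ, Cn n) ∞ f m) :
    jacobian n (g ∘ f) m = jacobian n g (f m) * jacobian n f m := by
  unfold jacobian
  rw [mfderiv_comp m (hg.mdifferentiableAt (by simp)) (hf.mdifferentiableAt (by simp))]
  exact ContinuousLinearMap.det_comp' _ _

theorem jacobian_congr {f g : M → N} {m : M} (h : f =ᶠ[𝓝 m] g) :
    jacobian n f m = jacobian n g m := by
  have := h.mfderiv_eq (I := 𝓘(ℝ, Cn n)) (I' := 𝓘(ℝ, Cn n))
  simp only [jacobian]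
  have h0 := h.eq_of_nhds
  revert this
  generalize mfderiv 𝓘(ℝ, Cn n) 𝓘(ℝ, Cn n) f m = a
  intro h
  subst h
  rfl

theorem jacobian_eq_det_fderiv (f : Cn n → Cn n) (w : Cn n) :
    jacobian n f w = (fderiv ℝ f w).det := by
  simp only [jacobian, mfderiv_eq_fderiv]

theorem jacobian_id (m : M) : jacobian n (id : M → M) m = 1 := by
  simp only [jacobian, mfderiv_id]
  exact LinearMap.det_id

namespace OrientedAt

theorem comp {g : N → K} {f : M → N} {m : M} (hg : OrientedAt n g (f m)) (hf : OrientedAt n f m) :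
    OrientedAt n (g ∘ f) m :=
  ⟨hg.1.comp m hf.1, by rw [jacobian_comp hg.1 hf.1]; exact mul_pos hg.2 hf.2⟩

theorem congr {f g : M → N} {m : M} (h : OrientedAt n f m) (hfg : g =ᶠ[𝓝 m] f) :
    OrientedAt n g m :=
  ⟨h.1.congr_of_eventuallyEq hfg, by rw [jacobian_congr hfg]; exact h.2⟩

protected theorem id (m : M) : OrientedAt n (id : M → M) m :=
  ⟨contMDiffAt_id, by rw [jacobian_id]; exact one_pos⟩

/-- The two Jacobians have product 1, so they have the same sign. -/
theorem of_comp_right {g : N → M} {f : M → N} {m : M}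
    (hg : ContMDiffAt 𝓘(ℝ, Cn n) 𝓘(ℝ, Cn n) ∞ g (f m)) (hf : OrientedAt n f m)
    (h : g ∘ f =ᶠ[𝓝 m] id) : OrientedAt n g (f m) := by
  refine ⟨hg, ?_⟩
  have h1 := jacobian_comp hg hf.1
  rw [jacobian_congr h, jacobian_id] at h1
  have h2 := hf.2
  by_contra hc
  nlinarith [mul_nonneg (not_lt.1 hc |> neg_nonneg.2) h2.le]

end OrientedAt

theorem orientedAt_of_fderiv {f : Cn n → Cn n} {w : Cn n} (hf : ContDiffAt ℝ ∞ f w)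
    (h : 0 < (fderiv ℝ f w).det) : OrientedAt n f w :=
  ⟨hf.contMDiffAt, by rwa [jacobian_eq_det_fderiv]⟩

theorem isOrientedAtlas_model : IsOrientedAtlas n (Cn n) := by
  intro e he e' he' w hw
  rw [chartedSpaceSelf_atlas] at he he'
  subst he he'
  have : (((OpenPartialHomeomorph.refl (Cn n)).symm ≫ₕ OpenPartialHomeomorph.refl (Cn n) :
    OpenPartialHomeomorph (Cn n) (Cn n)) : Cn n → Cn n) = id := rfl
  rw [this, fderiv_id]
  have : (ContinuousLinearMap.id ℝ (Cn n)).det = 1 := LinearMap.det_id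
  rw [this]; exact one_pos

/-- The Jacobian is taken in the preferred chart at `m`, so it is the determinant of the coordinate
change from that chart to `e`, which is positive in an oriented atlas. -/
theorem orientedAt_chart [IsManifold 𝓘(ℝ, Cn n) ∞ M] (hM : IsOrientedAtlas n M)
    {e : OpenPartialHomeomorph M (Cn n)} (he : e ∈ atlas (Cn n) M) {m : M} (hm : m ∈ e.source) :
    OrientedAt n e m := by
  have hs : ContMDiffAt 𝓘(ℝ, Cn n) 𝓘(ℝ, Cn n) ∞ e m :=
    contMDiffAt_of_mem_maximalAtlas (IsManifold.subset_maximalAtlas he) hm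
  refine ⟨hs, ?_⟩
  have h := hM _ (chart_mem_atlas (Cn n) m) e he (chartAt (Cn n) m m)
    (by simp [hm])
  have hmd := hs.mdifferentiableAt (by simp)
  simp only [jacobian, mfderiv, hmd, writtenInExtChartAt,
    mfld_simps, fderivWithin_univ]
  exact h

theorem orientedAt_chart_symm [IsManifold 𝓘(ℝ, Cn n) ∞ M] (hM : IsOrientedAtlas n M)
    {e : OpenPartialHomeomorph M (Cn n)} (he : e ∈ atlas (Cn n) M) {z : Cn n}
    (hz : z ∈ e.target) : OrientedAt n e.symm z := by
  have h1 : OrientedAt n e (e.symm z) := orientedAt_chart hM he (e.map_target hz)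
  have h2 : ContMDiffAt 𝓘(ℝ, Cn n) 𝓘(ℝ, Cn n) ∞ e.symm z :=
    contMDiffAt_symm_of_mem_maximalAtlas (IsManifold.subset_maximalAtlas he) hz
  have h3 := OrientedAt.of_comp_right (f := e) (g := e.symm) (m := e.symm z)
    (by rwa [e.right_inv hz]) h1
    (Filter.eventually_of_mem (e.open_source.mem_nhds (e.map_target hz)) fun x hx => e.left_inv hx)
  rwa [e.right_inv hz] at h3

/-- A local diffeomorphism from `ℂⁿ` detects smoothness of maps and the sign of their Jacobians. -/
theorem contMDiffAt_of_comp [IsManifold 𝓘(ℝ, Cn n) ∞ M] {h : Cn n → M} {f : M → N} {w : Cn n}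
    (hh : ContMDiffAt 𝓘(ℝ, Cn n) 𝓘(ℝ, Cn n) ∞ h w) (hj : jacobian n h w ≠ 0)
    (hf : ContMDiffAt 𝓘(ℝ, Cn n) 𝓘(ℝ, Cn n) ∞ (f ∘ h) w) :
    ContMDiffAt 𝓘(ℝ, Cn n) 𝓘(ℝ, Cn n) ∞ f (h w) := by
  set e := chartAt (Cn n) (h w) with he
  have hes : h w ∈ e.source := mem_chart_source _ _
  have hec : ContMDiffAt 𝓘(ℝ, Cn n) 𝓘(ℝ, Cn n) ∞ e (h w) :=
    contMDiffAt_of_mem_maximalAtlas (IsManifold.chart_mem_maximalAtlas _) hes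
  have hg : ContDiffAt ℝ ∞ (e ∘ h) w := (hec.comp w hh).contDiffAt
  have hdet : (fderiv ℝ (e ∘ h) w).det ≠ 0 := by
    have hmd := hh.mdifferentiableAt (by simp)
    simp only [jacobian, mfderiv, hmd, writtenInExtChartAt,
      mfld_simps, fderivWithin_univ] at hj
    exact hj
  obtain ⟨g', hg'⟩ : ∃ g' : Cn n ≃L[ℝ] Cn n, (g' : Cn n →L[ℝ] Cn n) = fderiv ℝ (e ∘ h) w :=
    ⟨ContinuousLinearMap.toContinuousLinearEquivOfDetNeZero _ hdet,
      ContinuousLinearMap.coe_toContinuousLinearEquivOfDetNeZero _ hdet⟩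
  have hfd : HasFDerivAt (e ∘ h) (g' : Cn n →L[ℝ] Cn n) w := by
    rw [hg']; exact (hg.differentiableAt (by simp)).hasFDerivAt
  have hne : (∞ : WithTop ℕ∞) ≠ 0 := by simp
  set G := hg.toOpenPartialHomeomorph _ hfd hne with hG
  have hGc : (G : Cn n → Cn n) = e ∘ h := rfl
  have hwG : w ∈ G.source := hg.mem_toOpenPartialHomeomorph_source hfd hne
  have hGs : ContDiffAt ℝ ∞ G.symm ((e ∘ h) w) := hg.to_localInverse hfd hne
  have hGw : G.symm ((e ∘ h) w) = w := by rw [← hGc]; exact G.left_inv hwG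
  -- By the inverse function theorem `G.symm ∘ e` is a smooth local inverse of `h`, so `f` agrees
  -- with this composite near `h w`.
  have hcomp : ContMDiffAt 𝓘(ℝ, Cn n) 𝓘(ℝ, Cn n) ∞ ((f ∘ h) ∘ (G.symm ∘ e)) (h w) := by
    refine ContMDiffAt.comp (h w) ?_ (hGs.contMDiffAt.comp (h w) hec)
    have : (G.symm ∘ e) (h w) = w := hGw
    rw [this]; exact hf
  refine hcomp.congr_of_eventuallyEq ?_
  have hcont : ContinuousAt (fun m => h (G.symm (e m))) (h w) := by
    have h1 : ContinuousAt (G.symm ∘ e) (h w) := by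
      exact ContinuousAt.comp (f := e) (g := G.symm) hGs.continuousAt hec.continuousAt
    have h2 : ContinuousAt h ((G.symm ∘ e) (h w)) := by
      have : (G.symm ∘ e) (h w) = w := hGw
      rw [this]; exact hh.continuousAt
    exact ContinuousAt.comp (f := G.symm ∘ e) (g := h) h2 h1
  have hA : ∀ᶠ m in 𝓝 (h w), h (G.symm (e m)) ∈ e.source := by
    refine hcont.eventually_mem (e.open_source.mem_nhds ?_)
    have : G.symm (e (h w)) = w := hGw
    rw [this]; exact hes
  have hB : ∀ᶠ m in 𝓝 (h w), e m ∈ G.target :=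
    hec.continuousAt.eventually_mem (G.open_target.mem_nhds (G.map_source hwG))
  have hC : ∀ᶠ m in 𝓝 (h w), m ∈ e.source := e.open_source.mem_nhds hes
  filter_upwards [hA, hB, hC] with m h1 h2 h3
  have h4 : e (h (G.symm (e m))) = e m := G.right_inv h2
  have h5 : h (G.symm (e m)) = m := e.injOn h1 h3 h4
  simp only [Function.comp_apply, h5]

theorem OrientedAt.of_comp [IsManifold 𝓘(ℝ, Cn n) ∞ M] {h : Cn n → M} {f : M → N} {w : Cn n}
    (hh : OrientedAt n h w) (hf : OrientedAt n (f ∘ h) w) : OrientedAt n f (h w) := by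
  have h1 := contMDiffAt_of_comp hh.1 hh.2.ne' hf.1
  refine ⟨h1, ?_⟩
  have h2 := jacobian_comp h1 hh.1
  have h3 := hf.2
  rw [h2] at h3
  exact pos_of_mul_pos_left h3 hh.2.le

end Jacobian

/-! ### Gluing oriented manifolds with torus action -/

section Gluing

variable {n : ℕ} {ι : Type} {M : ι → Type} [∀ i, TopologicalSpace (M i)]
  [∀ i, ChartedSpace (Cn n) (M i)] {X : Type} [TopologicalSpace X]

/-- The atlas on `X` consisting of the charts of the pieces `M i`. -/
@[reducible] def gluedChartedSpace (J : ∀ i, OpenPartialHomeomorph (M i) X)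
    (cover : ∀ x, ∃ i, x ∈ (J i).target) : ChartedSpace (Cn n) X where
  atlas := {e | ∃ i, ∃ c ∈ atlas (Cn n) (M i), e = (J i).symm ≫ₕ c}
  chartAt x := (J (cover x).choose).symm ≫ₕ chartAt (Cn n) ((J (cover x).choose).symm x)
  mem_chart_source x := by
    have := (cover x).choose_spec
    simp only [OpenPartialHomeomorph.trans_source, OpenPartialHomeomorph.symm_source, mem_inter_iff,
      mem_preimage]
    exact ⟨this, mem_chart_source _ _⟩
  chart_mem_atlas x := ⟨_, _, chart_mem_atlas _ _, rfl⟩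

/-- A coordinate change of the glued atlas is a chart of one piece, a transition `(J j).symm ∘ J i`,
and an inverse chart of another, each smooth and orientation preserving. The action is locally
conjugate to `A i`. This is used twice: with open parts of `ℂⁿ` for quasitoric manifolds, and with
the punctured summands for the fiber sum. -/
theorem exists_glued [AddAction (Torus n) X]
    (hM : ∀ i, IsManifold 𝓘(ℝ, Cn n) ∞ (M i)) (hor : ∀ i, IsOrientedAtlas n (M i))
    (J : ∀ i, OpenPartialHomeomorph (M i) X) (cover : ∀ x, ∃ i, x ∈ (J i).target)
    (trans : ∀ i j, ∀ m ∈ (J i).source, J i m ∈ (J j).target →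
      OrientedAt n ((J j).symm ∘ J i) m)
    (A : ∀ i, (Fin n → ℝ) × M i → M i)
    (hA : ∀ i, ContMDiff (𝓘(ℝ, Fin n → ℝ).prod 𝓘(ℝ, Cn n)) 𝓘(ℝ, Cn n) ∞ (A i))
    (hAs : ∀ i q, ∀ m ∈ (J i).source, A i (q, m) ∈ (J i).source)
    (hAJ : ∀ i q, ∀ m ∈ (J i).source, J i (A i (q, m)) = torusProj n q +ᵥ J i m) :
    ∃ _ : ChartedSpace (Cn n) X, IsOrientedSmoothTorusManifold n X ∧
      ∀ i, ∀ m ∈ (J i).source, OrientedAt n (J i) m := by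
  let cs : ChartedSpace (Cn n) X := gluedChartedSpace J cover
  have key : ∀ e ∈ atlas (Cn n) X, ∀ e' ∈ atlas (Cn n) X, ∀ w ∈ (e.symm ≫ₕ e').source,
      OrientedAt n (e.symm ≫ₕ e') w := by
    rintro e ⟨i, c, hc, rfl⟩ e' ⟨j, c', hc', rfl⟩ w hw
    have := hM i
    have := hM j
    simp only [mfld_simps] at hw
    obtain ⟨⟨hw1, hw2⟩, hw3, hw4⟩ := hw
    exact OrientedAt.comp (f := ((J j).symm ∘ J i) ∘ c.symm) (m := w)
      (orientedAt_chart (hor j) hc' hw4) ((trans i j _ hw2 hw3).comp (orientedAt_chart_symm (hor i) hc hw1))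
  have man : IsManifold 𝓘(ℝ, Cn n) ∞ X := by
    refine isManifold_of_contDiffOn _ _ _ fun e e' he he' w hw => ?_
    have hw' : w ∈ (e.symm ≫ₕ e').source := hw.1
    exact ((key e he e' he' w hw').1.contDiffAt).contDiffWithinAt
  have ori : IsOrientedAtlas n X := fun e he e' he' w hw => by
    rw [← jacobian_eq_det_fderiv]; exact (key e he e' he' w hw).2
  have hJ : ∀ i, ∀ m ∈ (J i).source, OrientedAt n (J i) m := by
    intro i m hm
    have := hM i
    set c := chartAt (Cn n) m
    have hc : c ∈ atlas (Cn n) (M i) := chart_mem_atlas _ _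
    have hcm : m ∈ c.source := mem_chart_source _ _
    have he : (J i).symm ≫ₕ c ∈ atlas (Cn n) X := ⟨i, c, hc, rfl⟩
    -- Near `m`, the map `J i` is a chart of the piece followed by the inverse of the corresponding
    -- chart of `X`.
    have h1 := (orientedAt_chart_symm ori he (z := c m) (by simp [hcm, hm])).comp
      (orientedAt_chart (hor i) hc hcm)
    refine h1.congr ?_
    filter_upwards [c.open_source.mem_nhds hcm] with y hy
    simp [hy]
  have hJs : ∀ i, ∀ x ∈ (J i).target,
      ContMDiffAt 𝓘(ℝ, Cn n) 𝓘(ℝ, Cn n) ∞ (J i).symm x := by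
    intro i x hx
    have := hM i
    set c := chartAt (Cn n) ((J i).symm x)
    have hc : c ∈ atlas (Cn n) (M i) := chart_mem_atlas _ _
    have hcm : (J i).symm x ∈ c.source := mem_chart_source _ _
    have he : (J i).symm ≫ₕ c ∈ atlas (Cn n) X := ⟨i, c, hc, rfl⟩
    have hxs : x ∈ ((J i).symm ≫ₕ c).source := by simp [hcm, hx]
    have h1 := (orientedAt_chart_symm (hor i) hc (z := c ((J i).symm x)) (by simp [hcm])).comp
      (f := (J i).symm ≫ₕ c) (orientedAt_chart ori he hxs)
    refine (h1.congr ?_).1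
    filter_upwards [((J i).symm ≫ₕ c).open_source.mem_nhds hxs] with y hy
    simp only [mfld_simps] at hy
    simp [hy.2]
  refine ⟨cs, ⟨man, ori, ?_⟩, hJ⟩
  rintro ⟨q, x⟩
  obtain ⟨i, hx⟩ := cover x
  have h0 : (J i).symm x ∈ (J i).source := (J i).map_target hx
  have h1 : ContMDiffAt (𝓘(ℝ, Fin n → ℝ).prod 𝓘(ℝ, Cn n)) 𝓘(ℝ, Cn n) ∞
      (fun z : (Fin n → ℝ) × X => J i (A i (z.1, (J i).symm z.2))) (q, x) := by
    refine ContMDiffAt.comp (g := J i) (q, x) (hJ i _ (hAs i q _ h0)).1 ?_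
    refine ContMDiffAt.comp (g := A i) (f := fun z : (Fin n → ℝ) × X => (z.1, (J i).symm z.2))
      (q, x) ((hA i) _) ?_
    exact contMDiffAt_fst.prodMk
      (ContMDiffAt.comp (g := (J i).symm) (f := Prod.snd) (q, x) (hJs i x hx) contMDiffAt_snd)
  refine h1.congr_of_eventuallyEq ?_
  have : ∀ᶠ z : (Fin n → ℝ) × X in 𝓝 (q, x), z.2 ∈ (J i).target :=
    continuousAt_snd.eventually_mem ((J i).open_target.mem_nhds hx)
  filter_upwards [this] with z hz
  rw [hAJ i _ _ ((J i).map_target hz), (J i).right_inv hz]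

end Gluing

/-! ### The facet description of a polytope -/

section Polytope

variable {n : ℕ} {P F : Set (E n)}

theorem IsSimplePolytope.convex (hP : IsSimplePolytope P) : Convex ℝ P := by
  obtain ⟨V, -, rfl⟩ := hP.exists_finite
  exact convex_convexHull ℝ V

theorem IsSimplePolytope.isCompact (hP : IsSimplePolytope P) : IsCompact P := by
  obtain ⟨V, hV, rfl⟩ := hP.exists_finite
  exact hV.isCompact_convexHull ℝ

theorem IsSimplePolytope.nonempty (hP : IsSimplePolytope P) : P.Nonempty :=
  hP.interior_nonempty.mono interior_subset

theorem IsSimplePolytope.finrank_vectorSpan (hP : IsSimplePolytope P) :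
    Module.finrank ℝ (vectorSpan ℝ P) = n := by
  have h := (hP.convex.interior_nonempty_iff_affineSpan_eq_top).1 hP.interior_nonempty
  rw [AffineSubspace.vectorSpan_eq_top_of_affineSpan_eq_top _ _ _ h, finrank_top]
  simp

/-- A linear functional which is minimal at an interior point vanishes. -/
theorem eq_zero_of_isMinOn_interior {l : E n →L[ℝ] ℝ} {x : E n} (hx : x ∈ interior P)
    (h : ∀ p ∈ P, l x ≤ l p) : l = 0 := by
  ext d
  have hc : Continuous fun t : ℝ => x + t • d := by fun_prop
  have h0 : ∀ᶠ t in 𝓝 (0 : ℝ), x + t • d ∈ P := by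
    have := hc.continuousAt (x := 0)
    refine (this.eventually_mem (isOpen_interior.mem_nhds (by simpa using hx))).mono
      fun t ht => interior_subset ht
  have h1 : ∀ᶠ t in 𝓝 (0 : ℝ), x + (-t) • d ∈ P := by
    have : Filter.Tendsto (fun t : ℝ => -t) (𝓝 0) (𝓝 0) := by
      simpa using (continuous_neg (G := ℝ)).tendsto 0
    exact this.eventually h0
  obtain ⟨t, ⟨ht1, ht2⟩, ht⟩ := ((h0.and h1).filter_mono nhdsWithin_le_nhds |>.and
    (self_mem_nhdsWithin (a := (0 : ℝ)) (s := Ioi 0))).exists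
  have ht : 0 < t := ht
  have a1 := h _ ht1
  have a2 := h _ ht2
  simp only [map_add, map_smul, smul_eq_mul] at a1 a2
  have : t * l d = 0 := by linarith
  simpa [ht.ne'] using this

/-- A facet is cut out by a supporting hyperplane. -/
theorem IsFacet.exists_height (hP : IsSimplePolytope P) (hF : IsFacet P F) :
    ∃ l : E n →L[ℝ] ℝ, ∃ c : ℝ, l ≠ 0 ∧ (∀ p ∈ P, c ≤ l p) ∧ F = {p ∈ P | l p = c} := by
  obtain ⟨⟨w, hw⟩, hexp, hdim⟩ := hF
  obtain ⟨l, hl⟩ := hexp ⟨w, hw⟩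
  have hw' : w ∈ P ∧ ∀ y ∈ P, l y ≤ l w := by rw [hl] at hw; exact hw
  refine ⟨-l, -l w, ?_, fun p hp => by simpa using hw'.2 p hp, ?_⟩
  -- A zero functional would expose all of `P`, which has dimension `n` instead of `n - 1`.
  · intro h0
    have hl0 : l = 0 := by simpa using h0
    have : F = P := by rw [hl]; ext p; simp [hl0]
    rw [this, hP.finrank_vectorSpan] at hdim
    omega
  · rw [hl]
    ext p
    refine and_congr_right fun hp => ?_
    simp only [neg_apply, neg_inj]
    exact ⟨fun h => le_antisymm (hw'.2 p hp) (h w hw'.1), fun h y hy => h ▸ hw'.2 y hy⟩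

open Classical in
/-- The linear part of a supporting function of the facet `F` of `P`. -/
def facetNormal (P F : Set (E n)) : E n →L[ℝ] ℝ :=
  if h : ∃ l : E n →L[ℝ] ℝ, ∃ c : ℝ, l ≠ 0 ∧ (∀ p ∈ P, c ≤ l p) ∧ F = {p ∈ P | l p = c}
  then h.choose else 0

open Classical in
/-- An affine function which is nonnegative on `P` and vanishes there precisely on the facet `F`. -/
def facetHeight (P F : Set (E n)) (p : E n) : ℝ :=
  if h : ∃ l : E n →L[ℝ] ℝ, ∃ c : ℝ, l ≠ 0 ∧ (∀ p ∈ P, c ≤ l p) ∧ F = {p ∈ P | l p = c}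
  then facetNormal P F p - h.choose_spec.choose else 0

theorem facetHeight_add (P F : Set (E n)) (p d : E n) :
    facetHeight P F (p + d) = facetHeight P F p + facetNormal P F d := by
  unfold facetHeight
  split_ifs with h
  · rw [map_add]; ring
  · rw [facetNormal, dif_neg h]; simp

theorem facetHeight_eq (P F : Set (E n)) (p : E n) :
    facetHeight P F p = facetHeight P F 0 + facetNormal P F p := by
  simpa using facetHeight_add P F 0 p

@[fun_prop]
theorem continuous_facetHeight (P F : Set (E n)) : Continuous (facetHeight P F) := by
  have : facetHeight P F = fun p => facetHeight P F 0 + facetNormal P F p :=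
    funext (facetHeight_eq P F)
  rw [this]; fun_prop

theorem facetHeight_spec (hP : IsSimplePolytope P) (hF : IsFacet P F) :
    facetNormal P F ≠ 0 ∧ (∀ p ∈ P, 0 ≤ facetHeight P F p) ∧
    F = {p ∈ P | facetHeight P F p = 0} := by
  have h := hF.exists_height hP
  have h1 := h.choose_spec.choose_spec
  have h2 : facetNormal P F = h.choose := dif_pos h
  have h3 : ∀ p, facetHeight P F p = h.choose p - h.choose_spec.choose := by
    intro p; simp only [facetHeight, dif_pos h, h2]
  refine ⟨h2 ▸ h1.1, fun p hp => by rw [h3]; linarith [h1.2.1 p hp], ?_⟩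
  refine h1.2.2.trans ?_
  ext p
  simp only [mem_ofPred_eq, h3, sub_eq_zero]

theorem facetHeight_nonneg (hP : IsSimplePolytope P) (hF : IsFacet P F)
    {p : E n} (hp : p ∈ P) : 0 ≤ facetHeight P F p :=
  (facetHeight_spec hP hF).2.1 p hp

theorem mem_facet_iff (hP : IsSimplePolytope P) (hF : IsFacet P F)
    {p : E n} (hp : p ∈ P) : p ∈ F ↔ facetHeight P F p = 0 := by
  have h := (facetHeight_spec hP hF).2.2
  constructor
  · intro h'; rw [h] at h'; exact h'.2
  · intro h'; rw [h]; exact ⟨hp, h'⟩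

theorem facet_subset (hP : IsSimplePolytope P) (hF : IsFacet P F) : F ⊆ P := by
  rw [(facetHeight_spec hP hF).2.2]; exact sep_subset _ _

theorem facetHeight_pos_of_interior (hP : IsSimplePolytope P) (hF : IsFacet P F)
    {p : E n} (hp : p ∈ interior P) : 0 < facetHeight P F p := by
  refine lt_of_le_of_ne (facetHeight_nonneg hP hF (interior_subset hp)) fun h0 => ?_
  refine (facetHeight_spec hP hF).1 (eq_zero_of_isMinOn_interior hp fun q hq => ?_)
  have := facetHeight_nonneg hP hF hq
  rw [facetHeight_eq] at this h0
  linarith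

theorem notMem_facet_of_interior (hP : IsSimplePolytope P) (hF : IsFacet P F)
    {p : E n} (hp : p ∈ interior P) : p ∉ F := fun h =>
  (facetHeight_pos_of_interior hP hF hp).ne'
    ((mem_facet_iff hP hF (interior_subset hp)).1 h)

theorem IsFacet.isClosed (hP : IsSimplePolytope P) (hF : IsFacet P F) : IsClosed F := hF.2.1.isClosed hP.isCompact.isClosed

/-- An exposed subset of the convex hull of a finite set `V` is the convex hull of its points
in `V`. -/
theorem eq_convexHull_of_isExposed {V : Set (E n)} (hV : V.Finite)
    (hF : IsExposed ℝ (convexHull ℝ V) F) : F = convexHull ℝ (V ∩ F) := by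
  have hc : IsCompact F := hF.isCompact (hV.isCompact_convexHull ℝ)
  have hconv : Convex ℝ F := hF.convex (convex_convexHull ℝ V)
  refine Subset.antisymm ?_ (convexHull_min inter_subset_right hconv)
  -- Extreme points of an exposed subset are extreme in the polytope, hence belong to `V`;
  -- Krein–Milman recovers `F` from them.
  have h1 : F.extremePoints ℝ ⊆ V ∩ F := fun x hx =>
    ⟨extremePoints_convexHull_subset (hF.isExtreme.extremePoints_subset_extremePoints hx), hx.1⟩
  calc F = closure (convexHull ℝ (F.extremePoints ℝ)) :=
        (closure_convexHull_extremePoints hc hconv).symm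
    _ ⊆ closure (convexHull ℝ (V ∩ F)) := closure_mono (convexHull_mono h1)
    _ = convexHull ℝ (V ∩ F) := ((hV.inter_of_left F).isCompact_convexHull ℝ).isClosed.closure_eq

/-- A facet is the convex hull of a subset of the finite set `V`. -/
theorem finite_facets (hP : IsSimplePolytope P) : {F | IsFacet P F}.Finite := by
  obtain ⟨V, hV, rfl⟩ := hP.exists_finite
  refine (hV.powerset.image (convexHull ℝ)).subset fun F hF => ?_
  exact ⟨V ∩ F, inter_subset_left, (eq_convexHull_of_isExposed hV hF.2.1).symm⟩

/-- A generic point of an open set avoids finitely many proper affine subspaces. -/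
theorem exists_mem_notMem_affineSubspaces {U : Set (E n)} (hU : IsOpen U) (hne : U.Nonempty)
    {S : Set (AffineSubspace ℝ (E n))} (hS : S.Finite) (htop : ∀ A ∈ S, A ≠ ⊤) :
    ∃ z ∈ U, ∀ A ∈ S, z ∉ A := by
  by_contra! h
  have h1 : U ⊆ ⋃ A ∈ S, (A : Set (E n)) := fun z hz => by
    obtain ⟨A, hA, hzA⟩ := h z hz
    exact mem_biUnion hA hzA
  -- Proper affine subspaces are Lebesgue null, whereas a nonempty open set has positive measure.
  have h2 : MeasureTheory.volume (⋃ A ∈ S, (A : Set (E n))) = 0 :=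
    (MeasureTheory.measure_biUnion_null_iff hS.countable).2 fun A hA =>
      MeasureTheory.Measure.addHaar_affineSubspace _ _ (htop A hA)
  exact (hU.measure_pos MeasureTheory.volume hne).ne' (MeasureTheory.measure_mono_null h1 h2)

/-- Every point outside a polytope is separated from it by a facet. -/
theorem exists_facet_between (hP : IsSimplePolytope P) {y : E n} (hy : y ∉ P) :
    ∃ F, IsFacet P F ∧ ∃ z ∈ interior P, ∃ t : ℝ, 0 < t ∧ t < 1 ∧
      AffineMap.lineMap y z t ∈ F := by
  obtain ⟨V, hV, hPV⟩ := hP.exists_finite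
  -- A generic interior point: it avoids the span of `y` with any subset of `V` of dimension below
  -- `n - 1`. These spans are proper and finite in number. The segment from `y` to `z` will
  -- therefore not enter `P` through a face of lower dimension.
  obtain ⟨z, hz, hzS⟩ := exists_mem_notMem_affineSubspaces isOpen_interior hP.interior_nonempty
    (S := (fun W => affineSpan ℝ (insert y W)) ''
      {W | W ⊆ V ∧ Module.finrank ℝ (vectorSpan ℝ W) + 1 < n})
    ((hV.powerset.subset fun W hW => hW.1).image _) (by
      rintro _ ⟨W, hW, rfl⟩ htop
      have h1 := finrank_vectorSpan_insert_le_set ℝ W y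
      rw [AffineSubspace.vectorSpan_eq_top_of_affineSpan_eq_top _ _ _ htop, finrank_top] at h1
      have h2 : Module.finrank ℝ (E n) = n := by simp
      have := hW.2
      omega)
  have hLc : Continuous fun t : ℝ => AffineMap.lineMap (k := ℝ) y z t :=
    AffineMap.lineMap_continuous
  -- The parameter at which the segment from `y` to `z` first meets `P`.
  obtain ⟨t, ⟨⟨ht0, ht1⟩, htP⟩, htmin⟩ :=
    (isCompact_Icc.inter_right (hP.isCompact.isClosed.preimage hLc)).exists_isLeast
      (⟨1, ⟨zero_le_one, le_rfl⟩, by simpa using interior_subset hz⟩ :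
        (Icc (0 : ℝ) 1 ∩ (fun t : ℝ => AffineMap.lineMap (k := ℝ) y z t) ⁻¹' P).Nonempty)
  have htP : AffineMap.lineMap y z t ∈ P := htP
  have ht0' : 0 < t := by
    refine lt_of_le_of_ne ht0 ?_
    rintro rfl
    exact hy (by simpa using htP)
  have hnotint : AffineMap.lineMap y z t ∉ interior P := by
    intro hint
    have h1 : ∀ᶠ s in 𝓝[<] t, AffineMap.lineMap (k := ℝ) y z s ∈ interior P :=
      (hLc.continuousAt.eventually_mem (isOpen_interior.mem_nhds hint)).filter_mono
        nhdsWithin_le_nhds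
    have h2 : ∀ᶠ s in 𝓝[<] t, s ∈ Ioo 0 t := Ioo_mem_nhdsLT ht0'
    obtain ⟨s, hs1, hs2⟩ := (h1.and h2).exists
    exact absurd (htmin ⟨⟨hs2.1.le, by linarith [hs2.2]⟩,
      show AffineMap.lineMap y z s ∈ P from interior_subset hs1⟩) (not_le.2 hs2.2)
  have ht1' : t < 1 := by
    refine lt_of_le_of_ne ht1 ?_
    rintro rfl
    exact hnotint (by simpa using hz)
  set w := AffineMap.lineMap (k := ℝ) y z t with hw
  obtain ⟨f, hf⟩ := geometric_hahn_banach_open_point hP.convex.interior isOpen_interior hnotint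
  have hfle : ∀ p ∈ P, f p ≤ f w := by
    have hcl : P ⊆ closure (interior P) := by
      rw [hP.convex.closure_interior_eq_closure_of_nonempty_interior hP.interior_nonempty]
      exact subset_closure
    intro p hp
    exact closure_minimal (fun q hq => (hf q hq).le) (isClosed_le f.continuous continuous_const)
      (hcl hp)
  -- The supporting functional at the entry point `w` exposes a face through `w`. Its dimension is
  -- at most `n - 1` since `f` is constant on it; the choice of `z` excludes anything smaller.
  have hexp : IsExposed ℝ P {p ∈ P | ∀ q ∈ P, f q ≤ f p} := fun _ => ⟨f, rfl⟩
  set G := {p ∈ P | ∀ q ∈ P, f q ≤ f p} with hG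
  have hwG : w ∈ G := ⟨htP, hfle⟩
  refine ⟨G, ⟨⟨w, hwG⟩, hexp, ?_⟩, z, hz, t, ht0', ht1', hwG⟩
  have hne : (f : E n →ₗ[ℝ] ℝ) ≠ 0 := fun h0 => by
    have h1 : ∀ p, f p = 0 := fun p => LinearMap.congr_fun h0 p
    have := hf z hz
    rw [h1, h1] at this
    exact lt_irrefl _ this
  have hker := Module.Dual.finrank_ker_add_one_of_ne_zero (f := (f : E n →ₗ[ℝ] ℝ)) hne
  have hn : Module.finrank ℝ (E n) = n := by simp
  have hle : vectorSpan ℝ G ≤ LinearMap.ker (f : E n →ₗ[ℝ] ℝ) := by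
    rw [vectorSpan_def, Submodule.span_le]
    rintro _ ⟨p, hp, q, hq, rfl⟩
    have : f p = f q := le_antisymm (hq.2 p hp.1) (hp.2 q hq.1)
    simp [this]
  have h1 := Submodule.finrank_mono hle
  rw [hPV] at hexp
  have hGW := eq_convexHull_of_isExposed hV hexp
  by_contra hdim
  have hW : V ∩ G ∈ {W | W ⊆ V ∧ Module.finrank ℝ (vectorSpan ℝ W) + 1 < n} := by
    refine ⟨inter_subset_left, ?_⟩
    have h2 : vectorSpan ℝ (V ∩ G) ≤ vectorSpan ℝ G := vectorSpan_mono ℝ inter_subset_right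
    have h3 := Submodule.finrank_mono h2
    omega
  refine hzS _ (mem_image_of_mem _ hW) ?_
  have hwA : w ∈ affineSpan ℝ (insert y (V ∩ G)) := by
    have : w ∈ affineSpan ℝ (convexHull ℝ (V ∩ G)) := by
      rw [← hGW]; exact mem_affineSpan ℝ hwG
    rw [affineSpan_convexHull] at this
    exact affineSpan_mono ℝ (subset_insert _ _) this
  have hyA : y ∈ affineSpan ℝ (insert y (V ∩ G)) := mem_affineSpan ℝ (mem_insert _ _)
  -- Since `t ≠ 0`, the point `z` lies on the line through `y` and `w`, hence in the span that it
  -- was chosen to avoid.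
  have hzw : z = AffineMap.lineMap y w t⁻¹ := by
    rw [hw, AffineMap.lineMap_lineMap_right]
    simp [ht0'.ne']
  rw [hzw]
  exact AffineMap.lineMap_mem _ hyA hwA

/-- A polytope is the intersection of the half spaces given by its facets. -/
theorem mem_iff_facetHeight_nonneg (hP : IsSimplePolytope P) {p : E n} :
    p ∈ P ↔ ∀ F, IsFacet P F → 0 ≤ facetHeight P F p := by
  refine ⟨fun hp F hF => facetHeight_nonneg hP hF hp, fun h => ?_⟩
  by_contra hp
  obtain ⟨F, hF, z, hz, t, ht0, ht1, hw⟩ := exists_facet_between hP hp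
  have h1 := (mem_facet_iff hP hF (facet_subset hP hF hw)).1 hw
  have h2 := facetHeight_pos_of_interior hP hF hz
  have h3 := h F hF
  rw [facetHeight_eq] at h1 h2 h3
  rw [AffineMap.lineMap_apply_module'] at h1
  simp only [map_add, map_smul, map_sub, smul_eq_mul] at h1
  -- The height is affine on the segment, nonnegative at `p` and positive at `z`, so it cannot
  -- vanish at a parameter `t > 0`.
  nlinarith

/-- The facets through any point of a polytope have a vertex in common. -/
theorem exists_vertex (hP : IsSimplePolytope P) {x : E n} (hx : x ∈ P) :
    ∃ v ∈ P.extremePoints ℝ, ∀ F, IsFacet P F → x ∈ F → v ∈ F := by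
  -- Including `P` itself keeps the intersection inside `P` when no facet contains `x`. The
  -- intersection is a compact face, and any of its extreme points will do.
  set S : Set (Set (E n)) := {F | F = P ∨ (IsFacet P F ∧ x ∈ F)} with hS
  have hext : IsExtreme ℝ P (⋂₀ S) := by
    refine isExtreme_sInter ⟨P, Or.inl rfl⟩ ?_
    rintro B (rfl | hB)
    · exact IsExtreme.rfl
    · exact hB.1.2.1.isExtreme
  have hcl : IsClosed (⋂₀ S) := isClosed_sInter (by
    rintro B (rfl | hB)
    · exact hP.isCompact.isClosed
    · exact hB.1.isClosed hP)
  have hne : (⋂₀ S).Nonempty := ⟨x, by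
    rintro B (rfl | hB)
    · exact hx
    · exact hB.2⟩
  have hc : IsCompact (⋂₀ S) := hP.isCompact.of_isClosed_subset hcl (sInter_subset_of_mem (Or.inl rfl))
  obtain ⟨v, hv⟩ := hc.extremePoints_nonempty hne
  exact ⟨v, hext.extremePoints_subset_extremePoints hv, fun F hF hxF => hv.1 F (Or.inr ⟨hF, hxF⟩)⟩

/-- The normals of the facets through a vertex span the dual space. -/
theorem eq_zero_of_facetNormal_eq_zero (hP : IsSimplePolytope P) {v d : E n}
    (hv : v ∈ P.extremePoints ℝ) (hd : ∀ F, IsFacet P F → v ∈ F → facetNormal P F d = 0) :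
    d = 0 := by
  -- Along `e` the heights over the facets through `v` stay zero and the other heights are positive
  -- at `v`, so short moves remain in `P`. For `e = ±d` this makes `v` a midpoint, against
  -- extremality unless `d = 0`.
  have h1 : ∀ e : E n, (∀ F, IsFacet P F → v ∈ F → facetNormal P F e = 0) →
      ∀ᶠ t in 𝓝 (0 : ℝ), v + t • e ∈ P := by
    intro e he
    have : ∀ᶠ t in 𝓝 (0 : ℝ), ∀ F ∈ {F | IsFacet P F}, 0 ≤ facetHeight P F (v + t • e) := by
      refine (Filter.eventually_all_finite (finite_facets hP)).2 fun F hF => ?_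
      by_cases hvF : v ∈ F
      · refine Filter.Eventually.of_forall fun t => ?_
        rw [facetHeight_add, map_smul, he F hF hvF]
        simpa using facetHeight_nonneg hP hF hv.1
      · have hpos : 0 < facetHeight P F v := lt_of_le_of_ne (facetHeight_nonneg hP hF hv.1)
          fun h0 => hvF ((mem_facet_iff hP hF hv.1).2 h0.symm)
        have hc : Continuous fun t : ℝ => facetHeight P F (v + t • e) := by fun_prop
        exact (hc.continuousAt.eventually_const_lt (by simpa using hpos)).mono fun t ht => ht.le
    exact this.mono fun t ht => (mem_iff_facetHeight_nonneg hP).2 ht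
  have h2 := h1 d hd
  have h3 := h1 (-d) fun F hF hvF => by simp [hd F hF hvF]
  obtain ⟨t, ⟨ht1, ht2⟩, ht⟩ := ((h2.and h3).filter_mono nhdsWithin_le_nhds |>.and
    (self_mem_nhdsWithin (a := (0 : ℝ)) (s := Ioi 0))).exists
  have ht : 0 < t := ht
  have h4 := hv.2 ht1 ht2 ⟨1 / 2, 1 / 2, by norm_num, by norm_num, by norm_num, by
    simp only [smul_add, smul_neg]
    rw [add_add_add_comm, add_neg_cancel, add_zero, ← add_smul]
    norm_num⟩
  have h5 : t • d = 0 := by simpa using h4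
  exact (smul_eq_zero.1 h5).resolve_left ht.ne'

/-- An enumeration of the facets through a vertex of a simple polytope. -/
theorem exists_facet_enumeration (hP : IsSimplePolytope P) {v : E n}
    (hv : v ∈ P.extremePoints ℝ) :
    ∃ σ : Fin n → Set (E n), Function.Injective σ ∧ range σ = {F | IsFacet P F ∧ v ∈ F} := by
  have hcard := hP.simple v hv
  have hfin : {F : Set (E n) | IsFacet P F ∧ v ∈ F}.Finite :=
    (finite_facets hP).subset fun F hF => hF.1
  have : Fintype {F : Set (E n) | IsFacet P F ∧ v ∈ F} := hfin.fintype
  have hc : Fintype.card {F : Set (E n) | IsFacet P F ∧ v ∈ F} = n := by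
    rw [← Nat.card_eq_fintype_card]; exact hcard
  let e := (Fintype.equivFinOfCardEq hc).symm
  refine ⟨fun i => (e i).1, Subtype.val_injective.comp e.injective, ?_⟩
  ext F
  constructor
  · rintro ⟨i, rfl⟩; exact (e i).2
  · intro hF; exact ⟨e.symm ⟨F, hF⟩, by simp⟩

/-- The heights over the facets through a vertex are affine coordinates. -/
theorem exists_vertex_linearEquiv (hP : IsSimplePolytope P) {v : E n}
    (hv : v ∈ P.extremePoints ℝ) {σ : Fin n → Set (E n)}
    (hσ : range σ = {F | IsFacet P F ∧ v ∈ F}) :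
    ∃ L : E n ≃ₗ[ℝ] (Fin n → ℝ), ∀ d i, L d i = facetNormal P (σ i) d := by
  let L : E n →ₗ[ℝ] (Fin n → ℝ) := LinearMap.pi fun i => (facetNormal P (σ i) : E n →ₗ[ℝ] ℝ)
  have hinj : Function.Injective L := by
    refine (injective_iff_map_eq_zero L).2 fun d hd => ?_
    refine eq_zero_of_facetNormal_eq_zero hP hv fun F hF hvF => ?_
    obtain ⟨i, rfl⟩ : F ∈ range σ := by rw [hσ]; exact ⟨hF, hvF⟩
    exact congrFun hd i
  exact ⟨L.linearEquivOfInjective hinj (by simp), fun d i => rfl⟩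

end Polytope

/-! ### Endomorphisms of the torus given by integer matrices -/

section Torus

variable {n : ℕ}

/-- The endomorphism of `𝕋ⁿ` induced by an integer matrix. -/
def matTorus (B : Matrix (Fin n) (Fin n) ℤ) : Torus n →+ Torus n where
  toFun t := fun i => ∑ j, B i j • t j
  map_zero' := by ext i; simp
  map_add' s t := by ext i; simp [Finset.sum_add_distrib]

theorem matTorus_apply (B : Matrix (Fin n) (Fin n) ℤ) (t : Torus n) (i : Fin n) :
    matTorus B t i = ∑ j, B i j • t j := rfl

@[fun_prop]
theorem continuous_matTorus (B : Matrix (Fin n) (Fin n) ℤ) : Continuous (matTorus B) := by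
  refine continuous_pi fun i => ?_
  simp only [matTorus_apply]
  fun_prop

theorem matTorus_mul (B C : Matrix (Fin n) (Fin n) ℤ) (t : Torus n) :
    matTorus (B * C) t = matTorus B (matTorus C t) := by
  ext i
  simp only [matTorus_apply, Matrix.mul_apply, Finset.sum_smul, Finset.smul_sum, mul_smul]
  exact Finset.sum_comm

theorem matTorus_one (t : Torus n) : matTorus 1 t = t := by
  ext i
  simp [matTorus_apply, Matrix.one_apply, ite_smul]

theorem matTorus_torusProj (B : Matrix (Fin n) (Fin n) ℤ) (q : Fin n → ℝ) :
    matTorus B (torusProj n q) = torusProj n fun i => ∑ j, (B i j : ℝ) * q j := by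
  ext i
  simp only [matTorus_apply, torusProj, AddMonoidHom.coe_mk, ZeroHom.coe_mk]
  rw [← QuotientAddGroup.mk'_apply, map_sum]
  refine Finset.sum_congr rfl fun j _ => ?_
  rw [QuotientAddGroup.mk'_apply, ← AddCircle.coe_zsmul, zsmul_eq_mul]

theorem torusProj_surjective (t : Torus n) : ∃ q, torusProj n q = t := by
  refine ⟨fun i => (QuotientAddGroup.mk_surjective (t i)).choose, ?_⟩
  ext i
  exact (QuotientAddGroup.mk_surjective (t i)).choose_spec

/-- The subtorus spanned by a part of a basis of `ℤⁿ` is a coordinate subtorus. -/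
theorem mem_subtorus_span_iff {A B : Matrix (Fin n) (Fin n) ℤ} (hAB : A * B = 1) (hBA : B * A = 1)
    (I : Set (Fin n)) (t : Torus n) :
    t ∈ subtorus (Submodule.span ℤ ((fun i => A.transpose i) '' I)) ↔
      ∀ i ∉ I, matTorus B t i = 0 := by
  constructor
  · rintro ⟨q, hq, rfl⟩ i hi
    rw [matTorus_torusProj]
    -- Row `i` of `B` annihilates the columns of `A` with index in `I`, because `B * A = 1`; this
    -- passes from the integral to the real span.
    let φ : (Fin n → ℝ) →ₗ[ℝ] ℝ := ∑ j, (B i j : ℝ) • LinearMap.proj j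
    have hφ : ∀ q, φ q = ∑ j, (B i j : ℝ) * q j := fun q => by simp [φ]
    have h1 : Submodule.span ℝ ((fun (v : Fin n → ℤ) (i : Fin n) => (v i : ℝ)) ''
        (Submodule.span ℤ ((fun i => A.transpose i) '' I) : Set (Fin n → ℤ))) ≤
        LinearMap.ker φ := by
      rw [Submodule.span_le]
      rintro _ ⟨v, hv, rfl⟩
      have h2 : ∑ j, B i j * v j = 0 := by
        let φ' : (Fin n → ℤ) →ₗ[ℤ] ℤ := ∑ j, B i j • LinearMap.proj j
        have hφ' : ∀ q, φ' q = ∑ j, B i j * q j := fun q => by simp [φ']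
        have h3 : Submodule.span ℤ ((fun i => A.transpose i) '' I) ≤ LinearMap.ker φ' := by
          rw [Submodule.span_le]
          rintro _ ⟨k, hk, rfl⟩
          have h4 : (B * A) i k = 0 := by
            rw [hBA, Matrix.one_apply_ne]
            rintro rfl; exact hi hk
          simp only [SetLike.mem_coe, LinearMap.mem_ker, hφ', Matrix.transpose_apply]
          rwa [Matrix.mul_apply] at h4
        have := h3 hv
        rwa [LinearMap.mem_ker, hφ'] at this
      simp only [SetLike.mem_coe, LinearMap.mem_ker, hφ]
      exact_mod_cast h2
    have h5 := h1 hq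
    rw [LinearMap.mem_ker, hφ] at h5
    simp [torusProj, h5]
  · intro h
    obtain ⟨c, hc⟩ := torusProj_surjective (matTorus B t)
    classical
    -- Off `I` the lift `c` is only known to be integral. Replacing those entries by zero gives a
    -- lift that `A` sends into the real span of the columns in `I`.
    let c' : Fin n → ℝ := fun i => if i ∈ I then c i else 0
    have hc' : torusProj n c' = matTorus B t := by
      ext i
      by_cases hi : i ∈ I
      · rw [← hc]; simp [c', torusProj, hi]
      · rw [h i hi]; simp [c', torusProj, hi]
    refine ⟨fun i => ∑ j, (A i j : ℝ) * c' j, ?_, ?_⟩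
    · have : (fun i => ∑ j, (A i j : ℝ) * c' j) = ∑ j, c' j • fun i => (A i j : ℝ) := by
        ext i; simp [mul_comm]
      rw [this]
      refine Submodule.sum_mem _ fun j _ => ?_
      by_cases hj : j ∈ I
      · refine Submodule.smul_mem _ _ (Submodule.subset_span ?_)
        exact ⟨A.transpose j, Submodule.subset_span ⟨j, hj, rfl⟩, rfl⟩
      · simp [c', hj]
    · rw [← matTorus_torusProj, hc', ← matTorus_mul, hAB, matTorus_one]

/-- The complex number of modulus one corresponding to a point of `ℝ / ℤ`. -/
def phase (s : UnitAddCircle) : ℂ := (AddCircle.toCircle s : ℂ)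

theorem phase_add (s t : UnitAddCircle) : phase (s + t) = phase s * phase t := by
  simp [phase, AddCircle.toCircle_add]

theorem phase_coe (x : ℝ) : phase (x : UnitAddCircle) = Complex.exp (2 * Real.pi * x * Complex.I) := by
  simp [phase, AddCircle.toCircle_apply_mk, Circle.coe_exp]

theorem norm_phase (s : UnitAddCircle) : ‖phase s‖ = 1 := Circle.norm_coe _

theorem phase_ne_zero (s : UnitAddCircle) : phase s ≠ 0 := by simp [phase]

@[fun_prop]
theorem continuous_phase : Continuous phase :=
  continuous_subtype_val.comp AddCircle.continuous_toCircle

theorem phase_injective : Function.Injective phase :=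
  Subtype.val_injective.comp (AddCircle.injective_toCircle one_ne_zero)

theorem phase_zero : phase 0 = 1 := by simp [phase]

theorem phase_zsmul (c : ℤ) (s : UnitAddCircle) : phase (c • s) = phase s ^ c := by
  simp [phase, AddCircle.toCircle_zsmul]

theorem phase_sum {ι : Type*} (S : Finset ι) (f : ι → UnitAddCircle) :
    phase (∑ i ∈ S, f i) = ∏ i ∈ S, phase (f i) := by
  classical
  induction S using Finset.induction_on with
  | empty => simp [phase_zero]
  | insert a S ha ih => rw [Finset.sum_insert ha, Finset.prod_insert ha, phase_add, ih]

/-- The argument of a complex number, as a point of `ℝ / ℤ`. -/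
def turn (z : ℂ) : UnitAddCircle := ((z.arg / (2 * Real.pi) : ℝ) : UnitAddCircle)

theorem phase_turn (z : ℂ) : phase (turn z) = Complex.exp (z.arg * Complex.I) := by
  have : (2 * (Real.pi : ℂ)) ≠ 0 := by simp [Real.pi_ne_zero]
  rw [turn, phase_coe]
  push_cast
  rw [mul_div_cancel₀ _ this]

theorem norm_mul_phase_turn (z : ℂ) : (‖z‖ : ℂ) * phase (turn z) = z := by
  rw [phase_turn, Complex.norm_mul_exp_arg_mul_I]

end Torus

/-! ### Elementary properties of the spaces `M(Q, μ)` -/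

namespace PolytopeWithHoles

section TorusSpace

variable {n s : ℕ} (Q : PolytopeWithHoles n s) (mu : Q.Facet → Fin n → ℤ)

theorem cls_eq_cls_iff {t u : Torus n} {x y : Q.body} :
    Q.cls mu t x = Q.cls mu u y ↔ x = y ∧ t - u ∈ subtorus (Q.faceModule mu x) :=
  Quotient.eq (r := Q.torusSetoid mu)

theorem exists_cls (m : Q.TorusSpace mu) : ∃ t x, Q.cls mu t x = m := by
  induction m using Quotient.inductionOn with
  | h a => exact ⟨a.1, a.2, rfl⟩

@[simp]
theorem orbitMap_cls (t : Torus n) (x : Q.body) : Q.orbitMap mu (Q.cls mu t x) = x := rfl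

theorem vadd_cls (t u : Torus n) (x : Q.body) : t +ᵥ Q.cls mu u x = Q.cls mu (t + u) x := rfl

@[simp]
theorem orbitMap_vadd (t : Torus n) (m : Q.TorusSpace mu) :
    Q.orbitMap mu (t +ᵥ m) = Q.orbitMap mu m := by
  obtain ⟨u, x, rfl⟩ := Q.exists_cls mu m
  rfl

theorem isQuotientMap_cls : IsQuotientMap fun a : Torus n × Q.body => Q.cls mu a.1 a.2 :=
  isQuotientMap_quotient_mk' (s := Q.torusSetoid mu)

theorem continuous_cls : Continuous fun a : Torus n × Q.body => Q.cls mu a.1 a.2 :=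
  (Q.isQuotientMap_cls mu).continuous

@[fun_prop]
theorem continuous_orbitMap : Continuous (Q.orbitMap mu) :=
  (Q.isQuotientMap_cls mu).continuous_iff.2 (continuous_subtype_val.comp continuous_snd)

theorem orbitMap_mem (m : Q.TorusSpace mu) : Q.orbitMap mu m ∈ Q.body := by
  obtain ⟨u, x, rfl⟩ := Q.exists_cls mu m
  exact x.2

/-- The angular component of a representative of a point of `M(Q, μ)`. -/
def someAngle (m : Q.TorusSpace mu) : Torus n := (Quotient.out m).1

theorem cls_someAngle (m : Q.TorusSpace mu) :
    Q.cls mu (Q.someAngle mu m) ⟨Q.orbitMap mu m, Q.orbitMap_mem mu m⟩ = m := by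
  have h : Q.cls mu (Quotient.out m).1 (Quotient.out m).2 = m := Quotient.out_eq m
  have h2 : Q.orbitMap mu m = (Quotient.out m).2 := by
    conv_lhs => rw [← h]
    rfl
  conv_rhs => rw [← h]
  unfold someAngle
  congr 1
  exact Subtype.ext h2

open Classical in
/-- The point `[t, p]` of `M(Q, μ)`, with an arbitrary value if `p` is not in `Q`. -/
def point [Nonempty (Q.TorusSpace mu)] (t : Torus n) (p : E n) : Q.TorusSpace mu :=
  if h : p ∈ Q.body then Q.cls mu t ⟨p, h⟩ else Classical.arbitrary _

variable [Nonempty (Q.TorusSpace mu)]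

theorem point_of_mem {t : Torus n} {p : E n} (h : p ∈ Q.body) :
    Q.point mu t p = Q.cls mu t ⟨p, h⟩ := dif_pos h

theorem orbitMap_point {t : Torus n} {p : E n} (h : p ∈ Q.body) :
    Q.orbitMap mu (Q.point mu t p) = p := by
  rw [point_of_mem Q mu h, orbitMap_cls]

theorem vadd_point {t u : Torus n} {p : E n} (h : p ∈ Q.body) :
    t +ᵥ Q.point mu u p = Q.point mu (t + u) p := by
  rw [point_of_mem Q mu h, point_of_mem Q mu h, vadd_cls]

theorem exists_point (m : Q.TorusSpace mu) : ∃ t, ∃ p ∈ Q.body, Q.point mu t p = m := by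
  obtain ⟨t, x, rfl⟩ := Q.exists_cls mu m
  exact ⟨t, x, x.2, point_of_mem Q mu x.2⟩

theorem point_eq_point_iff {t u : Torus n} {p q : E n} (hp : p ∈ Q.body) (hq : q ∈ Q.body) :
    Q.point mu t p = Q.point mu u q ↔ p = q ∧ t - u ∈ subtorus (Q.faceModule mu p) := by
  rw [point_of_mem Q mu hp, point_of_mem Q mu hq, cls_eq_cls_iff, Subtype.mk_eq_mk]

theorem subtorus_bot : subtorus (⊥ : Submodule ℤ (Fin n → ℤ)) = ⊥ := by
  have : (fun (v : Fin n → ℤ) (i : Fin n) => (v i : ℝ)) ''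
      ((⊥ : Submodule ℤ (Fin n → ℤ)) : Set (Fin n → ℤ)) = {0} := by
    ext v; simp [Submodule.bot_coe, funext_iff]
  rw [subtorus, this]
  simp

theorem continuousOn_point : ContinuousOn (fun a : Torus n × E n => Q.point mu a.1 a.2)
    {a | a.2 ∈ Q.body} := by
  rw [continuousOn_iff_continuous_domRestrict]
  have h : Continuous fun a : {a : Torus n × E n | a.2 ∈ Q.body} =>
      Q.cls mu a.1.1 ⟨a.1.2, a.2⟩ :=
    (Q.continuous_cls mu).comp (f := fun a : {a : Torus n × E n | a.2 ∈ Q.body} =>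
      ((a.1.1, ⟨a.1.2, a.2⟩) : Torus n × Q.body))
      ((continuous_fst.comp continuous_subtype_val).prodMk
        ((continuous_snd.comp continuous_subtype_val).subtype_mk _))
  refine h.congr fun a => ?_
  exact (point_of_mem Q mu a.2).symm

/-- A map on an invariant open set of `M(Q, μ)` is continuous if it is so in terms of
representatives. -/
theorem continuousOn_of_point {Y : Type*} [TopologicalSpace Y] {f : Q.TorusSpace mu → Y}
    {U : Set (E n)} (hU : IsOpen U)
    (hf : ContinuousOn (fun a : Torus n × E n => f (Q.point mu a.1 a.2))
      {a | a.2 ∈ Q.body ∩ U}) :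
    ContinuousOn f (Q.orbitMap mu ⁻¹' U) := by
  rw [(Q.isQuotientMap_cls mu).continuousOn_isOpen_iff (hU.preimage (Q.continuous_orbitMap mu))]
  have h := hf.comp (s := {a : Torus n × Q.body | (a.2 : E n) ∈ U})
    (f := fun a : Torus n × Q.body => (a.1, (a.2 : E n))) (by fun_prop) fun a ha => ⟨a.2.2, ha⟩
  refine h.congr fun a ha => ?_
  simp [point_of_mem Q mu a.2.2]

end TorusSpace

end PolytopeWithHoles

/-! ### Charts at the corners -/

/-- Affine coordinates on `ℝⁿ` together with a basis of `ℤⁿ`, and an open set on which they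
are meant to be used. -/
structure CornerFrame (n : ℕ) where
  lin : E n ≃L[ℝ] E n
  off : E n
  basis : Matrix (Fin n) (Fin n) ℤ
  dual : Matrix (Fin n) (Fin n) ℤ
  basis_mul_dual : basis * dual = 1
  dual_mul_basis : dual * basis = 1
  dom : Set (E n)
  isOpen_dom : IsOpen dom

namespace CornerFrame

variable {n : ℕ} (c : CornerFrame n)

/-- The affine coordinates. -/
def ht (p : E n) : E n := c.lin p + c.off

@[fun_prop]
theorem continuous_ht : Continuous c.ht := by unfold ht; fun_prop

/-- The complex coordinates `zᵢ = √(lᵢ(p)) exp(2πi sᵢ)`. -/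
def coord (t : Torus n) (p : E n) : Cn n :=
  fun i => (Real.sqrt (c.ht p i) : ℂ) * phase (matTorus c.dual t i)

@[fun_prop]
theorem continuous_coord : Continuous fun a : Torus n × E n => c.coord a.1 a.2 := by
  unfold coord; fun_prop

/-- The point of `ℝⁿ` with complex coordinates `z`. -/
def base (z : Cn n) : E n := c.lin.symm (WithLp.toLp 2 (fun i => Complex.normSq (z i)) - c.off)

theorem contDiff_base : ContDiff ℝ ∞ c.base := by
  unfold base
  refine c.lin.symm.contDiff.comp (ContDiff.sub ?_ contDiff_const)
  refine PiLp.contDiff_toLp.comp (contDiff_pi.2 fun i => ?_)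
  have h : (fun z : Cn n => Complex.normSq (z i)) = fun z => ‖z i‖ ^ 2 :=
    funext fun z => Complex.normSq_eq_norm_sq _
  rw [h]
  exact (contDiff_apply ℝ ℂ i).norm_sq ℝ

@[fun_prop]
theorem continuous_base : Continuous c.base := c.contDiff_base.continuous

/-- A point of the torus with complex coordinates `z`. -/
def ang (z : Cn n) : Torus n := matTorus c.basis fun i => turn (z i)

@[simp]
theorem ht_base (z : Cn n) (i : Fin n) : c.ht (c.base z) i = Complex.normSq (z i) := by
  simp [ht, base]

theorem dual_ang (z : Cn n) : matTorus c.dual (c.ang z) = fun i => turn (z i) := by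
  rw [ang, ← matTorus_mul, c.dual_mul_basis, matTorus_one]

@[simp]
theorem coord_ang_base (z : Cn n) : c.coord (c.ang z) (c.base z) = z := by
  ext i
  rw [coord, ht_base, dual_ang, Complex.normSq_eq_norm_sq, Real.sqrt_sq (norm_nonneg _),
    norm_mul_phase_turn]

theorem base_coord {t : Torus n} {p : E n} (h : ∀ i, 0 ≤ c.ht p i) : c.base (c.coord t p) = p := by
  have : (WithLp.toLp 2 fun i => Complex.normSq (c.coord t p i)) = c.ht p := by
    ext i
    simp only [coord, Complex.normSq_eq_norm_sq, norm_mul, norm_phase, mul_one, Complex.norm_real,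
      Real.norm_eq_abs, sq_abs, Real.sq_sqrt (h i)]
  rw [base, this, ht, add_sub_cancel_right, ContinuousLinearEquiv.symm_apply_apply]

/-- The diagonal action of `ℝⁿ` on `ℂⁿ` which corresponds to translation in the torus. -/
def rotate (a : (Fin n → ℝ) × Cn n) : Cn n := fun i =>
  Complex.exp (2 * Real.pi * (∑ j, (c.dual i j : ℝ) * a.1 j : ℝ) * Complex.I) * a.2 i

theorem contDiff_rotate : ContDiff ℝ ∞ c.rotate := by
  refine contDiff_pi.2 fun i => ?_
  refine ContDiff.mul (ContDiff.cexp (ContDiff.mul (contDiff_const.mul ?_) contDiff_const)) ?_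
  · have h : ContDiff ℝ ∞ fun a : (Fin n → ℝ) × Cn n => ∑ j, (c.dual i j : ℝ) * a.1 j :=
      ContDiff.sum fun j _ => contDiff_const.mul ((contDiff_apply ℝ ℝ j).comp contDiff_fst)
    exact Complex.ofRealCLM.contDiff.comp h
  · exact (contDiff_apply ℝ ℂ i).comp contDiff_snd

theorem rotate_coord (q : Fin n → ℝ) (t : Torus n) (p : E n) :
    c.rotate (q, c.coord t p) = c.coord (torusProj n q + t) p := by
  ext i
  have h : Complex.exp (2 * Real.pi * (∑ j, (c.dual i j : ℝ) * q j : ℝ) * Complex.I) =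
      phase (matTorus c.dual (torusProj n q) i) := by
    rw [matTorus_torusProj]
    exact (phase_coe _).symm
  simp only [rotate, coord, map_add, Pi.add_apply, phase_add]
  rw [h]; ring

theorem base_rotate (q : Fin n → ℝ) (z : Cn n) : c.base (c.rotate (q, z)) = c.base z := by
  have : ∀ i, Complex.normSq (c.rotate (q, z) i) = Complex.normSq (z i) := by
    intro i
    have h : (2 * Real.pi * (∑ j, (c.dual i j : ℝ) * q j : ℝ) : ℂ) =
      ((2 * Real.pi * (∑ j, (c.dual i j : ℝ) * q j) : ℝ) : ℂ) := by push_cast; ring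
    have h2 : c.rotate (q, z) i = Complex.exp
      ((2 * Real.pi * (∑ j, (c.dual i j : ℝ) * q j) : ℝ) * Complex.I) * z i := by rw [← h]; rfl
    rw [h2, map_mul, Complex.normSq_eq_norm_sq (Complex.exp _), Complex.norm_exp_ofReal_mul_I]
    simp
  simp only [base, this]

variable {s : ℕ}

/-- The frame describes `Q` and `μ` over its domain. -/
structure Fits (Q : PolytopeWithHoles n s) (mu : Q.Facet → Fin n → ℤ) : Prop where
  nonneg : ∀ p ∈ Q.body, ∀ i, 0 ≤ c.ht p i
  pos : ∀ p ∈ interior Q.body, ∀ i, 0 < c.ht p i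
  interior_subset : interior Q.body ⊆ c.dom
  mem_body : ∀ p ∈ c.dom, (∀ i, 0 ≤ c.ht p i) → p ∈ Q.body
  face : ∀ p ∈ c.dom, p ∈ Q.body → Q.faceModule mu p =
    Submodule.span ℤ ((fun i => c.basis.transpose i) '' {i | c.ht p i = 0})

namespace Fits

variable {c} {Q : PolytopeWithHoles n s} {mu : Q.Facet → Fin n → ℤ} (h : c.Fits Q mu)

include h

theorem base_mem_body {z : Cn n} (hz : c.base z ∈ c.dom) : c.base z ∈ Q.body :=
  h.mem_body _ hz fun i => by rw [ht_base]; exact Complex.normSq_nonneg _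

/-- A coordinate of height zero imposes no condition on the angle, and any other coordinate
determines its angle. This is the description of the subtorus in the frame's basis, and it makes the
complex coordinates well defined and injective on classes. -/
theorem sub_mem_subtorus_iff {t u : Torus n} {p : E n} (hp : p ∈ c.dom) (hpb : p ∈ Q.body) :
    t - u ∈ subtorus (Q.faceModule mu p) ↔ c.coord t p = c.coord u p := by
  rw [h.face p hp hpb, mem_subtorus_span_iff c.basis_mul_dual c.dual_mul_basis, funext_iff]
  refine forall_congr' fun i => ?_
  by_cases hi : c.ht p i = 0
  · simp [coord, hi]
  · have hs : (Real.sqrt (c.ht p i) : ℂ) ≠ 0 := by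
      rw [Ne, Complex.ofReal_eq_zero, Real.sqrt_eq_zero (h.nonneg p hpb i)]
      exact hi
    simp only [mem_ofPred_eq, hi, not_false_eq_true, true_imp_iff, map_sub, Pi.sub_apply, coord,
      mul_right_inj' hs, phase_injective.eq_iff, sub_eq_zero]

theorem mem_interior_of_pos {p : E n} (hp : p ∈ c.dom) (hpos : ∀ i, 0 < c.ht p i) :
    p ∈ interior Q.body := by
  rw [mem_interior_iff_mem_nhds]
  have h1 : ∀ᶠ q in 𝓝 p, ∀ i, 0 < c.ht q i := Filter.eventually_all.2 fun i =>
    (show Continuous fun q => c.ht q i by fun_prop).continuousAt.eventually_const_lt (hpos i)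
  filter_upwards [h1, c.isOpen_dom.mem_nhds hp] with q h2 h3
  exact h.mem_body q h3 fun i => (h2 i).le

variable [Nonempty (Q.TorusSpace mu)]

theorem coord_someAngle_point {t : Torus n} {p : E n} (hp : p ∈ c.dom) (hpb : p ∈ Q.body) :
    c.coord (Q.someAngle mu (Q.point mu t p)) p = c.coord t p := by
  rw [← h.sub_mem_subtorus_iff hp hpb]
  have h1 := Q.cls_someAngle mu (Q.point mu t p)
  rw [← Q.point_of_mem mu, Q.orbitMap_point mu hpb, Q.point_eq_point_iff mu hpb hpb] at h1
  exact h1.2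

theorem point_ang_base_coord {t : Torus n} {p : E n} (hp : p ∈ c.dom) (hpb : p ∈ Q.body) :
    Q.point mu (c.ang (c.coord t p)) (c.base (c.coord t p)) = Q.point mu t p := by
  have h1 : c.base (c.coord t p) = p := c.base_coord (h.nonneg p hpb)
  rw [h1, Q.point_eq_point_iff mu hpb hpb]
  refine ⟨rfl, (h.sub_mem_subtorus_iff hp hpb).2 ?_⟩
  have h2 := c.coord_ang_base (c.coord t p)
  rwa [h1] at h2

/-- The inverse of the chart given by a frame. -/
def param (hc : IsCompact Q.body) : OpenPartialHomeomorph (Cn n) (Q.TorusSpace mu) where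
  toFun z := Q.point mu (c.ang z) (c.base z)
  invFun m := c.coord (Q.someAngle mu m) (Q.orbitMap mu m)
  source := c.base ⁻¹' c.dom
  target := Q.orbitMap mu ⁻¹' c.dom
  map_source' z hz := by
    have hz' : c.base z ∈ c.dom := hz
    rw [mem_preimage, Q.orbitMap_point mu (h.base_mem_body hz')]; exact hz'
  map_target' m hm := by
    have hm' : Q.orbitMap mu m ∈ c.dom := hm
    rw [mem_preimage, c.base_coord (h.nonneg _ (Q.orbitMap_mem mu m))]; exact hm'
  left_inv' z hz := by
    have hz' : c.base z ∈ c.dom := hz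
    rw [Q.orbitMap_point mu (h.base_mem_body hz'),
      h.coord_someAngle_point hz' (h.base_mem_body hz'), coord_ang_base]
  right_inv' m hm := by
    rw [h.point_ang_base_coord hm (Q.orbitMap_mem mu m), Q.point_of_mem mu (Q.orbitMap_mem mu m),
      Q.cls_someAngle]
  open_source := c.isOpen_dom.preimage c.continuous_base
  open_target := c.isOpen_dom.preimage (Q.continuous_orbitMap mu)
  continuousOn_toFun := by
    refine continuousOn_iff'.2 fun W hW => ?_
    have := isCompact_iff_compactSpace.1 hc
    -- The angles of `z` are discontinuous, so continuity is not proved by formula. The coordinate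
    -- map on the compact space `𝕋ⁿ × Q.body` sends the closed set `C` to a closed set, and the
    -- preimage of `W` is its complement.
    set C : Set (Torus n × Q.body) := (fun a => Q.cls mu a.1 a.2) ⁻¹' Wᶜ
    have hC : IsCompact C := (hW.isClosed_compl.preimage (Q.continuous_cls mu)).isCompact
    have hF : Continuous fun a : Torus n × Q.body => c.coord a.1 (a.2 : E n) :=
      c.continuous_coord.comp (f := fun a : Torus n × Q.body => (a.1, (a.2 : E n))) (by fun_prop)
    refine ⟨_, (hC.image hF).isClosed.isOpen_compl, ?_⟩
    ext z
    refine and_congr_left fun hz => ?_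
    have hz' : c.base z ∈ c.dom := hz
    have hzb := h.base_mem_body hz'
    constructor
    · rintro hzW ⟨⟨t, x⟩, hx, rfl⟩
      refine hx ?_
      have h1 : c.base (c.coord t x) = x := c.base_coord (h.nonneg _ x.2)
      simp only [h1] at hz'
      have h2 := h.point_ang_base_coord (t := t) hz' x.2
      rw [Q.point_of_mem mu x.2] at h2
      rw [mem_preimage, h2] at hzW
      exact hzW
    · intro hzC
      by_contra hzW
      refine hzC ⟨(c.ang z, ⟨c.base z, hzb⟩), ?_, c.coord_ang_base z⟩
      have h3 : Q.point mu (c.ang z) (c.base z) ∉ W := hzW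
      rw [Q.point_of_mem mu hzb] at h3
      exact h3
  continuousOn_invFun := by
    refine Q.continuousOn_of_point mu c.isOpen_dom ?_
    refine c.continuous_coord.continuousOn.congr fun a ha => ?_
    rw [Q.orbitMap_point mu ha.1]
    exact h.coord_someAngle_point ha.2 ha.1

theorem param_apply (hc : IsCompact Q.body) (z : Cn n) :
    h.param hc z = Q.point mu (c.ang z) (c.base z) := rfl

theorem param_coord (hc : IsCompact Q.body) {t : Torus n} {p : E n} (hp : p ∈ c.dom)
    (hpb : p ∈ Q.body) : h.param hc (c.coord t p) = Q.point mu t p :=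
  h.point_ang_base_coord hp hpb

theorem param_symm_point (hc : IsCompact Q.body) {t : Torus n} {p : E n} (hp : p ∈ c.dom)
    (hpb : p ∈ Q.body) : (h.param hc).symm (Q.point mu t p) = c.coord t p := by
  have : (h.param hc).symm (Q.point mu t p) =
    c.coord (Q.someAngle mu (Q.point mu t p)) (Q.orbitMap mu (Q.point mu t p)) := rfl
  rw [this, Q.orbitMap_point mu hpb, h.coord_someAngle_point hp hpb]

theorem param_rotate (hc : IsCompact Q.body) (q : Fin n → ℝ) {z : Cn n} (hz : c.base z ∈ c.dom) :
    h.param hc (c.rotate (q, z)) = torusProj n q +ᵥ h.param hc z := by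
  have hzb := h.base_mem_body hz
  conv_lhs => rw [← c.coord_ang_base z, c.rotate_coord]
  rw [h.param_coord hc hz hzb, h.param_apply, Q.vadd_point mu hzb]

end Fits

end CornerFrame

/-! ### Jacobian determinants in Cartesian and angular coordinates -/

section Determinants

variable {n : ℕ}

/-- The decomposition of `ℂⁿ` into real and imaginary parts. -/
def splitEquiv (n : ℕ) : Cn n ≃ₗ[ℝ] E n × (Fin n → ℝ) where
  toFun w := (rePart w, fun i => (w i).im)
  map_add' v w := by ext <;> simp [rePart]
  map_smul' r w := by ext <;> simp [rePart]
  invFun a := fun i => ⟨a.1 i, a.2 i⟩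
  left_inv w := by ext i; simp [rePart]
  right_inv a := by ext <;> simp [rePart]

/-- The linear map of `ℂⁿ` which is `f` on real parts and `g` on imaginary parts. -/
def sep (f : E n →L[ℝ] E n) (g : (Fin n → ℝ) →L[ℝ] (Fin n → ℝ)) : Cn n →L[ℝ] Cn n :=
  LinearMap.toContinuousLinearMap
    (((splitEquiv n).symm : E n × (Fin n → ℝ) →ₗ[ℝ] Cn n) ∘ₗ
      (LinearMap.prodMap (f : E n →ₗ[ℝ] E n) (g : (Fin n → ℝ) →ₗ[ℝ] (Fin n → ℝ))) ∘ₗ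
        (splitEquiv n : Cn n →ₗ[ℝ] E n × (Fin n → ℝ)))

theorem sep_apply (f : E n →L[ℝ] E n) (g : (Fin n → ℝ) →L[ℝ] (Fin n → ℝ)) (w : Cn n) (i : Fin n) :
    sep f g w i = ⟨f (rePart w) i, g (fun i => (w i).im) i⟩ := rfl

theorem det_sep (f : E n →L[ℝ] E n) (g : (Fin n → ℝ) →L[ℝ] (Fin n → ℝ)) :
    (sep f g).det = f.det * g.det := by
  have h := LinearMap.det_conj
    (LinearMap.prodMap (f : E n →ₗ[ℝ] E n) (g : (Fin n → ℝ) →ₗ[ℝ] (Fin n → ℝ))) (splitEquiv n).symm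
  rw [LinearMap.det_prodMap] at h
  exact h

@[fun_prop]
theorem continuous_rePart : Continuous (rePart : Cn n → E n) := by unfold rePart; fun_prop

/-- The determinant of a real linear map of the complex plane. -/
theorem det_complex (f : ℂ →L[ℝ] ℂ) :
    f.det = (f 1).re * (f Complex.I).im - (f Complex.I).re * (f 1).im := by
  rw [ContinuousLinearMap.det, ← LinearMap.det_toMatrix Complex.basisOneI, Matrix.det_fin_two]
  simp [LinearMap.toMatrix_apply]

/-- The map `a + ib ↦ √a exp(2πib)`. -/
def polar (h : ℂ) : ℂ := (Real.sqrt h.re : ℂ) * Complex.exp (2 * Real.pi * h.im * Complex.I)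

theorem contDiffAt_polar {h : ℂ} (hh : 0 < h.re) : ContDiffAt ℝ ∞ polar h := by
  unfold polar
  refine ContDiffAt.mul ?_ ?_
  · exact Complex.ofRealCLM.contDiff.contDiffAt.comp h
      (Complex.reCLM.contDiff.contDiffAt.sqrt hh.ne')
  · refine ContDiffAt.cexp (ContDiffAt.mul (contDiffAt_const.mul ?_) contDiffAt_const)
    exact (Complex.ofRealCLM.contDiff.comp Complex.imCLM.contDiff).contDiffAt

/-- The determinant is the constant `π`: with `r = √a` and `θ = 2πb` the area form `r dr dθ` is `π
da db`. -/
theorem det_fderiv_polar {h : ℂ} (hh : 0 < h.re) : 0 < (fderiv ℝ polar h).det := by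
  set e : ℂ := Complex.exp (2 * Real.pi * h.im * Complex.I) with he
  have h1 : HasFDerivAt (fun h : ℂ => ((Real.sqrt h.re : ℝ) : ℂ))
      (Complex.ofRealCLM.comp ((1 / (2 * Real.sqrt h.re)) • Complex.reCLM)) h :=
    Complex.ofRealCLM.hasFDerivAt.comp h (Complex.reCLM.hasFDerivAt.sqrt hh.ne')
  have h2 : HasFDerivAt (fun h : ℂ => (2 * Real.pi * h.im * Complex.I : ℂ))
      ((2 * Real.pi * Complex.I : ℂ) • (Complex.ofRealCLM.comp Complex.imCLM)) h := by
    have := ((Complex.ofRealCLM.comp Complex.imCLM).hasFDerivAt (x := h)).const_mul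
      (2 * Real.pi * Complex.I : ℂ)
    refine this.congr_of_eventuallyEq (Filter.Eventually.of_forall fun x => ?_)
    simp only [ContinuousLinearMap.comp_apply, Complex.imCLM_apply, Complex.ofRealCLM_apply]
    ring
  have h3 := h1.mul h2.cexp
  have h4 : HasFDerivAt polar _ h := h3
  rw [h4.fderiv, det_complex]
  have hs : 0 < Real.sqrt h.re := Real.sqrt_pos.2 hh
  have hn : e.re * e.re + e.im * e.im = 1 := by
    rw [← Complex.normSq_apply, Complex.normSq_eq_norm_sq, he]
    have : (2 * Real.pi * h.im * Complex.I : ℂ) = ((2 * Real.pi * h.im : ℝ) : ℂ) * Complex.I := by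
      push_cast; ring
    rw [this, Complex.norm_exp_ofReal_mul_I]; norm_num
  simp only [add_apply, smul_apply, ContinuousLinearMap.comp_apply, smul_eq_mul, Complex.imCLM_apply,
    Complex.reCLM_apply, Complex.ofRealCLM_apply, ← he]
  simp
  have : (Real.sqrt h.re * (e.re * (2 * Real.pi))) * (e.re * ((Real.sqrt h.re)⁻¹ * 2⁻¹)) +
    (Real.sqrt h.re * (e.im * (2 * Real.pi))) * (e.im * ((Real.sqrt h.re)⁻¹ * 2⁻¹)) = Real.pi := by
    field_simp
    linear_combination 1 * hn
  nlinarith [Real.pi_pos]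

theorem realMatrix_det (B : Matrix (Fin n) (Fin n) ℤ) :
    (LinearMap.toContinuousLinearMap (Matrix.toLin' (B.map (Int.cast : ℤ → ℝ)))).det =
      (B.det : ℝ) := by
  have : (LinearMap.toContinuousLinearMap (Matrix.toLin' (B.map (Int.cast : ℤ → ℝ)))).det =
    LinearMap.det (Matrix.toLin' (B.map (Int.cast : ℤ → ℝ))) := rfl
  rw [this, LinearMap.det_toLin']
  exact ((Int.castRingHom ℝ).map_det B).symm

end Determinants

namespace CornerFrame

variable {n : ℕ} (c : CornerFrame n)

/-- The complex coordinates in terms of the Cartesian and angular coordinates. -/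
def interiorCoord (w : Cn n) : Cn n := c.coord (angle w) (rePart w)

/-- The sign of the determinant of the coordinate change. -/
def orientation : ℝ := (c.lin : E n →L[ℝ] E n).det * (c.dual.det : ℝ)

theorem interiorCoord_eq (w : Cn n) : c.interiorCoord w = fun i => polar
    ((sep (c.lin : E n →L[ℝ] E n) (LinearMap.toContinuousLinearMap
      (Matrix.toLin' (c.dual.map (Int.cast : ℤ → ℝ)))) w + fun i => (c.off i : ℂ)) i) := by
  ext i
  have h : matTorus c.dual (angle w) i =
      ((∑ j, (c.dual i j : ℝ) * (w j).im : ℝ) : UnitAddCircle) := by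
    rw [angle, matTorus_torusProj]; rfl
  rw [interiorCoord, coord, h, phase_coe, polar]
  simp [sep_apply, ht, Matrix.mulVec, dotProduct]

theorem contDiffAt_interiorCoord {w : Cn n} (hw : ∀ i, 0 < c.ht (rePart w) i) :
    ContDiffAt ℝ ∞ c.interiorCoord w := by
  have : c.interiorCoord = fun w => _ := funext c.interiorCoord_eq
  rw [this]
  refine contDiffAt_pi.2 fun i => ?_
  refine ContDiffAt.comp (g := polar) w (contDiffAt_polar ?_) ?_
  · simpa [sep_apply, ht] using hw i
  · exact ((contDiff_apply ℝ ℂ i).comp ((ContinuousLinearMap.contDiff _).add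
      contDiff_const)).contDiffAt

/-- The coordinates are an affine map, with linear part `c.lin` on Cartesian and `c.dual` on angular
coordinates, followed by `polar` in each variable. The polar factors are positive, so the sign is
that of `c.orientation`. -/
theorem det_fderiv_interiorCoord {w : Cn n} (hw : ∀ i, 0 < c.ht (rePart w) i) :
    ∃ r : ℝ, 0 < r ∧ (fderiv ℝ c.interiorCoord w).det = r * c.orientation := by
  have : c.interiorCoord = fun w => _ := funext c.interiorCoord_eq
  set g : (Fin n → ℝ) →L[ℝ] (Fin n → ℝ) := LinearMap.toContinuousLinearMap
      (Matrix.toLin' (c.dual.map (Int.cast : ℤ → ℝ))) with hg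
  set S := sep (c.lin : E n →L[ℝ] E n) g with hS
  set T : Cn n → Cn n := fun w => S w + fun i => (c.off i : ℂ) with hT
  have hTd : HasFDerivAt T S w := S.hasFDerivAt.add_const _
  have hpos : ∀ i, 0 < (T w i).re := fun i => by simpa [hT, hS, sep_apply, ht] using hw i
  have hD : HasFDerivAt (fun z : Cn n => fun i => polar (z i))
      (ContinuousLinearMap.pi fun i => (fderiv ℝ polar (T w i)).comp
        (ContinuousLinearMap.proj (R := ℝ) (φ := fun _ : Fin n => ℂ) i)) (T w) := by
    refine hasFDerivAt_pi.2 fun i => ?_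
    exact ((contDiffAt_polar (hpos i)).differentiableAt (by simp)).hasFDerivAt.comp (T w)
      (ContinuousLinearMap.proj (R := ℝ) (φ := fun _ : Fin n => ℂ) i).hasFDerivAt
  have hcomp := hD.comp w hTd
  refine ⟨∏ i, (fderiv ℝ polar (T w i)).det,
    Finset.prod_pos fun i _ => det_fderiv_polar (hpos i), ?_⟩
  have h2 : c.interiorCoord = (fun z : Cn n => fun i => polar (z i)) ∘ T := by rw [this]; rfl
  rw [h2, hcomp.fderiv, ContinuousLinearMap.det_comp', ContinuousLinearMap.det_pi, hS, det_sep, hg,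
    realMatrix_det, orientation]

/-! ### Smoothness of coordinate changes -/

/-- At `p`, the coordinates of `c` that vanish are also coordinates of `c'`, up to the sign of the
corresponding angles. -/
def CompatAt (c c' : CornerFrame n) (p : E n) : Prop :=
  ∀ i, c.ht p i = 0 → ∃ j, (∀ q, c'.ht q j = c.ht q i) ∧
    (c'.basis.transpose j = c.basis.transpose i ∨ c'.basis.transpose j = -c.basis.transpose i)

theorem dual_mul_basis_apply (c : CornerFrame n) (i j : Fin n) :
    ∑ k, c.dual i k * c.basis.transpose j k = if i = j then 1 else 0 := by
  have := congrFun (congrFun c.dual_mul_basis i) j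
  rw [Matrix.mul_apply, Matrix.one_apply] at this
  exact this

theorem _root_.ContDiffAt.zpow_of_ne_zero {V : Type*} [NormedAddCommGroup V] [NormedSpace ℝ V]
    {f : V → ℂ} {x : V} (hf : ContDiffAt ℝ ∞ f x) (h0 : f x ≠ 0) (m : ℤ) :
    ContDiffAt ℝ ∞ (fun y => f y ^ m) x := by
  cases m with
  | ofNat k => simpa using hf.pow k
  | negSucc k =>
    simp only [zpow_negSucc]
    exact (hf.pow (k + 1)).inv (pow_ne_zero _ h0)

/-- The function `turn` is lifted discontinuously, but the phase of `turn z` is `z / ‖z‖`, smooth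
off the origin; for `m = 0` the power is constant. -/
theorem contDiffAt_phase_turn_zpow {z : ℂ} {m : ℤ} (h : z ≠ 0 ∨ m = 0) :
    ContDiffAt ℝ ∞ (fun z => phase (turn z) ^ m) z := by
  by_cases hm : m = 0
  · subst hm; simpa using contDiffAt_const
  · have hz := h.resolve_right hm
    refine ContDiffAt.zpow_of_ne_zero (f := fun z : ℂ => phase (turn z)) ?_ (phase_ne_zero _) m
    have h1 : ContDiffAt ℝ ∞ (fun z : ℂ => z * ((‖z‖⁻¹ : ℝ) : ℂ)) z :=
      contDiffAt_id.mul (Complex.ofRealCLM.contDiff.contDiffAt.comp z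
        ((contDiffAt_norm ℝ hz).inv (norm_ne_zero_iff.2 hz)))
    refine h1.congr_of_eventuallyEq ?_
    filter_upwards [isOpen_ne.mem_nhds hz] with y hy
    have hy' : (‖y‖ : ℂ) ≠ 0 := by simpa using hy
    have h2 := norm_mul_phase_turn y
    calc phase (turn y) = ((‖y‖ : ℂ) * phase (turn y)) * (‖y‖ : ℂ)⁻¹ := by field_simp
      _ = _ := by rw [h2]; simp

/-- When two frames use opposite signs of the same characteristic vector, the shared coordinate is
conjugated; in this form it is visibly smooth at zero. -/
theorem norm_mul_phase_turn_inv (z : ℂ) :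
    (‖z‖ : ℂ) * phase (turn z) ^ (-1 : ℤ) = (starRingEnd ℂ) z := by
  conv_rhs => rw [← norm_mul_phase_turn z]
  rw [map_mul, Complex.conj_ofReal, zpow_neg_one, Complex.inv_def, Complex.normSq_eq_norm_sq,
    norm_phase]
  simp

/-- Coordinate changes between compatible frames are smooth. -/
theorem contDiffAt_transition {c c' : CornerFrame n} {z : Cn n}
    (hcc : CompatAt c c' (c.base z)) (hcc' : CompatAt c' c (c.base z)) :
    ContDiffAt ℝ ∞ (fun z => c'.coord (c.ang z) (c.base z)) z := by
  -- Angles change by the integer matrix `C`, so each new coordinate is the root of a height times a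
  -- monomial in the old phases. The only dangers are phases of vanishing `z i` and roots of
  -- vanishing heights.
  set C := c'.dual * c.basis with hC
  have hCapp : ∀ i j, C i j = ∑ k, c'.dual i k * c.basis.transpose j k := fun i j => by
    rw [hC, Matrix.mul_apply]; rfl
  have hform : ∀ z j, c'.coord (c.ang z) (c.base z) j =
      (Real.sqrt (c'.ht (c.base z) j) : ℂ) * ∏ i, phase (turn (z i)) ^ C j i := by
    intro z j
    rw [coord, ang, ← matTorus_mul, matTorus_apply, phase_sum]
    simp only [phase_zsmul, hC]
  -- The basis vector of a vanishing coordinate is, up to sign, a basis vector of `c'`. Its column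
  -- in `C` is therefore supported in one row, whose height vanishes as well.
  have hcol : ∀ i, z i = 0 → ∃ j', c'.ht (c.base z) j' = 0 ∧ ∀ j, j ≠ j' → C j i = 0 := by
    intro i hi
    have h0 : c.ht (c.base z) i = 0 := by rw [ht_base, hi, map_zero]
    obtain ⟨j', h1, h2⟩ := hcc i h0
    refine ⟨j', by rw [h1, h0], fun j hj => ?_⟩
    have h3 := c'.dual_mul_basis_apply j j'
    rw [if_neg hj] at h3
    rcases h2 with h2 | h2 <;> rw [h2] at h3 <;> rw [hCapp]
    · exact h3
    · simpa using h3
  refine contDiffAt_pi.2 fun j => ?_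
  simp only [hform]
  have hfac : ∀ i, z i ≠ 0 ∨ C j i = 0 →
      ContDiffAt ℝ ∞ (fun z : Cn n => phase (turn (z i)) ^ C j i) z := fun i hi =>
    ContDiffAt.comp (g := fun y : ℂ => phase (turn y) ^ C j i) (f := fun z : Cn n => z i) z
      (contDiffAt_phase_turn_zpow hi) (contDiff_apply ℝ ℂ i).contDiffAt
  by_cases hj : c'.ht (c.base z) j = 0
  · obtain ⟨i₀, h1, h2⟩ := hcc' j hj
    have hC0 : C j i₀ = 1 ∨ C j i₀ = -1 := by
      have h3 := c'.dual_mul_basis_apply j j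
      rw [if_pos rfl] at h3
      rw [hCapp]
      rcases h2 with h2 | h2 <;> rw [h2]
      · left; exact h3
      · right; simpa using h3
    -- A second vanishing coordinate with an entry in row `j` would give a column proportional to
    -- column `i₀`, contradicting invertibility of `C`.
    have hz0 : ∀ i, i ≠ i₀ → z i ≠ 0 ∨ C j i = 0 := by
      intro i hi
      by_cases hzi : z i = 0
      · right
        obtain ⟨j', h3, h4⟩ := hcol i hzi
        refine h4 j ?_
        rintro rfl
        have hci : ∀ k, k ≠ j → C k i = 0 := h4
        have hsq : ∃ m : ℤ, ∀ k, C k i = m * C k i₀ := by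
          have hk0 : ∀ k, k ≠ j → C k i₀ = 0 := by
            intro k hk
            have h3 := c'.dual_mul_basis_apply k j
            rw [if_neg hk] at h3
            rw [hCapp]
            rcases h2 with h2 | h2 <;> rw [h2]
            · exact h3
            · simpa using h3
          rcases hC0 with h0 | h0
          · exact ⟨C j i, fun k => by
              by_cases hk : k = j
              · subst hk; rw [h0, mul_one]
              · rw [hci k hk, hk0 k hk, mul_zero]⟩
          · exact ⟨-C j i, fun k => by
              by_cases hk : k = j
              · subst hk; rw [h0]; ring
              · rw [hci k hk, hk0 k hk, mul_zero]⟩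
        obtain ⟨m, hm⟩ := hsq
        have hback : ∀ l k, (∑ q, (c.dual * c'.basis) l q * C q k) = if l = k then 1 else 0 := by
          intro l k
          have : (c.dual * c'.basis) * C = 1 := by
            rw [hC, Matrix.mul_assoc, ← Matrix.mul_assoc c'.basis, c'.basis_mul_dual,
              Matrix.one_mul, c.dual_mul_basis]
          rw [← Matrix.mul_apply, this, Matrix.one_apply]
        have e1 := hback i i
        have e2 := hback i i₀
        rw [if_pos rfl] at e1
        rw [if_neg hi] at e2
        have e3 : ∑ q, (c.dual * c'.basis) i q * C q i =
            m * ∑ q, (c.dual * c'.basis) i q * C q i₀ := by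
          rw [Finset.mul_sum]
          exact Finset.sum_congr rfl fun q _ => by rw [hm q]; ring
        rw [e1, e2, mul_zero] at e3
        exact one_ne_zero e3
      · left; exact hzi
    -- The height under the root is `‖z i₀‖²`, so the root combines with the phase of `z i₀` to `z
    -- i₀` or its conjugate.
    have hform2 : (fun z : Cn n => (Real.sqrt (c'.ht (c.base z) j) : ℂ) *
        ∏ i, phase (turn (z i)) ^ C j i) = fun z => ((‖z i₀‖ : ℂ) * phase (turn (z i₀)) ^ C j i₀) *
          ∏ i ∈ Finset.univ.erase i₀, phase (turn (z i)) ^ C j i := by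
      funext z
      rw [mul_assoc, Finset.mul_prod_erase Finset.univ (fun i => phase (turn (z i)) ^ C j i)
        (Finset.mem_univ i₀), ← h1, ht_base, Complex.normSq_eq_norm_sq,
        Real.sqrt_sq (norm_nonneg _)]
    rw [hform2]
    refine ContDiffAt.mul ?_ (contDiffAt_prod fun i hi => hfac i (hz0 i (Finset.ne_of_mem_erase hi)))
    rcases hC0 with h0 | h0 <;> rw [h0]
    · simp only [zpow_one, norm_mul_phase_turn]
      exact (contDiff_apply ℝ ℂ i₀).contDiffAt
    · simp only [norm_mul_phase_turn_inv]
      exact (Complex.conjCLE.contDiff.comp (contDiff_apply ℝ ℂ i₀)).contDiffAt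
  · refine ContDiffAt.mul ?_ (contDiffAt_prod fun i _ => hfac i ?_)
    · refine Complex.ofRealCLM.contDiff.contDiffAt.comp z (ContDiffAt.sqrt ?_ hj)
      have : ContDiff ℝ ∞ fun z : Cn n => c'.ht (c.base z) j := by
        have h5 : ContDiff ℝ ∞ fun z : Cn n => c'.ht (c.base z) :=
          (c'.lin.contDiff.comp c.contDiff_base).add contDiff_const
        exact (contDiff_apply ℝ ℝ j).comp (PiLp.contDiff_ofLp.comp h5)
      exact this.contDiffAt
    · by_cases hzi : z i = 0
      · right
        obtain ⟨j', h3, h4⟩ := hcol i hzi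
        refine h4 j ?_
        rintro rfl
        exact hj h3
      · left; exact hzi

end CornerFrame

/-! ### Orientation of the coordinate changes and the manifold given by compatible frames -/

namespace CornerFrame

variable {n s : ℕ} {Q : PolytopeWithHoles n s} {mu : Q.Facet → Fin n → ℤ}
  [Nonempty (Q.TorusSpace mu)]

/-- The coordinate change from `c` to `c'`. -/
def transition (c c' : CornerFrame n) (z : Cn n) : Cn n := c'.coord (c.ang z) (c.base z)

theorem Fits.transition_coord {c c' : CornerFrame n} (h : c.Fits Q mu) (h' : c'.Fits Q mu)
    {t : Torus n} {p : E n} (hp : p ∈ c.dom) (hp' : p ∈ c'.dom) (hb : p ∈ Q.body) :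
    c.transition c' (c.coord t p) = c'.coord t p := by
  have h1 := h.point_ang_base_coord (t := t) hp hb
  have h2 : c.base (c.coord t p) = p := c.base_coord (h.nonneg p hb)
  rw [transition]
  rw [h2, Q.point_eq_point_iff mu hb hb, h'.sub_mem_subtorus_iff hp' hb] at h1
  rw [h2]
  exact h1.2

theorem Fits.transition_transition {c c' : CornerFrame n} (h : c.Fits Q mu) (h' : c'.Fits Q mu)
    {z : Cn n} (hz : c.base z ∈ c.dom) (hz' : c.base z ∈ c'.dom) :
    c'.transition c (c.transition c' z) = z := by
  have hb := h.base_mem_body hz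
  conv_rhs => rw [← c.coord_ang_base z]
  exact h'.transition_coord h hz' hz hb

/-- In a frame's domain such points lie over the interior, so density lets weak inequalities for
determinants pass to points over faces. -/
theorem dense_forall_ne_zero : Dense {z : Cn n | ∀ i, z i ≠ 0} := by
  have h := dense_pi (ι := Fin n) univ (s := fun _ => ({0}ᶜ : Set ℂ))
    fun _ _ => dense_compl_singleton (0 : ℂ)
  exact Dense.mono (fun z (hz : z ∈ univ.pi fun _ => ({0}ᶜ : Set ℂ)) i => hz i (mem_univ i)) h

variable {ε : ℝ} {c c' : CornerFrame n}

/-- Over the interior the transition carries the coordinates of `c` to those of `c'`, both expressed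
in the same Cartesian and angular variables. The two determinants have the common sign of `ε`, so
their quotient is positive. -/
theorem Fits.det_transition_pos_of_ne_zero (h : c.Fits Q mu) (h' : c'.Fits Q mu)
    (ho : 0 < ε * c.orientation) (ho' : 0 < ε * c'.orientation) {z : Cn n}
    (hz : c.base z ∈ c.dom)
    (hs : ContDiffAt ℝ ∞ (c.transition c') z) (h0 : ∀ i, z i ≠ 0) :
    0 < (fderiv ℝ (c.transition c') z).det := by
  obtain ⟨q, hq⟩ := torusProj_surjective (c.ang z)
  set w : Cn n := fun i => ⟨c.base z i, q i⟩ with hw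
  have hre : rePart w = c.base z := rfl
  have han : angle w = c.ang z := by rw [← hq]; rfl
  have hpos : ∀ i, 0 < c.ht (rePart w) i := fun i => by
    rw [hre, ht_base]; exact Complex.normSq_pos.2 (h0 i)
  have hint : rePart w ∈ interior Q.body := h.mem_interior_of_pos hz hpos
  have hcw : c.interiorCoord w = z := by rw [interiorCoord, hre, han, coord_ang_base]
  have heq : c.transition c' ∘ c.interiorCoord =ᶠ[𝓝 w] c'.interiorCoord := by
    have h1 : ∀ᶠ w' in 𝓝 w, rePart w' ∈ interior Q.body :=
      continuous_rePart.continuousAt.eventually_mem (isOpen_interior.mem_nhds hint)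
    filter_upwards [h1] with w' hw'
    exact h.transition_coord h' (h.interior_subset hw') (h'.interior_subset hw')
      (_root_.interior_subset hw')
  obtain ⟨r, hr, hr'⟩ := c.det_fderiv_interiorCoord hpos
  obtain ⟨r', hr1, hr1'⟩ := c'.det_fderiv_interiorCoord (h'.pos _ hint)
  have hd : fderiv ℝ (c.transition c' ∘ c.interiorCoord) w =
      (fderiv ℝ (c.transition c') (c.interiorCoord w)).comp (fderiv ℝ c.interiorCoord w) :=
    fderiv_comp w (by rw [hcw]; exact hs.differentiableAt (by simp))
      ((c.contDiffAt_interiorCoord hpos).differentiableAt (by simp))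
  rw [heq.fderiv_eq, hcw] at hd
  have hdet := congrArg ContinuousLinearMap.det hd
  rw [ContinuousLinearMap.det_comp', hr1', hr'] at hdet
  have h2 : 0 < (fderiv ℝ (c.transition c') z).det * (r * (ε * c.orientation)) := by
    calc 0 < r' * (ε * c'.orientation) := mul_pos hr1 ho'
      _ = _ := by linear_combination ε * hdet
  exact pos_of_mul_pos_left h2 (mul_pos hr ho).le

/-- By continuity from the dense set without vanishing coordinates the determinant is nonnegative;
it is nonzero because the reverse transition is a smooth local inverse. -/
theorem Fits.orientedAt_transition (h : c.Fits Q mu) (h' : c'.Fits Q mu)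
    (ho : 0 < ε * c.orientation) (ho' : 0 < ε * c'.orientation)
    (hcc : ∀ p ∈ Q.body, p ∈ c.dom → p ∈ c'.dom → CompatAt c c' p ∧ CompatAt c' c p) {z : Cn n}
    (hz : c.base z ∈ c.dom) (hz' : c.base z ∈ c'.dom) :
    OrientedAt n (c.transition c') z := by
  have hsm : ∀ z, c.base z ∈ c.dom → c.base z ∈ c'.dom →
      ContDiffAt ℝ ∞ (c.transition c') z := fun z hz hz' =>
    contDiffAt_transition (hcc _ (h.base_mem_body hz) hz hz').1 (hcc _ (h.base_mem_body hz) hz hz').2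
  have hnear : ∀ᶠ y in 𝓝 z, c.base y ∈ c.dom ∧ c.base y ∈ c'.dom :=
    (c.continuous_base.continuousAt.eventually_mem (c.isOpen_dom.mem_nhds hz)).and
      (c.continuous_base.continuousAt.eventually_mem (c'.isOpen_dom.mem_nhds hz'))
  refine orientedAt_of_fderiv (hsm z hz hz') (lt_of_le_of_ne ?_ ?_)
  · have hcont : ContinuousAt (fun y => (fderiv ℝ (c.transition c') y).det) z :=
      ContinuousLinearMap.continuous_det.continuousAt.comp
        ((hsm z hz hz').fderiv_right (m := 0) (by simp)).continuousAt
    by_contra hneg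
    have h1 := (hcont.eventually_lt_const (not_le.1 hneg)).and hnear
    obtain ⟨y, hy0, hy⟩ := (dense_forall_ne_zero (n := n)).inter_nhds_nonempty h1
    exact absurd (h.det_transition_pos_of_ne_zero h' ho ho' hy.2.1
      (hsm y hy.2.1 hy.2.2) hy0) (not_lt.2 hy.1.le)
  · intro hdet
    have hb := h.base_mem_body hz
    have hbt : c'.base (c.transition c' z) = c.base z := c'.base_coord (h'.nonneg _ hb)
    have hs' : ContDiffAt ℝ ∞ (c'.transition c) (c.transition c' z) := by
      refine contDiffAt_transition ?_ ?_ <;> rw [hbt]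
      exacts [(hcc _ hb hz hz').2, (hcc _ hb hz hz').1]
    have hid : c'.transition c ∘ c.transition c' =ᶠ[𝓝 z] id :=
      hnear.mono fun y hy => h.transition_transition h' hy.1 hy.2
    have hd := fderiv_comp z (hs'.differentiableAt (by simp))
      ((hsm z hz hz').differentiableAt (by simp))
    rw [hid.fderiv_eq, fderiv_id] at hd
    have hdet' := congrArg ContinuousLinearMap.det hd
    rw [ContinuousLinearMap.det_comp', ← hdet, mul_zero] at hdet'
    have : (ContinuousLinearMap.id ℝ (Cn n)).det = 1 := LinearMap.det_id
    rw [this] at hdet'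
    exact one_ne_zero hdet'

/-- A compatible family of frames turns `M(Q, μ)` into an oriented smooth manifold. -/
theorem exists_structure {ι : Type} (c : ι → CornerFrame n) (hc : IsCompact Q.body)
    (hfit : ∀ i, (c i).Fits Q mu) (cover : ∀ p ∈ Q.body, ∃ i, p ∈ (c i).dom)
    (compat : ∀ i j, ∀ p ∈ Q.body, p ∈ (c i).dom → p ∈ (c j).dom → CompatAt (c i) (c j) p)
    (hor : ∀ i, 0 < ε * (c i).orientation) :
    ∃ _ : ChartedSpace (Cn n) (Q.TorusSpace mu),
      IsOrientedSmoothTorusManifold n (Q.TorusSpace mu) ∧ Q.HasStandardInterior mu ε := by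
  obtain ⟨cs, hman, hJ⟩ := exists_glued (n := n) (M := fun _ : ι => Cn n) (X := Q.TorusSpace mu)
    (fun _ => inferInstance) (fun _ => isOrientedAtlas_model) (fun i => (hfit i).param hc)
    (fun m => cover _ (Q.orbitMap_mem mu m))
    (by
      intro i j z hz hz'
      have hz1 : (c i).base z ∈ (c i).dom := hz
      have hb := (hfit i).base_mem_body hz1
      have hz2 : (c i).base z ∈ (c j).dom := by
        have h1 : Q.orbitMap mu ((hfit i).param hc z) ∈ (c j).dom := hz'
        rwa [(hfit i).param_apply, Q.orbitMap_point mu hb] at h1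
      refine ((hfit i).orientedAt_transition (hfit j) (hor i) (hor j)
        (fun p hp h1 h2 => ⟨compat i j p hp h1 h2, compat j i p hp h2 h1⟩) hz1 hz2).congr ?_
      have hnear : ∀ᶠ y in 𝓝 z, (c i).base y ∈ (c i).dom ∧ (c i).base y ∈ (c j).dom :=
        ((c i).continuous_base.continuousAt.eventually_mem ((c i).isOpen_dom.mem_nhds hz1)).and
          ((c i).continuous_base.continuousAt.eventually_mem ((c j).isOpen_dom.mem_nhds hz2))
      filter_upwards [hnear] with y hy
      have hby := (hfit i).base_mem_body hy.1
      rw [Function.comp_apply, (hfit i).param_apply, (hfit j).param_symm_point hc hy.2 hby]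
      rfl)
    (fun i => (c i).rotate)
    (fun i => by
      rw [← modelWithCornersSelf_prod, chartedSpaceSelf_prod]
      exact (c i).contDiff_rotate.contMDiff)
    (fun i q z hz => by
      have hz1 : (c i).base z ∈ (c i).dom := hz
      have : (c i).base ((c i).rotate (q, z)) ∈ (c i).dom := by rwa [base_rotate]
      exact this)
    (fun i q z hz => (hfit i).param_rotate hc q hz)
  refine ⟨cs, hman, fun w => Q.point mu (angle w) (rePart w),
    fun w hw => Q.point_of_mem mu hw, ?_⟩
  -- Near an interior point the standard parametrization is `interiorCoord` followed by an oriented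
  -- inverse chart, so its Jacobian has the sign of the frame's orientation.
  have key : ∀ w : Cn n, rePart w ∈ interior Q.body → ∃ i,
      (∀ᶠ w' in 𝓝 w, Q.point mu (angle w') (rePart w') =
        ((hfit i).param hc ∘ (c i).interiorCoord) w') ∧
      OrientedAt n ((hfit i).param hc) ((c i).interiorCoord w) := by
    intro w hw
    obtain ⟨i, hi⟩ := cover _ (_root_.interior_subset hw)
    refine ⟨i, ?_, ?_⟩
    · have h1 : ∀ᶠ w' in 𝓝 w, rePart w' ∈ interior Q.body :=
        continuous_rePart.continuousAt.eventually_mem (isOpen_interior.mem_nhds hw)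
      filter_upwards [h1] with w' hw'
      exact ((hfit i).param_coord hc ((hfit i).interior_subset hw') (_root_.interior_subset hw')).symm
    · refine hJ i _ ?_
      have : (c i).base ((c i).coord (angle w) (rePart w)) ∈ (c i).dom := by
        rwa [base_coord _ ((hfit i).nonneg _ (_root_.interior_subset hw))]
      exact this
  constructor
  · intro w hw
    obtain ⟨i, h1, h2⟩ := key w hw
    refine ContMDiffAt.contMDiffWithinAt ?_
    refine (h2.1.comp w ((c i).contDiffAt_interiorCoord
      ((hfit i).pos _ hw)).contMDiffAt).congr_of_eventuallyEq h1
  · intro w hw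
    obtain ⟨i, h1, h2⟩ := key w hw
    obtain ⟨r, hr, hr'⟩ := (c i).det_fderiv_interiorCoord ((hfit i).pos _ hw)
    rw [jacobian_congr h1, jacobian_comp h2.1 ((c i).contDiffAt_interiorCoord
      ((hfit i).pos _ hw)).contMDiffAt, jacobian_eq_det_fderiv, hr']
    calc 0 < jacobian n ((hfit i).param hc) ((c i).interiorCoord w) *
          (r * (ε * (c i).orientation)) := mul_pos h2.2 (mul_pos hr (hor i))
      _ = _ := by ring

end CornerFrame

/-! ### The frames of a simple polytope at its vertices -/

namespace PolytopeWithHoles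

variable {n s : ℕ}

/-- A facet of a summand, as a facet of the polytope with holes. -/
def summandFacet (P : PolytopeWithHoles n s) (k : Fin (s + 1)) (F : (P.summand k).Facet) :
    P.Facet := ⟨F.1, k, F.2.elim fun _ h => h⟩

theorem IsCharacteristic.restrict {P : PolytopeWithHoles n s} {lam : P.Facet → Fin n → ℤ}
    (h : P.IsCharacteristic lam) (k : Fin (s + 1)) :
    (P.summand k).IsCharacteristic (P.restrict lam k) := by
  intro S hS hdim
  let j : (P.summand k).Facet ↪ P.Facet :=
    ⟨P.summandFacet k, fun F G hFG => Subtype.ext (congrArg (fun F : P.Facet => F.1) hFG)⟩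
  have h1 : (⋂ F ∈ S.map j, F.1) = ⋂ F ∈ S, F.1 := by
    ext x
    simp only [Finset.mem_map, mem_iInter]
    exact ⟨fun hx F hF => hx (j F) ⟨F, hF, rfl⟩, by rintro hx _ ⟨F, hF, rfl⟩; exact hx F hF⟩
  have h2 : lam '' (S.map j : Set P.Facet) = P.restrict lam k '' (S : Set (P.summand k).Facet) := by
    rw [Finset.coe_map, image_image]; rfl
  have h3 := h (S.map j) (by rwa [h1]) (by rwa [h1, Finset.card_map])
  rwa [h2, Finset.card_map] at h3

theorem body_eq_piece (Q : PolytopeWithHoles n 0) : Q.body = Q.piece 0 := by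
  rw [body]
  have : (⋃ k : Fin 0, interior (Q.piece k.succ)) = ∅ := iUnion_of_empty _
  rw [this, sdiff_empty]

theorem facet_prop (Q : PolytopeWithHoles n 0) (F : Q.Facet) : IsFacet (Q.piece 0) F.1 := by
  obtain ⟨k, hk⟩ := F.2
  rwa [Fin.fin_one_eq_zero k] at hk

variable {Q : PolytopeWithHoles n 0} {mu : Q.Facet → Fin n → ℤ}

/-- The characteristic vectors of the facets through a vertex form a basis of `ℤⁿ`. -/
theorem IsCharacteristic.exists_dual (hmu : Q.IsCharacteristic mu) {v : E n}
    (hv : v ∈ (Q.piece 0).extremePoints ℝ) {F : Fin n → Q.Facet} (hinj : Function.Injective F)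
    (hF : range (fun i => (F i).1) = {G | IsFacet (Q.piece 0) G ∧ v ∈ G}) :
    ∃ B : Matrix (Fin n) (Fin n) ℤ, (Matrix.of fun i => mu (F i)).transpose * B = 1 := by
  have hP := Q.simple 0
  set S : Finset Q.Facet := Finset.univ.map ⟨F, hinj⟩ with hS
  have hcard : S.card = n := by simp [hS]
  -- A second common point would differ from `v` by a vector annihilated by all normals at `v`.
  -- Hence the characteristic condition applies to all `n` facets, with a face of dimension zero.
  have hint : (⋂ G ∈ S, G.1) = {v} := by
    ext p
    simp only [mem_iInter, mem_singleton_iff]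
    constructor
    · intro hp
      have h1 : ∀ G, IsFacet (Q.piece 0) G → v ∈ G → p ∈ G := by
        intro G hG hvG
        obtain ⟨i, rfl⟩ : G ∈ range (fun i => (F i).1) := by rw [hF]; exact ⟨hG, hvG⟩
        exact hp (F i) (by simp [hS])
      have h2 : p - v = 0 := by
        refine eq_zero_of_facetNormal_eq_zero hP hv fun G hG hvG => ?_
        have h3 := (mem_facet_iff hP hG (facet_subset hP hG (h1 G hG hvG))).1 (h1 G hG hvG)
        have h4 := (mem_facet_iff hP hG hv.1).1 hvG
        have h5 := facetHeight_add (Q.piece 0) G v (p - v)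
        rw [add_sub_cancel, h3, h4] at h5
        linarith
      exact sub_eq_zero.1 h2
    · rintro rfl G hG
      obtain ⟨i, -, rfl⟩ := Finset.mem_map.1 hG
      have : (F i).1 ∈ range (fun i => (F i).1) := ⟨i, rfl⟩
      rw [hF] at this
      exact this.2
  have hfin : Module.finrank ℝ (vectorSpan ℝ ({v} : Set (E n))) = 0 := by
    rw [vectorSpan_singleton]; simp
  obtain ⟨hrank, C, hC⟩ := hmu S (by rw [hint]; exact singleton_nonempty v)
    (by rw [hint, hfin, hcard, zero_add])
  have himg : mu '' (S : Set Q.Facet) = range fun i => mu (F i) := by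
    rw [hS, Finset.coe_map, Finset.coe_univ, image_univ, ← range_comp]
    rfl
  rw [himg] at hC hrank
  -- A direct summand of rank `n` has a complement of rank zero; without the summand condition the
  -- span could have finite index.
  have htop : Submodule.span ℤ (range fun i => mu (F i)) = ⊤ := by
    have h1 := (Submodule.prodEquivOfIsCompl _ _ hC).finrank_eq
    rw [Module.finrank_prod, hrank, hcard, Module.finrank_fin_fun] at h1
    have h2 : Module.finrank ℤ C = 0 := by omega
    have h3 : C = ⊥ := Submodule.finrank_eq_zero.1 h2
    rw [h3] at hC
    exact eq_top_of_isCompl_bot hC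
  have hex : ∀ k : Fin n, ∃ b : Fin n → ℤ, ∑ i, b i • mu (F i) = Pi.single k 1 := fun k =>
    (Submodule.mem_span_range_iff_exists_fun ℤ).1 (by rw [htop]; trivial)
  choose b hb using hex
  refine ⟨Matrix.of fun i k => b k i, ?_⟩
  ext j k
  have := congrFun (hb k) j
  simp only [Finset.sum_apply, Pi.smul_apply, smul_eq_mul] at this
  rw [Matrix.mul_apply, Matrix.one_apply]
  simp only [Matrix.transpose_apply, Matrix.of_apply]
  rw [Pi.single_apply] at this
  rw [← this]
  exact Finset.sum_congr rfl fun i _ => mul_comm _ _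

/-- The frame at the vertex `v` of a simple polytope, with a prescribed orientation. -/
theorem exists_vertex_frame (hn : 1 ≤ n) (hmu : Q.IsCharacteristic mu) {ε : ℝ} (hε : ε ≠ 0)
    {v : E n} (hv : v ∈ (Q.piece 0).extremePoints ℝ) :
    ∃ c : CornerFrame n, ∃ F : Fin n → Q.Facet,
      range (fun i => (F i).1) = {G | IsFacet (Q.piece 0) G ∧ v ∈ G} ∧
      (∀ p i, c.ht p i = facetHeight (Q.piece 0) (F i).1 p) ∧
      (∀ i, c.basis.transpose i = mu (F i) ∨ c.basis.transpose i = -mu (F i)) ∧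
      c.dom = {p | ∀ G, IsFacet (Q.piece 0) G → v ∉ G → 0 < facetHeight (Q.piece 0) G p} ∧
      0 < ε * c.orientation := by
  have hP := Q.simple 0
  obtain ⟨σ, hσinj, hσ⟩ := exists_facet_enumeration hP hv
  have hσF : ∀ i, IsFacet (Q.piece 0) (σ i) := fun i => by
    have : σ i ∈ range σ := ⟨i, rfl⟩
    rw [hσ] at this; exact this.1
  obtain ⟨L, hL⟩ := exists_vertex_linearEquiv hP hv hσ
  set F : Fin n → Q.Facet := fun i => ⟨σ i, 0, hσF i⟩ with hF
  have hFinj : Function.Injective F := fun i j hij => hσinj (congrArg Subtype.val hij)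
  obtain ⟨B, hB⟩ := hmu.exists_dual hv hFinj hσ
  set A := (Matrix.of fun i => mu (F i)).transpose with hA
  have hB' : B * A = 1 := mul_eq_one_comm.1 hB
  have hAi : ∀ i, A.transpose i = mu (F i) := fun i => by rw [hA, Matrix.transpose_transpose]; rfl
  let lin : E n ≃L[ℝ] E n := (L.trans (WithLp.linearEquiv 2 ℝ (Fin n → ℝ)).symm).toContinuousLinearEquiv
  have hlin : ∀ p i, lin p i = facetNormal (Q.piece 0) (σ i) p := fun p i => hL p i
  have hopen : IsOpen {p | ∀ G, IsFacet (Q.piece 0) G → v ∉ G → 0 < facetHeight (Q.piece 0) G p} := by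
    have : {p | ∀ G, IsFacet (Q.piece 0) G → v ∉ G → 0 < facetHeight (Q.piece 0) G p} =
        ⋂ G ∈ {G | IsFacet (Q.piece 0) G ∧ v ∉ G}, {p | 0 < facetHeight (Q.piece 0) G p} := by
      ext p
      simp only [mem_ofPred_eq, mem_iInter, and_imp]
    rw [this]
    refine ((finite_facets hP).subset fun G hG => hG.1).isOpen_biInter fun G _ => ?_
    exact isOpen_lt continuous_const (continuous_facetHeight _ _)
  -- The diagonal sign matrix `D` reverses some basis vectors. The spans are unaffected, while the
  -- determinant of the dual basis is multiplied by `det D`.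
  have hmain : ∀ D : Matrix (Fin n) (Fin n) ℤ, ∀ e : Fin n → ℤ, D = Matrix.diagonal e →
      (∀ i, e i = 1 ∨ e i = -1) → 0 < ε * ((lin : E n →L[ℝ] E n).det * ((D * B).det : ℝ)) →
      ∃ c : CornerFrame n, ∃ F : Fin n → Q.Facet,
      range (fun i => (F i).1) = {G | IsFacet (Q.piece 0) G ∧ v ∈ G} ∧
      (∀ p i, c.ht p i = facetHeight (Q.piece 0) (F i).1 p) ∧
      (∀ i, c.basis.transpose i = mu (F i) ∨ c.basis.transpose i = -mu (F i)) ∧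
      c.dom = {p | ∀ G, IsFacet (Q.piece 0) G → v ∉ G → 0 < facetHeight (Q.piece 0) G p} ∧
      0 < ε * c.orientation := by
    intro D e hD he hpos
    have hDD : D * D = 1 := by
      rw [hD, Matrix.diagonal_mul_diagonal, ← Matrix.diagonal_one]
      congr 1
      ext i
      rcases he i with h | h <;> rw [h] <;> rfl
    refine ⟨⟨lin, WithLp.toLp 2 fun i => facetHeight (Q.piece 0) (σ i) 0, A * D, D * B, ?_, ?_, _,
      hopen⟩, F, hσ, ?_, ?_, rfl, hpos⟩
    · rw [Matrix.mul_assoc, ← Matrix.mul_assoc D, hDD, Matrix.one_mul, hB]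
    · rw [Matrix.mul_assoc, ← Matrix.mul_assoc B, hB', Matrix.one_mul, hDD]
    · intro p i
      exact (congrArg (· + facetHeight (Q.piece 0) (σ i) 0) (hlin p i)).trans
        ((add_comm _ _).trans (facetHeight_eq _ _ _).symm)
    · intro i
      have h1 : (A * D).transpose i = e i • A.transpose i := by
        ext k
        rw [Matrix.transpose_apply, hD, Matrix.mul_diagonal, Pi.smul_apply, Matrix.transpose_apply,
          smul_eq_mul, mul_comm]
      rcases he i with h | h <;> simp only [h1, h, hAi]
      · left; simp
      · right; simp
  have hdetB : (B.det : ℝ) ≠ 0 := by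
    have h1 := congrArg Matrix.det hB
    rw [Matrix.det_mul, Matrix.det_one] at h1
    exact_mod_cast right_ne_zero_of_mul_eq_one h1
  have hdetL : (lin : E n →L[ℝ] E n).det ≠ 0 := (LinearEquiv.isUnit_det' lin.toLinearEquiv).ne_zero
  rcases lt_or_gt_of_ne (mul_ne_zero hε (mul_ne_zero hdetL hdetB)) with hneg | hpos
  -- The sign is wrong, so one basis vector is reversed; it exists because `n ≥ 1`.
  · refine hmain _ (Function.update 1 ⟨0, hn⟩ (-1)) rfl (fun i => ?_) ?_
    · by_cases hi : i = ⟨0, hn⟩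
      · subst hi; right; simp
      · left; simp [hi]
    · rw [Matrix.det_mul, Matrix.det_diagonal, Finset.prod_update_of_mem (Finset.mem_univ _)]
      simp only [Pi.one_apply, Finset.prod_const_one, mul_one]
      rw [Int.cast_mul, Int.cast_neg, Int.cast_one]
      linarith
  · refine hmain 1 1 Matrix.diagonal_one.symm (fun i => Or.inl rfl) ?_
    rwa [Matrix.one_mul]

/-- On the domain every facet that misses `v` has positive height. Membership in the polytope and
the facets through a point are then decided by the `n` heights at `v`, and signs of basis vectors do
not change spans. -/
theorem vertex_frame_fits {v : E n} {c : CornerFrame n} {F : Fin n → Q.Facet}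
    (hF : range (fun i => (F i).1) = {G | IsFacet (Q.piece 0) G ∧ v ∈ G})
    (hht : ∀ p i, c.ht p i = facetHeight (Q.piece 0) (F i).1 p)
    (hbasis : ∀ i, c.basis.transpose i = mu (F i) ∨ c.basis.transpose i = -mu (F i))
    (hdom : c.dom = {p | ∀ G, IsFacet (Q.piece 0) G → v ∉ G → 0 < facetHeight (Q.piece 0) G p}) :
    c.Fits Q mu := by
  have hP := Q.simple 0
  have hbody := Q.body_eq_piece
  refine ⟨?_, ?_, ?_, ?_, ?_⟩
  · intro p hp i
    rw [hht]
    exact facetHeight_nonneg hP (Q.facet_prop _) (hbody ▸ hp)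
  · intro p hp i
    rw [hht]
    exact facetHeight_pos_of_interior hP (Q.facet_prop _) (hbody ▸ hp)
  · intro p hp
    rw [hdom]
    exact fun G hG _ => facetHeight_pos_of_interior hP hG (hbody ▸ hp)
  · intro p hp hp0
    rw [hdom] at hp
    rw [hbody, mem_iff_facetHeight_nonneg hP]
    intro G hG
    by_cases hvG : v ∈ G
    · obtain ⟨i, rfl⟩ : G ∈ range (fun i => (F i).1) := by rw [hF]; exact ⟨hG, hvG⟩
      rw [← hht]; exact hp0 i
    · exact (hp G hG hvG).le
  · intro p hp hpb
    rw [hdom] at hp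
    rw [hbody] at hpb
    apply le_antisymm <;> rw [faceModule, Submodule.span_le]
    · rintro _ ⟨G, hpG, rfl⟩
      have hG := Q.facet_prop G
      have h0 := (mem_facet_iff hP hG hpb).1 hpG
      have hvG : v ∈ G.1 := by
        by_contra hvG
        exact (hp _ hG hvG).ne' h0
      obtain ⟨i, hi⟩ : G.1 ∈ range (fun i => (F i).1) := by rw [hF]; exact ⟨hG, hvG⟩
      have hi' : F i = G := Subtype.ext hi
      have h1 : c.basis.transpose i ∈ Submodule.span ℤ
          ((fun i => c.basis.transpose i) '' {i | c.ht p i = 0}) :=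
        Submodule.subset_span ⟨i, by rw [mem_ofPred_eq, hht, hi', h0], rfl⟩
      rcases hbasis i with h | h <;> rw [h, hi'] at h1
      · exact h1
      · simpa using h1
    · rintro _ ⟨i, hi, rfl⟩
      rw [mem_ofPred_eq, hht] at hi
      have h1 : mu (F i) ∈ Submodule.span ℤ (mu '' {G : Q.Facet | p ∈ G.1}) :=
        Submodule.subset_span ⟨F i, (mem_facet_iff hP (Q.facet_prop _) hpb).2 hi, rfl⟩
      rcases hbasis i with h | h <;> simp only [h]
      · exact h1
      · simpa using h1

/-- The quasitoric manifold of a simple polytope. -/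
theorem exists_quasitoric_structure (hn : 1 ≤ n) [Nonempty (Q.TorusSpace mu)]
    (hmu : Q.IsCharacteristic mu) {ε : ℝ} (hε : ε ≠ 0) :
    ∃ _ : ChartedSpace (Cn n) (Q.TorusSpace mu),
      IsOrientedSmoothTorusManifold n (Q.TorusSpace mu) ∧ Q.HasStandardInterior mu ε := by
  have hP := Q.simple 0
  have hbody := Q.body_eq_piece
  choose c F hF hht hbasis hdom hor using
    fun v : (Q.piece 0).extremePoints ℝ => exists_vertex_frame hn hmu hε v.2
  refine CornerFrame.exists_structure c (by rw [hbody]; exact hP.isCompact)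
    (fun v => vertex_frame_fits (hF v) (hht v) (hbasis v) (hdom v)) ?_ ?_ hor
  · intro p hp
    rw [hbody] at hp
    obtain ⟨v, hv, hv'⟩ := exists_vertex hP hp
    refine ⟨⟨v, hv⟩, ?_⟩
    rw [hdom]
    intro G hG hvG
    exact lt_of_le_of_ne (facetHeight_nonneg hP hG hp)
      fun h0 => hvG (hv' G hG ((mem_facet_iff hP hG hp).2 h0.symm))
  -- A facet of vanishing height at `p` must contain `v'` too, since `p` is in the domain of `v'`.
  -- Its height is thus a coordinate of both frames, with the same characteristic vector up to sign.
  · intro v v' p hp hpv hpv' i hi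
    rw [hbody] at hp
    rw [hht] at hi
    rw [hdom] at hpv'
    have hG := Q.facet_prop (F v i)
    have hv' : (v' : E n) ∈ (F v i).1 := by
      by_contra h
      exact (hpv' _ hG h).ne' hi
    obtain ⟨j, hj⟩ : (F v i).1 ∈ range (fun i => (F v' i).1) := by rw [hF]; exact ⟨hG, hv'⟩
    have hj' : F v' j = F v i := Subtype.ext hj
    refine ⟨j, fun q => by rw [hht, hht, hj'], ?_⟩
    rcases hbasis v i with h1 | h1 <;> rcases hbasis v' j with h2 | h2 <;> rw [h1, h2, hj']
    · left; rfl
    · right; rfl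
    · right; simp
    · left; rfl

end PolytopeWithHoles

/-! ### Radial homeomorphisms -/

/-- A gauge `N` of the convex body `K` with respect to the interior point `x`, the radius `ε` of
a small ball around `x`, and a small parameter `δ`. -/
structure RadialData {n : ℕ} (K : Set (E n)) (x : E n) where
  N : E n → ℝ
  ε : ℝ
  δ : ℝ
  continuous_N : Continuous N
  N_smul : ∀ r : ℝ, 0 ≤ r → ∀ v, N (x + r • v) = r * N (x + v)
  N_le_one_iff : ∀ p, N p ≤ 1 ↔ p ∈ K
  N_lt_one_iff : ∀ p, N p < 1 ↔ p ∈ interior K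
  N_pos : ∀ p, p ≠ x → 0 < N p
  ε_pos : 0 < ε
  ε_mul_N_le : ∀ p, 2 * (ε * N p) ≤ ‖p - x‖
  δ_pos : 0 < δ
  δ_lt_one : δ < 1

/-- The function is the Minkowski gauge of `K - x`. If a ball of radius `r` about `x` lies in `K`,
then `ε = r / 2` leaves the factor 2, which keeps the closed ball of radius `ε` in the interior. -/
theorem exists_gauge {n : ℕ} {K : Set (E n)} {x : E n} (hK : Convex ℝ K) (hKc : IsCompact K)
    (hx : x ∈ interior K) :
    ∃ N : E n → ℝ, ∃ ε : ℝ, Continuous N ∧ (∀ r : ℝ, 0 ≤ r → ∀ v, N (x + r • v) = r * N (x + v)) ∧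
      (∀ p, N p ≤ 1 ↔ p ∈ K) ∧ (∀ p, N p < 1 ↔ p ∈ interior K) ∧ (∀ p, p ≠ x → 0 < N p) ∧
      0 < ε ∧ ∀ p, 2 * (ε * N p) ≤ ‖p - x‖ := by
  let h : E n ≃ₜ E n := Homeomorph.addRight (-x)
  set K' : Set (E n) := h '' K with hK'
  have hmem : ∀ p, p - x ∈ K' ↔ p ∈ K := fun p => by
    rw [sub_eq_add_neg]; exact h.injective.mem_set_image
  have hint : ∀ p, p - x ∈ interior K' ↔ p ∈ interior K := fun p => by
    rw [hK', ← h.image_interior, sub_eq_add_neg]; exact h.injective.mem_set_image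
  have hconv : Convex ℝ K' := by
    have : K' = (fun z => z + -x) '' K := rfl
    rw [this]
    simpa [add_comm] using hK.translate (-x)
  have hcomp : IsCompact K' := hKc.image h.continuous
  have h0 : K' ∈ 𝓝 0 := by
    rw [← mem_interior_iff_mem_nhds, ← sub_self x, hint]; exact hx
  have habs : Absorbent ℝ K' := absorbent_nhds_zero h0
  obtain ⟨r, hr, hball⟩ := Metric.mem_nhds_iff.1 h0
  refine ⟨fun p => gauge K' (p - x), r / 2, (continuous_gauge hconv h0).comp (by fun_prop), ?_, ?_,
    ?_, ?_, by positivity, ?_⟩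
  · intro t ht v
    simp only [add_sub_cancel_left]
    rw [gauge_smul_of_nonneg ht, smul_eq_mul]
  · intro p
    rw [gauge_le_one_iff_mem_closure hconv h0, hcomp.isClosed.closure_eq, hmem]
  · intro p
    rw [gauge_lt_one_iff_mem_interior hconv h0, hint]
  · intro p hp
    exact (gauge_pos habs ((NormedSpace.isVonNBounded_iff ℝ).2 hcomp.isBounded)).2 (sub_ne_zero.2 hp)
  · intro p
    have := mul_gauge_le_norm (x := p - x) hball
    linarith

namespace RadialData

variable {n : ℕ} {K : Set (E n)} {x : E n} (D : RadialData K x)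

theorem N_center : D.N x = 0 := by simpa using D.N_smul 0 le_rfl 0

theorem N_nonneg (p : E n) : 0 ≤ D.N p := by
  by_cases hp : p = x
  · rw [hp, D.N_center]
  · exact (D.N_pos p hp).le

theorem ne_center_of_N_pos {p : E n} (h : 0 < D.N p) : p ≠ x := by
  rintro rfl
  rw [D.N_center] at h
  exact lt_irrefl _ h

/-- The point of gauge `r` on the ray from `x` through `p`. -/
def level (r : ℝ) (p : E n) : E n := x + (r / D.N p) • (p - x)

theorem level_center (r : ℝ) : D.level r x = x := by simp [level]

theorem level_N (p : E n) : D.level (D.N p) p = p := by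
  by_cases hp : p = x
  · rw [hp, level_center]
  · rw [level, div_self (D.N_pos p hp).ne', one_smul, add_sub_cancel]

theorem N_level {r : ℝ} (hr : 0 ≤ r) {p : E n} (hp : p ≠ x) : D.N (D.level r p) = r := by
  have h := D.N_pos p hp
  rw [level, D.N_smul _ (div_nonneg hr h.le), add_sub_cancel, div_mul_cancel₀ _ h.ne']

theorem level_ne_center {r : ℝ} (hr : 0 < r) {p : E n} (hp : p ≠ x) : D.level r p ≠ x :=
  D.ne_center_of_N_pos (by rwa [D.N_level hr.le hp])

theorem level_sub (r : ℝ) (p : E n) : D.level r p - x = (r / D.N p) • (p - x) := by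
  rw [level, add_sub_cancel_left]

theorem level_level {r r' : ℝ} (hr : 0 < r) {p : E n} (hp : p ≠ x) :
    D.level r' (D.level r p) = D.level r' p := by
  have h := (D.N_pos p hp).ne'
  rw [level, D.N_level hr.le hp, level_sub, smul_smul, div_mul_div_cancel₀ hr.ne', level]

/-- The gauge of the point at distance `ε` from `x` on the ray through `p`. -/
def a (p : E n) : ℝ := D.ε * D.N p / ‖p - x‖

theorem a_pos {p : E n} (hp : p ≠ x) : 0 < D.a p :=
  div_pos (mul_pos D.ε_pos (D.N_pos p hp)) (norm_pos_iff.2 (sub_ne_zero.2 hp))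

theorem a_lt_one (p : E n) : D.a p < 1 := by
  by_cases hp : p = x
  · simp [a, hp]
  · have h1 := norm_pos_iff.2 (sub_ne_zero.2 hp)
    rw [a, div_lt_one h1]
    have := D.ε_mul_N_le p
    have := mul_pos D.ε_pos (D.N_pos p hp)
    linarith

theorem a_level {r : ℝ} (hr : 0 < r) {p : E n} (hp : p ≠ x) : D.a (D.level r p) = D.a p := by
  have h := D.N_pos p hp
  have h1 := norm_pos_iff.2 (sub_ne_zero.2 hp)
  rw [a, a, D.N_level hr.le hp, level_sub, norm_smul, Real.norm_of_nonneg (div_pos hr h).le]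
  field_simp

theorem continuousOn_a : ContinuousOn D.a {x}ᶜ := by
  refine ContinuousOn.div ((continuous_const.mul D.continuous_N).continuousOn) (by fun_prop) ?_
  intro p hp
  exact norm_ne_zero_iff.2 (sub_ne_zero.2 hp)

theorem continuousOn_level {f : E n → ℝ} {S : Set (E n)} (hS : S ⊆ {x}ᶜ) (hf : ContinuousOn f S) :
    ContinuousOn (fun p => D.level (f p) p) S := by
  unfold level
  refine continuousOn_const.add (ContinuousOn.smul (hf.div D.continuous_N.continuousOn
    fun p hp => (D.N_pos p (hS hp)).ne') (by fun_prop))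

/-- The gauge at which the image of the ray through `p` under `outer` begins. -/
def β (p : E n) : ℝ := 1 + D.δ * (1 - D.a p)

/-- Beyond this gauge, `outer` is the identity. -/
def c : ℝ := (1 + D.δ) / (1 - D.δ)

theorem one_lt_β (p : E n) : 1 < D.β p := by
  have := mul_pos D.δ_pos (sub_pos.2 (D.a_lt_one p))
  unfold β; linarith

theorem β_lt {p : E n} (hp : p ≠ x) : D.β p < 1 + D.δ := by
  have := mul_pos D.δ_pos (D.a_pos hp)
  unfold β; linarith

theorem β_level {r : ℝ} (hr : 0 < r) {p : E n} (hp : p ≠ x) : D.β (D.level r p) = D.β p := by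
  rw [β, D.a_level hr hp, β]

theorem c_mul : D.c * (1 - D.δ) = 1 + D.δ :=
  div_mul_cancel₀ _ (sub_pos.2 D.δ_lt_one).ne'

theorem one_add_δ_lt_c : 1 + D.δ < D.c := by
  rw [c, lt_div_iff₀ (sub_pos.2 D.δ_lt_one)]
  nlinarith [D.δ_pos]

/-- The homeomorphism from the complement of `x` to the complement of a neighborhood of `K`. -/
def outer (p : E n) : E n := D.level (max (D.N p) (D.β p + D.δ * D.N p)) p

/-- The inverse of `outer`. -/
def outerInv (q : E n) : E n := D.level (min (D.N q) ((D.N q - D.β q) / D.δ)) q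

/-- The inversion, which maps the complement of `x` in `K` to a collar of `K`. -/
def inner (p : E n) : E n := D.level (1 + D.δ * (1 - D.N p)) p

/-- The inverse of `inner`. -/
def innerInv (q : E n) : E n := D.level (1 - (D.N q - 1) / D.δ) q

theorem outer_gauge_pos (p : E n) : 0 < max (D.N p) (D.β p + D.δ * D.N p) := by
  refine lt_max_of_lt_right ?_
  have := D.one_lt_β p
  have := mul_nonneg D.δ_pos.le (D.N_nonneg p)
  linarith

/-- On a fixed ray `β` is constant and `outer` acts on gauges by `u ↦ max (u, β + δu)`, increasing
from `(0, ∞)` onto `(β, ∞)`. Its inverse is the minimum of the inverses of the two branches. -/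
theorem N_outer {p : E n} (hp : p ≠ x) :
    D.N (D.outer p) = max (D.N p) (D.β p + D.δ * D.N p) :=
  D.N_level (D.outer_gauge_pos p).le hp

theorem β_outer {p : E n} (hp : p ≠ x) : D.β (D.outer p) = D.β p :=
  D.β_level (D.outer_gauge_pos p) hp

theorem β_lt_N_outer {p : E n} (hp : p ≠ x) : D.β (D.outer p) < D.N (D.outer p) := by
  rw [D.β_outer hp, D.N_outer hp]
  refine lt_max_of_lt_right ?_
  have := mul_pos D.δ_pos (D.N_pos p hp)
  linarith

theorem outerInv_outer {p : E n} (hp : p ≠ x) : D.outerInv (D.outer p) = p := by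
  have hd := D.δ_pos
  have h : min (D.N (D.outer p)) ((D.N (D.outer p) - D.β (D.outer p)) / D.δ) = D.N p := by
    rw [D.β_outer hp, D.N_outer hp]
    rcases le_total (D.N p) (D.β p + D.δ * D.N p) with h1 | h1
    · rw [max_eq_right h1, add_sub_cancel_left, mul_div_cancel_left₀ _ hd.ne', min_eq_right h1]
    · rw [max_eq_left h1, min_eq_left]
      rw [le_div_iff₀ hd]; linarith
  rw [outerInv, h, outer, D.level_level (D.outer_gauge_pos p) hp, D.level_N]

theorem outerInv_gauge_pos {q : E n} (hq : D.β q < D.N q) :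
    0 < min (D.N q) ((D.N q - D.β q) / D.δ) := by
  have := D.one_lt_β q
  exact lt_min (by linarith) (div_pos (sub_pos.2 hq) D.δ_pos)

theorem ne_center_of_β_lt {q : E n} (hq : D.β q < D.N q) : q ≠ x :=
  D.ne_center_of_N_pos (by linarith [D.one_lt_β q])

theorem outerInv_ne {q : E n} (hq : D.β q < D.N q) : D.outerInv q ≠ x :=
  D.level_ne_center (D.outerInv_gauge_pos hq) (D.ne_center_of_β_lt hq)

theorem N_outerInv {q : E n} (hq : D.β q < D.N q) :
    D.N (D.outerInv q) = min (D.N q) ((D.N q - D.β q) / D.δ) :=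
  D.N_level (D.outerInv_gauge_pos hq).le (D.ne_center_of_β_lt hq)

theorem outer_outerInv {q : E n} (hq : D.β q < D.N q) : D.outer (D.outerInv q) = q := by
  have hd := D.δ_pos
  have hqx := D.ne_center_of_β_lt hq
  have hpos := D.outerInv_gauge_pos hq
  have hN := D.N_outerInv hq
  have hβ : D.β (D.outerInv q) = D.β q := D.β_level hpos hqx
  have h : max (D.N (D.outerInv q)) (D.β (D.outerInv q) + D.δ * D.N (D.outerInv q)) = D.N q := by
    rw [hβ, hN]
    rcases le_total (D.N q) ((D.N q - D.β q) / D.δ) with h1 | h1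
    · rw [min_eq_left h1, max_eq_left]
      rw [le_div_iff₀ hd] at h1; linarith
    · rw [min_eq_right h1, mul_div_cancel₀ _ hd.ne', add_sub_cancel, max_eq_right h1]
  rw [outer, h, outerInv, D.level_level hpos hqx, D.level_N]

/-- The two branches cross at gauge `β / (1 - δ)`, which is less than `c` because `β < 1 + δ` away
from `x`. -/
theorem outer_eq_self {p : E n} (hp : D.c ≤ D.N p) : D.outer p = p := by
  have h1 : D.β p + D.δ * D.N p ≤ D.N p := by
    by_cases hpx : p = x
    · have h2 := D.one_add_δ_lt_c
      rw [hpx, D.N_center] at hp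
      linarith [D.δ_pos]
    · have h2 := D.β_lt hpx
      have h3 := D.c_mul
      have h4 := mul_le_mul_of_nonneg_right hp (sub_pos.2 D.δ_lt_one).le
      linarith
  rw [outer, max_eq_left h1, D.level_N]

theorem outerInv_eq_self {q : E n} (hq : D.c ≤ D.N q) : D.outerInv q = q := by
  have hd := D.δ_pos
  have h1 : D.N q ≤ (D.N q - D.β q) / D.δ := by
    rw [le_div_iff₀ hd]
    by_cases hpx : q = x
    · have h2 := D.one_add_δ_lt_c
      rw [hpx, D.N_center] at hq
      linarith [D.δ_pos]
    · have h2 := D.β_lt hpx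
      have h3 := D.c_mul
      have h4 := mul_le_mul_of_nonneg_right hq (sub_pos.2 D.δ_lt_one).le
      linarith
  rw [outerInv, min_eq_left h1, D.level_N]

theorem N_outer_lt {p : E n} (hp : p ≠ x) (hpc : D.N p < D.c) : D.N (D.outer p) < D.c := by
  rw [D.N_outer hp]
  refine max_lt hpc ?_
  have h2 := D.β_lt hp
  have h3 := D.c_mul
  have h4 := mul_lt_mul_of_pos_left hpc D.δ_pos
  linarith

theorem N_outerInv_lt {q : E n} (hq : D.β q < D.N q) (hqc : D.N q < D.c) :
    D.N (D.outerInv q) < D.c := by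
  rw [D.N_outerInv hq]
  exact (min_le_left _ _).trans_lt hqc

theorem continuousOn_outer : ContinuousOn D.outer {x}ᶜ := by
  refine D.continuousOn_level subset_rfl (ContinuousOn.sup D.continuous_N.continuousOn ?_)
  unfold β
  exact (continuousOn_const.add (continuousOn_const.mul (continuousOn_const.sub D.continuousOn_a))).add
    (continuousOn_const.mul D.continuous_N.continuousOn)

theorem continuousOn_β : ContinuousOn D.β {x}ᶜ :=
  continuousOn_const.add (continuousOn_const.mul (continuousOn_const.sub D.continuousOn_a))

theorem continuousOn_outerInv : ContinuousOn D.outerInv {x}ᶜ := by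
  refine D.continuousOn_level subset_rfl (ContinuousOn.inf D.continuous_N.continuousOn ?_)
  exact (D.continuous_N.continuousOn.sub D.continuousOn_β).div_const _

theorem isOpen_β_lt : IsOpen {q | D.β q < D.N q} := by
  have h : {q | D.β q < D.N q} = {x}ᶜ ∩ (fun q => D.N q - D.β q) ⁻¹' Ioi 0 := by
    ext q
    simp only [mem_ofPred_eq, mem_inter_iff, mem_compl_iff, mem_singleton_iff, mem_preimage, mem_Ioi,
      sub_pos]
    exact ⟨fun hq => ⟨D.ne_center_of_β_lt hq, hq⟩, fun hq => hq.2⟩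
  rw [h]
  exact (D.continuous_N.continuousOn.sub D.continuousOn_β).isOpen_inter_preimage
    isOpen_compl_singleton isOpen_Ioi

theorem inner_gauge_pos {p : E n} (hp : p ∈ K) : 1 ≤ 1 + D.δ * (1 - D.N p) := by
  have := mul_nonneg D.δ_pos.le (sub_nonneg.2 ((D.N_le_one_iff p).2 hp))
  linarith

/-- On a ray `inner` is the decreasing affine map of gauges from `(0, 1]` onto `[1, 1 + δ)`; it
fixes the boundary of `K`. -/
theorem N_inner {p : E n} (hp : p ∈ K) (hpx : p ≠ x) : D.N (D.inner p) = 1 + D.δ * (1 - D.N p) :=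
  D.N_level (zero_le_one.trans (D.inner_gauge_pos hp)) hpx

theorem one_le_N_inner {p : E n} (hp : p ∈ K) (hpx : p ≠ x) : 1 ≤ D.N (D.inner p) := by
  rw [D.N_inner hp hpx]; exact D.inner_gauge_pos hp

theorem N_inner_lt {p : E n} (hp : p ∈ K) (hpx : p ≠ x) : D.N (D.inner p) < 1 + D.δ := by
  rw [D.N_inner hp hpx]
  have := mul_pos D.δ_pos (D.N_pos p hpx)
  linarith

theorem innerInv_inner {p : E n} (hp : p ∈ K) (hpx : p ≠ x) : D.innerInv (D.inner p) = p := by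
  have h : 1 - (D.N (D.inner p) - 1) / D.δ = D.N p := by
    rw [D.N_inner hp hpx, add_sub_cancel_left, mul_div_cancel_left₀ _ D.δ_pos.ne', sub_sub_cancel]
  rw [innerInv, h, inner, D.level_level (zero_lt_one.trans_le (D.inner_gauge_pos hp)) hpx, D.level_N]

theorem innerInv_gauge_pos {q : E n} (hq : D.N q < 1 + D.δ) : 0 < 1 - (D.N q - 1) / D.δ := by
  rw [sub_pos, div_lt_one D.δ_pos]
  linarith

theorem N_innerInv {q : E n} (hq1 : 1 ≤ D.N q) (hq : D.N q < 1 + D.δ) :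
    D.N (D.innerInv q) = 1 - (D.N q - 1) / D.δ :=
  D.N_level (D.innerInv_gauge_pos hq).le (D.ne_center_of_N_pos (by linarith))

theorem innerInv_mem {q : E n} (hq1 : 1 ≤ D.N q) (hq : D.N q < 1 + D.δ) : D.innerInv q ∈ K := by
  rw [← D.N_le_one_iff, D.N_innerInv hq1 hq]
  have := div_nonneg (sub_nonneg.2 hq1) D.δ_pos.le
  linarith

theorem innerInv_ne {q : E n} (hq1 : 1 ≤ D.N q) (hq : D.N q < 1 + D.δ) : D.innerInv q ≠ x :=
  D.level_ne_center (D.innerInv_gauge_pos hq) (D.ne_center_of_N_pos (by linarith))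

theorem inner_innerInv {q : E n} (hq1 : 1 ≤ D.N q) (hq : D.N q < 1 + D.δ) :
    D.inner (D.innerInv q) = q := by
  have h : 1 + D.δ * (1 - D.N (D.innerInv q)) = D.N q := by
    rw [D.N_innerInv hq1 hq, sub_sub_cancel, mul_div_cancel₀ _ D.δ_pos.ne', add_sub_cancel]
  rw [inner, h, innerInv, D.level_level (D.innerInv_gauge_pos hq)
    (D.ne_center_of_N_pos (by linarith)), D.level_N]

theorem inner_eq_self {p : E n} (hp : D.N p = 1) : D.inner p = p := by
  have h : 1 + D.δ * (1 - D.N p) = D.N p := by rw [hp]; ring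
  rw [inner, h, D.level_N]

theorem continuousOn_inner : ContinuousOn D.inner {x}ᶜ :=
  D.continuousOn_level subset_rfl
    (continuousOn_const.add (continuousOn_const.mul
      (continuousOn_const.sub D.continuous_N.continuousOn)))

theorem continuousOn_innerInv : ContinuousOn D.innerInv {x}ᶜ :=
  D.continuousOn_level subset_rfl
    (continuousOn_const.sub ((D.continuous_N.continuousOn.sub continuousOn_const).div_const _))

/-- In the ball of radius `ε`, the maps `outer` and `inner` differ by the radial inversion. -/
theorem outer_eq_inner {v : E n} (hv0 : v ≠ 0) (hv : ‖v‖ < D.ε) :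
    D.outer (x + ((D.ε - ‖v‖) / ‖v‖) • v) = D.inner (x + v) := by
  have hvn : 0 < ‖v‖ := norm_pos_iff.2 hv0
  set p := x + v with hp
  have hpx : p ≠ x := by simpa [hp] using hv0
  have hNp := D.N_pos p hpx
  have hr : 0 < (D.ε - ‖v‖) / ‖v‖ := div_pos (sub_pos.2 hv) hvn
  have hq : x + ((D.ε - ‖v‖) / ‖v‖) • v = D.level ((D.ε - ‖v‖) / ‖v‖ * D.N p) p := by
    rw [level, mul_div_cancel_right₀ _ hNp.ne', hp, add_sub_cancel_left]
  have ha : D.a p = D.ε * D.N p / ‖v‖ := by rw [a, hp, add_sub_cancel_left]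
  have hs : (D.ε - ‖v‖) / ‖v‖ * D.N p = D.a p - D.N p := by
    rw [ha]; field_simp
  have hspos := mul_pos hr hNp
  rw [hq, outer, D.N_level hspos.le hpx, D.β_level hspos hpx, D.level_level hspos hpx, inner]
  congr 1
  rw [hs] at hspos ⊢
  -- Inversion in the ball of radius `ε` sends gauge `u` to `a - u`. The value `β = 1 + δ(1 - a)` is
  -- the one for which `outer` at `a - u` equals `inner` at `u`.
  have h1 : D.β p + D.δ * (D.a p - D.N p) = 1 + D.δ * (1 - D.N p) := by rw [β]; ring
  rw [h1, max_eq_right]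
  have h2 := D.a_lt_one p
  have h3 : D.N p ≤ 1 := by linarith
  have h4 := mul_nonneg D.δ_pos.le (sub_nonneg.2 h3)
  linarith

/-- Conversely, the images of `outer` and `inner` overlap in the image of this ball only. -/
theorem eq_of_outer_eq_inner {p p' : E n} (hp : p ≠ x) (hp'K : p' ∈ K) (hp' : p' ≠ x)
    (h : D.outer p = D.inner p') :
    ‖p' - x‖ < D.ε ∧ p = x + ((D.ε - ‖p' - x‖) / ‖p' - x‖) • (p' - x) := by
  have hlt : ‖p' - x‖ < D.ε := by
    -- Images of `outer` have gauge above `β`. For an image of `inner` this says `N p' < a p'`,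
    -- which is `‖p' - x‖ < ε`.
    have h1 := D.β_lt_N_outer hp
    rw [h, D.N_inner hp'K hp', inner,
      D.β_level (zero_lt_one.trans_le (D.inner_gauge_pos hp'K)) hp', β] at h1
    have h2 : D.δ * D.N p' < D.δ * D.a p' := by linarith
    have h3 := lt_of_mul_lt_mul_left h2 D.δ_pos.le
    have h4 := norm_pos_iff.2 (sub_ne_zero.2 hp')
    rw [a, lt_div_iff₀ h4, mul_comm] at h3
    exact lt_of_mul_lt_mul_right h3 (D.N_nonneg _)
  refine ⟨hlt, ?_⟩
  have hv0 : p' - x ≠ 0 := sub_ne_zero.2 hp'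
  have h5 := D.outer_eq_inner hv0 hlt
  rw [add_sub_cancel] at h5
  rw [← D.outerInv_outer hp, h, ← h5, D.outerInv_outer]
  simp only [ne_eq, add_eq_left, smul_eq_zero, hv0, or_false]
  exact (div_pos (sub_pos.2 hlt) (norm_pos_iff.2 hv0)).ne'

end RadialData

namespace PolytopeWithHoles

/-! ### Homeomorphisms covering homeomorphisms of the base -/

section BaseHomeo

variable {n s s' : ℕ}

/-- A homeomorphism between open subsets of the bodies of two polytopes with holes which preserves
the submodules assigned to their faces. -/
structure BaseHomeo (Q : PolytopeWithHoles n s) (mu : Q.Facet → Fin n → ℤ)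
    (Q' : PolytopeWithHoles n s') (mu' : Q'.Facet → Fin n → ℤ) where
  toFun : E n → E n
  invFun : E n → E n
  source : Set (E n)
  target : Set (E n)
  isOpen_source : IsOpen source
  isOpen_target : IsOpen target
  continuousOn_toFun : ContinuousOn toFun (Q.body ∩ source)
  continuousOn_invFun : ContinuousOn invFun (Q'.body ∩ target)
  map_source : ∀ p ∈ Q.body ∩ source, toFun p ∈ Q'.body ∩ target
  map_target : ∀ q ∈ Q'.body ∩ target, invFun q ∈ Q.body ∩ source
  left_inv : ∀ p ∈ Q.body ∩ source, invFun (toFun p) = p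
  right_inv : ∀ q ∈ Q'.body ∩ target, toFun (invFun q) = q
  faceModule_eq : ∀ p ∈ Q.body ∩ source, Q'.faceModule mu' (toFun p) = Q.faceModule mu p

variable {Q : PolytopeWithHoles n s} {mu : Q.Facet → Fin n → ℤ}
  {Q' : PolytopeWithHoles n s'} {mu' : Q'.Facet → Fin n → ℤ}

/-- The inverse homeomorphism. -/
def BaseHomeo.symm (h : BaseHomeo Q mu Q' mu') : BaseHomeo Q' mu' Q mu where
  toFun := h.invFun
  invFun := h.toFun
  source := h.target
  target := h.source
  isOpen_source := h.isOpen_target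
  isOpen_target := h.isOpen_source
  continuousOn_toFun := h.continuousOn_invFun
  continuousOn_invFun := h.continuousOn_toFun
  map_source := h.map_target
  map_target := h.map_source
  left_inv := h.right_inv
  right_inv := h.left_inv
  faceModule_eq q hq := by rw [← h.faceModule_eq _ (h.map_target q hq), h.right_inv q hq]

variable [Nonempty (Q.TorusSpace mu)] [Nonempty (Q'.TorusSpace mu')]

/-- The map `[t, p] ↦ [t, φ(p)]`. -/
def BaseHomeo.lift (h : BaseHomeo Q mu Q' mu') (m : Q.TorusSpace mu) : Q'.TorusSpace mu' :=
  Q'.point mu' (Q.someAngle mu m) (h.toFun (Q.orbitMap mu m))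

/-- The chosen angle of a class differs from `t` by an element of the subtorus at `p`, and the image
point has the same subtorus. -/
theorem BaseHomeo.lift_point (h : BaseHomeo Q mu Q' mu') {t : Torus n} {p : E n}
    (hp : p ∈ Q.body ∩ h.source) : h.lift (Q.point mu t p) = Q'.point mu' t (h.toFun p) := by
  have h1 := Q.cls_someAngle mu (Q.point mu t p)
  rw [← Q.point_of_mem mu, Q.orbitMap_point mu hp.1, Q.point_eq_point_iff mu hp.1 hp.1] at h1
  rw [BaseHomeo.lift, Q.orbitMap_point mu hp.1, Q'.point_eq_point_iff mu' (h.map_source p hp).1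
    (h.map_source p hp).1, h.faceModule_eq p hp]
  exact ⟨rfl, h1.2⟩

theorem BaseHomeo.continuousOn_lift (h : BaseHomeo Q mu Q' mu') :
    ContinuousOn h.lift (Q.orbitMap mu ⁻¹' h.source) := by
  refine Q.continuousOn_of_point mu h.isOpen_source ?_
  have h1 : ContinuousOn (fun a : Torus n × E n => Q'.point mu' a.1 (h.toFun a.2))
      {a | a.2 ∈ Q.body ∩ h.source} := by
    refine (Q'.continuousOn_point mu').comp (f := fun a : Torus n × E n => (a.1, h.toFun a.2))
      (continuousOn_fst.prodMk ?_) fun a ha => (h.map_source a.2 ha).1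
    exact h.continuousOn_toFun.comp continuousOn_snd fun a ha => ha
  exact h1.congr fun a ha => h.lift_point ha

theorem BaseHomeo.lift_mem (h : BaseHomeo Q mu Q' mu') {m : Q.TorusSpace mu}
    (hm : Q.orbitMap mu m ∈ h.source) : Q'.orbitMap mu' (h.lift m) ∈ h.target := by
  obtain ⟨t, p, hp, rfl⟩ := Q.exists_point mu m
  rw [Q.orbitMap_point mu hp] at hm
  rw [h.lift_point ⟨hp, hm⟩, Q'.orbitMap_point mu' (h.map_source p ⟨hp, hm⟩).1]
  exact (h.map_source p ⟨hp, hm⟩).2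

theorem BaseHomeo.lift_symm_lift (h : BaseHomeo Q mu Q' mu') {m : Q.TorusSpace mu}
    (hm : Q.orbitMap mu m ∈ h.source) : h.symm.lift (h.lift m) = m := by
  obtain ⟨t, p, hp, rfl⟩ := Q.exists_point mu m
  rw [Q.orbitMap_point mu hp] at hm
  rw [h.lift_point ⟨hp, hm⟩, h.symm.lift_point (h.map_source p ⟨hp, hm⟩)]
  exact congrArg (Q.point mu t) (h.left_inv p ⟨hp, hm⟩)

/-- The homeomorphism of parts of `M(Q, μ)` and `M(Q', μ')` covering a homeomorphism of parts of
the polytopes. -/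
def BaseHomeo.toOpenPartialHomeomorph (h : BaseHomeo Q mu Q' mu') :
    OpenPartialHomeomorph (Q.TorusSpace mu) (Q'.TorusSpace mu') where
  toFun := h.lift
  invFun := h.symm.lift
  source := Q.orbitMap mu ⁻¹' h.source
  target := Q'.orbitMap mu' ⁻¹' h.target
  map_source' _ hm := h.lift_mem hm
  map_target' _ hm := h.symm.lift_mem hm
  left_inv' _ hm := h.lift_symm_lift hm
  right_inv' _ hm := h.symm.lift_symm_lift hm
  open_source := h.isOpen_source.preimage (Q.continuous_orbitMap mu)
  open_target := h.isOpen_target.preimage (Q'.continuous_orbitMap mu')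
  continuousOn_toFun := h.continuousOn_lift
  continuousOn_invFun := h.symm.continuousOn_lift

theorem BaseHomeo.lift_vadd (h : BaseHomeo Q mu Q' mu') (t : Torus n) {m : Q.TorusSpace mu}
    (hm : Q.orbitMap mu m ∈ h.source) : h.lift (t +ᵥ m) = t +ᵥ h.lift m := by
  obtain ⟨u, p, hp, rfl⟩ := Q.exists_point mu m
  rw [Q.orbitMap_point mu hp] at hm
  rw [Q.vadd_point mu hp, h.lift_point ⟨hp, hm⟩, h.lift_point ⟨hp, hm⟩,
    Q'.vadd_point mu' (h.map_source p ⟨hp, hm⟩).1]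

theorem BaseHomeo.orbitMap_lift (h : BaseHomeo Q mu Q' mu') {m : Q.TorusSpace mu}
    (hm : Q.orbitMap mu m ∈ h.source) :
    Q'.orbitMap mu' (h.lift m) = h.toFun (Q.orbitMap mu m) := by
  obtain ⟨u, p, hp, rfl⟩ := Q.exists_point mu m
  rw [Q.orbitMap_point mu hp] at hm
  rw [h.lift_point ⟨hp, hm⟩, Q.orbitMap_point mu hp,
    Q'.orbitMap_point mu' (h.map_source p ⟨hp, hm⟩).1]

end BaseHomeo

/-! ### Facets of polytopes with holes -/

section Faces

variable {n s : ℕ} (P : PolytopeWithHoles n s) (lam : P.Facet → Fin n → ℤ)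

theorem summand_body (k : Fin (s + 1)) : (P.summand k).body = P.piece k :=
  (P.summand k).body_eq_piece

theorem finite_facet : Finite P.Facet := by
  have h : {F : Set (E n) | ∃ k, IsFacet (P.piece k) F}.Finite := by
    have : {F : Set (E n) | ∃ k, IsFacet (P.piece k) F} = ⋃ k, {F | IsFacet (P.piece k) F} := by
      ext F; simp
    rw [this]
    exact finite_iUnion fun k => finite_facets (P.simple k)
  exact h.to_subtype

/-- Holes are disjoint from one another and lie in the interior of the outer polytope, so facets of
different pieces never meet. -/
theorem isFacet_of_mem_hole {p : E n} {k : Fin s} (hp : p ∈ P.piece k.succ) (F : P.Facet)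
    (hF : p ∈ F.1) : IsFacet (P.piece k.succ) F.1 := by
  obtain ⟨j, hj⟩ := F.2
  induction j using Fin.cases with
  | zero => exact absurd hF (notMem_facet_of_interior (P.simple 0) hj (P.hole_subset k hp))
  | succ j =>
    by_cases hjk : j = k
    · rwa [hjk] at hj
    · exact absurd hp ((P.hole_disjoint hjk).notMem_of_mem_left (facet_subset (P.simple _) hj hF))

theorem isFacet_of_notMem_hole {p : E n} (hp : ∀ k : Fin s, p ∉ P.piece k.succ) (F : P.Facet)
    (hF : p ∈ F.1) : IsFacet (P.piece 0) F.1 := by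
  obtain ⟨j, hj⟩ := F.2
  induction j using Fin.cases with
  | zero => exact hj
  | succ j => exact absurd (facet_subset (P.simple _) hj hF) (hp j)

theorem faceModule_eq_summand {p : E n} {k : Fin (s + 1)}
    (h : ∀ F : P.Facet, p ∈ F.1 → IsFacet (P.piece k) F.1) :
    P.faceModule lam p = (P.summand k).faceModule (P.restrict lam k) p := by
  rw [faceModule, faceModule]
  congr 1
  apply Subset.antisymm
  · rintro _ ⟨F, hF, rfl⟩
    exact ⟨⟨F.1, 0, h F hF⟩, hF, rfl⟩
  · rintro _ ⟨F, hF, rfl⟩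
    exact ⟨P.summandFacet k F, hF, rfl⟩

theorem faceModule_eq_bot {p : E n} (h : ∀ F : P.Facet, p ∉ F.1) : P.faceModule lam p = ⊥ := by
  have : {F : P.Facet | p ∈ F.1} = ∅ := eq_empty_of_forall_notMem h
  rw [faceModule, this, image_empty, Submodule.span_empty]

theorem faceModule_eq_bot_of_interior {p : E n} (hp : p ∈ interior (P.piece 0))
    (hp' : ∀ k : Fin s, p ∉ P.piece k.succ) : P.faceModule lam p = ⊥ :=
  P.faceModule_eq_bot lam fun F hF =>
    notMem_facet_of_interior (P.simple 0) (P.isFacet_of_notMem_hole hp' F hF) hp hF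

theorem summand_faceModule_eq_bot {k : Fin (s + 1)} {p : E n} (hp : p ∈ interior (P.piece k)) :
    (P.summand k).faceModule (P.restrict lam k) p = ⊥ :=
  (P.summand k).faceModule_eq_bot_of_interior _ hp fun l => l.elim0

theorem exists_faceModule_eq {p : E n} (hp : p ∈ P.body) : ∃ k, p ∈ P.piece k ∧
    P.faceModule lam p = (P.summand k).faceModule (P.restrict lam k) p := by
  by_cases h : ∃ k : Fin s, p ∈ P.piece k.succ
  · obtain ⟨k, hk⟩ := h
    exact ⟨k.succ, hk, P.faceModule_eq_summand lam (P.isFacet_of_mem_hole hk)⟩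
  · push Not at h
    exact ⟨0, hp.1, P.faceModule_eq_summand lam (P.isFacet_of_notMem_hole h)⟩

theorem isClosed_body : IsClosed P.body :=
  (P.simple 0).isCompact.isClosed.sdiff (isOpen_iUnion fun _ => isOpen_interior)

theorem isCompact_body : IsCompact P.body :=
  (P.simple 0).isCompact.of_isClosed_subset P.isClosed_body sdiff_subset

theorem compactSpace : CompactSpace (P.TorusSpace lam) := by
  have := isCompact_iff_compactSpace.1 P.isCompact_body
  exact inferInstanceAs (CompactSpace (Quotient (P.torusSetoid lam)))

/-- For `n ≥ 1` a vertex of the outer polytope lies on a facet, hence outside its interior and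
outside all holes. -/
theorem body_nonempty (hn : 1 ≤ n) : P.body.Nonempty := by
  obtain ⟨x, hx⟩ := (P.simple 0).nonempty
  obtain ⟨v, hv, -⟩ := exists_vertex (P.simple 0) hx
  have hP := P.simple 0
  obtain ⟨σ, -, hσ⟩ := exists_facet_enumeration hP hv
  have h1 : σ ⟨0, hn⟩ ∈ range σ := ⟨_, rfl⟩
  rw [hσ] at h1
  refine ⟨v, hv.1, ?_⟩
  simp only [mem_iUnion, not_exists]
  exact fun k hk => notMem_facet_of_interior hP h1.1 (P.hole_subset k (interior_subset hk)) h1.2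

theorem nonempty_torusSpace (hn : 1 ≤ n) : Nonempty (P.TorusSpace lam) := by
  obtain ⟨v, hv⟩ := P.body_nonempty hn
  exact ⟨P.cls lam 0 ⟨v, hv⟩⟩

variable {P lam}

/-- In the basis of a vertex of the face this is a coordinate subtorus, given by equations. -/
theorem isClosed_subtorus_faceModule (hn : 1 ≤ n) (hlam : P.IsCharacteristic lam) {p : E n}
    (hp : p ∈ P.body) : IsClosed (subtorus (P.faceModule lam p) : Set (Torus n)) := by
  obtain ⟨k, hk, hface⟩ := P.exists_faceModule_eq lam hp
  have hP := P.simple k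
  have hb := P.summand_body k
  obtain ⟨v, hv, hv'⟩ := exists_vertex hP hk
  obtain ⟨c, F, hF, hht, hbasis, hdom, -⟩ :=
    exists_vertex_frame hn (hlam.restrict k) one_ne_zero (Q := P.summand k) (v := v) hv
  have hfit := vertex_frame_fits hF hht hbasis hdom
  rw [hface, hfit.face p ?_ (by rwa [hb])]
  · have : (subtorus (Submodule.span ℤ ((fun i => c.basis.transpose i) '' {i | c.ht p i = 0})) :
        Set (Torus n)) = ⋂ i ∈ {i | c.ht p i ≠ 0}, {t | matTorus c.dual t i = 0} := by
      ext t
      simp only [SetLike.mem_coe, mem_subtorus_span_iff c.basis_mul_dual c.dual_mul_basis,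
        mem_ofPred_eq, mem_iInter]
    rw [this]
    refine isClosed_biInter fun i _ => isClosed_eq ?_ continuous_const
    exact (continuous_apply i).comp (continuous_matTorus _)
  · rw [hdom]
    intro G hG hvG
    exact lt_of_le_of_ne (facetHeight_nonneg hP hG hk)
      fun h0 => hvG (hv' G hG ((mem_facet_iff hP hG hk).2 h0.symm))

theorem subtorus_mono {N N' : Submodule ℤ (Fin n → ℤ)} (h : N ≤ N') : subtorus N ≤ subtorus N' :=
  AddSubgroup.map_mono (Submodule.span_mono (image_mono h))

/-- Points in different fibers are separated by the orbit map. In the fiber over `p` they are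
separated by the angle modulo the subtorus `H` at `p`: this is well defined near the fiber, and the
quotient by the closed subgroup `H` is Hausdorff. -/
theorem t2Space (hn : 1 ≤ n) (hlam : P.IsCharacteristic lam) : T2Space (P.TorusSpace lam) := by
  have := P.nonempty_torusSpace lam hn
  refine ⟨fun m m' hne => ?_⟩
  by_cases hπ : P.orbitMap lam m = P.orbitMap lam m'
  · obtain ⟨t, p, hp, rfl⟩ := P.exists_point lam m
    obtain ⟨u, q, hq, rfl⟩ := P.exists_point lam m'
    rw [P.orbitMap_point lam hp, P.orbitMap_point lam hq] at hπ
    subst hπ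
    set H := subtorus (P.faceModule lam p) with hH
    have hcl : IsClosed (H : Set (Torus n)) := isClosed_subtorus_faceModule hn hlam hp
    have : T3Space (Torus n ⧸ H) := QuotientAddGroup.instT3Space H
    -- Over `U` every facet through a point also contains `p`, so the subtori there are contained in
    -- `H`.
    set U : Set (E n) := ⋂ F ∈ {F : P.Facet | p ∉ F.1}, (F.1)ᶜ with hU
    have hUo : IsOpen U := by
      have := P.finite_facet
      refine (toFinite _).isOpen_biInter fun F _ => ?_
      obtain ⟨k, hk⟩ := F.2
      exact (hk.isClosed (P.simple k)).isOpen_compl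
    have hpU : p ∈ U := by simp only [hU, mem_iInter]; exact fun F hF => hF
    have hle : ∀ q ∈ U, subtorus (P.faceModule lam q) ≤ H := by
      intro q hq
      refine subtorus_mono (Submodule.span_mono (image_mono fun F hF => ?_))
      by_contra hpF
      simp only [hU, mem_iInter] at hq
      exact hq F hpF hF
    let f : P.TorusSpace lam → Torus n ⧸ H := fun m => QuotientAddGroup.mk (P.someAngle lam m)
    have hf : ∀ t : Torus n, ∀ q ∈ P.body ∩ U,
        f (P.point lam t q) = (QuotientAddGroup.mk t : Torus n ⧸ H) := by
      intro t q hq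
      have h1 := P.cls_someAngle lam (P.point lam t q)
      rw [← P.point_of_mem lam, P.orbitMap_point lam hq.1, P.point_eq_point_iff lam hq.1 hq.1] at h1
      rw [QuotientAddGroup.eq_iff_sub_mem]
      exact hle q hq.2 h1.2
    have hfc : ContinuousOn f (P.orbitMap lam ⁻¹' U) := by
      refine P.continuousOn_of_point lam hUo ?_
      have h1 : ContinuousOn (fun a : Torus n × E n => (QuotientAddGroup.mk a.1 : Torus n ⧸ H))
          {a | a.2 ∈ P.body ∩ U} :=
        (continuous_quotient_mk'.comp continuous_fst).continuousOn
      exact h1.congr fun a ha => hf _ _ ha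
    have hO : IsOpen (P.orbitMap lam ⁻¹' U) := hUo.preimage (P.continuous_orbitMap lam)
    have hne' : (QuotientAddGroup.mk t : Torus n ⧸ H) ≠ QuotientAddGroup.mk u := by
      intro h
      rw [QuotientAddGroup.eq_iff_sub_mem] at h
      exact hne ((P.point_eq_point_iff lam hp hp).2 ⟨rfl, h⟩)
    obtain ⟨V, W, hV, hW, htV, huW, hVW⟩ := t2_separation hne'
    refine ⟨_, _, hfc.isOpen_inter_preimage hO hV, hfc.isOpen_inter_preimage hO hW, ?_, ?_, ?_⟩
    · refine ⟨?_, ?_⟩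
      · rw [mem_preimage, P.orbitMap_point lam hp]; exact hpU
      · rw [mem_preimage, hf t p ⟨hp, hpU⟩]; exact htV
    · refine ⟨?_, ?_⟩
      · rw [mem_preimage, P.orbitMap_point lam hp]; exact hpU
      · rw [mem_preimage, hf u p ⟨hp, hpU⟩]; exact huW
    · exact (hVW.preimage f).mono inter_subset_right inter_subset_right
  · obtain ⟨V, W, hV, hW, htV, huW, hVW⟩ := t2_separation hπ
    exact ⟨_, _, hV.preimage (P.continuous_orbitMap lam), hW.preimage (P.continuous_orbitMap lam),
      htV, huW, hVW.preimage _⟩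

end Faces

end PolytopeWithHoles

/-! ### Disjoint collars of the holes and the maps of the polytopes onto parts of `P` -/

namespace PolytopeWithHoles

variable {n s : ℕ} {P : PolytopeWithHoles n s} {x : Fin s → E n}

/-- Radial data for all holes, with disjoint collars in the interior of the outer polytope. -/
structure CollarData (P : PolytopeWithHoles n s) (x : Fin s → E n) where
  rad : ∀ k : Fin s, RadialData (P.piece k.succ) (x k)
  mem_interior : ∀ k p, (rad k).N p < (rad k).c → p ∈ interior (P.piece 0)
  disjoint : ∀ k l p, k ≠ l → (rad k).N p < (rad k).c → (rad l).c ≤ (rad l).N p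

/-- By compactness, dilating all holes about their centers by a factor `r` slightly above 1 keeps
them disjoint and in the interior of the outer polytope. -/
theorem exists_collarData (hx : ∀ k, x k ∈ interior (P.piece k.succ)) :
    Nonempty (CollarData P x) := by
  choose N ε hcont hsmul hle hlt hpos hε hεN using fun k =>
    exists_gauge (P.simple k.succ).convex (P.simple k.succ).isCompact (hx k)
  let h : Fin s → ℝ → E n → E n := fun k r p => x k + r • (p - x k)
  have h1 : ∀ k p, h k 1 p = p := fun k p => by simp [h]
  have hc : ∀ k, Continuous fun a : ℝ × E n => h k a.1 a.2 := fun k => by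
    simp only [h]; fun_prop
  have e1 : ∀ᶠ r in 𝓝 (1 : ℝ), ∀ k, ∀ p ∈ P.piece k.succ, h k r p ∈ interior (P.piece 0) := by
    refine Filter.eventually_all.2 fun k => ?_
    refine (P.simple k.succ).isCompact.eventually_forall_of_forall_eventually fun p hp => ?_
    refine (hc k).continuousAt.eventually_mem (isOpen_interior.mem_nhds ?_)
    rw [h1]; exact P.hole_subset k hp
  have e2 : ∀ᶠ r in 𝓝 (1 : ℝ), ∀ k l, k ≠ l →
      ∀ a ∈ P.piece k.succ ×ˢ P.piece l.succ, h k r a.1 ≠ h l r a.2 := by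
    refine Filter.eventually_all.2 fun k => Filter.eventually_all.2 fun l => ?_
    by_cases hkl : k = l
    · exact Filter.Eventually.of_forall fun r hr => absurd hkl hr
    · have hK : IsCompact (P.piece k.succ ×ˢ P.piece l.succ) :=
        (P.simple k.succ).isCompact.prod (P.simple l.succ).isCompact
      have := hK.eventually_forall_of_forall_eventually (x₀ := (1 : ℝ))
        (P := fun r a => h k r a.1 ≠ h l r a.2) fun a ha => by
          have hc1 : Continuous fun z : ℝ × (E n × E n) => h k z.1 z.2.1 :=
            (hc k).comp (f := fun z : ℝ × (E n × E n) => (z.1, z.2.1)) (by fun_prop)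
          have hc2 : Continuous fun z : ℝ × (E n × E n) => h l z.1 z.2.2 :=
            (hc l).comp (f := fun z : ℝ × (E n × E n) => (z.1, z.2.2)) (by fun_prop)
          refine (isOpen_ne_fun hc1 hc2).mem_nhds ?_
          have : h k 1 a.1 ≠ h l 1 a.2 := by
            rw [h1, h1]
            exact fun heq => (P.hole_disjoint hkl).notMem_of_mem_left ha.1 (heq ▸ ha.2)
          exact this
      exact this.mono fun r hr _ => hr
  obtain ⟨r, ⟨hr1, hr2⟩, hr⟩ := ((e1.and e2).filter_mono nhdsWithin_le_nhds |>.and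
    (self_mem_nhdsWithin (a := (1 : ℝ)) (s := Ioi 1))).exists
  have hr : 1 < r := hr
  have hr0 : 0 < r := by linarith
  -- This value of `δ` solves `(1 + δ) / (1 - δ) = r`, so the collars of gauge less than `c` lie in
  -- the dilated holes.
  have hδ0 : 0 < (r - 1) / (r + 1) := div_pos (by linarith) (by linarith)
  have hδ1 : (r - 1) / (r + 1) < 1 := (div_lt_one (by linarith)).2 (by linarith)
  let rad : ∀ k : Fin s, RadialData (P.piece k.succ) (x k) := fun k =>
    ⟨N k, ε k, (r - 1) / (r + 1), hcont k, hsmul k, hle k, hlt k, hpos k, hε k, hεN k, hδ0, hδ1⟩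
  have hcr : ∀ k, (rad k).c = r := fun k => by
    have : r + 1 ≠ 0 := by linarith
    have h2 : (1 : ℝ) - (r - 1) / (r + 1) ≠ 0 := by linarith
    change (1 + (r - 1) / (r + 1)) / (1 - (r - 1) / (r + 1)) = r
    rw [div_eq_iff h2]
    field_simp
    ring
  have hback : ∀ k p, N k p < r → ∃ p' ∈ P.piece k.succ, h k r p' = p := by
    intro k p hp
    refine ⟨x k + r⁻¹ • (p - x k), ?_, ?_⟩
    · rw [← hle k, hsmul k _ (inv_nonneg.2 hr0.le), add_sub_cancel, inv_mul_le_iff₀ hr0, mul_one]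
      exact hp.le
    · simp only [h, add_sub_cancel_left, smul_smul, mul_inv_cancel₀ hr0.ne', one_smul,
        add_sub_cancel]
  refine ⟨⟨rad, fun k p hp => ?_, fun k l p hkl hp => ?_⟩⟩
  · rw [hcr] at hp
    obtain ⟨p', hp', rfl⟩ := hback k p hp
    exact hr1 k p' hp'
  · rw [hcr] at hp ⊢
    by_contra hq
    obtain ⟨p', hp', rfl⟩ := hback k p hp
    obtain ⟨q', hq', heq⟩ := hback l _ (not_le.1 hq)
    exact hr2 k l hkl (p', q') ⟨hp', hq'⟩ heq.symm

namespace CollarData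

variable (D : CollarData P x)

/-- The map of the outer polytope without the points `xₖ` onto the complement of the holes. -/
def outer (p : E n) : E n := p + ∑ k, ((D.rad k).outer p - p)

/-- The inverse of `outer`. -/
def outerInv (p : E n) : E n := p + ∑ k, ((D.rad k).outerInv p - p)

/-- The collars are disjoint, so every other radial map is the identity at `p` and contributes
nothing to the sum. -/
theorem outer_of_lt {k : Fin s} {p : E n} (hp : (D.rad k).N p < (D.rad k).c) :
    D.outer p = (D.rad k).outer p := by
  rw [outer, Finset.sum_eq_single k, add_sub_cancel]
  · intro l _ hl
    rw [(D.rad l).outer_eq_self (D.disjoint k l p hl.symm hp), sub_self]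
  · simp

theorem outer_of_le {p : E n} (hp : ∀ k, (D.rad k).c ≤ (D.rad k).N p) : D.outer p = p := by
  rw [outer, Finset.sum_eq_zero, add_zero]
  intro l _
  rw [(D.rad l).outer_eq_self (hp l), sub_self]

theorem outerInv_of_lt {k : Fin s} {p : E n} (hp : (D.rad k).N p < (D.rad k).c) :
    D.outerInv p = (D.rad k).outerInv p := by
  rw [outerInv, Finset.sum_eq_single k, add_sub_cancel]
  · intro l _ hl
    rw [(D.rad l).outerInv_eq_self (D.disjoint k l p hl.symm hp), sub_self]
  · simp

theorem outerInv_of_le {p : E n} (hp : ∀ k, (D.rad k).c ≤ (D.rad k).N p) : D.outerInv p = p := by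
  rw [outerInv, Finset.sum_eq_zero, add_zero]
  intro l _
  rw [(D.rad l).outerInv_eq_self (hp l), sub_self]

theorem continuousOn_outer : ContinuousOn D.outer {p | ∀ k, p ≠ x k} :=
  continuousOn_id.add (continuousOn_finsetSum _ fun k _ =>
    ((D.rad k).continuousOn_outer.mono
      fun p (hp : p ∈ {p | ∀ k, p ≠ x k}) => hp k).sub continuousOn_id)

theorem continuousOn_outerInv : ContinuousOn D.outerInv {p | ∀ k, p ≠ x k} :=
  continuousOn_id.add (continuousOn_finsetSum _ fun k _ =>
    ((D.rad k).continuousOn_outerInv.mono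
      fun p (hp : p ∈ {p | ∀ k, p ≠ x k}) => hp k).sub continuousOn_id)

theorem one_lt_c (k : Fin s) : 1 < (D.rad k).c :=
  (lt_add_of_pos_right _ (D.rad k).δ_pos).trans (D.rad k).one_add_δ_lt_c

theorem notMem_piece {k : Fin s} {p : E n} (hp : 1 < (D.rad k).N p) : p ∉ P.piece k.succ :=
  fun h => not_le.2 hp (((D.rad k).N_le_one_iff p).2 h)

theorem ne_of_one_lt {k : Fin s} {p : E n} (hp : 1 < (D.rad k).N p) : p ≠ x k :=
  (D.rad k).ne_center_of_N_pos (zero_lt_one.trans hp)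

theorem β_lt_of_c_le {k : Fin s} {p : E n} (hp : (D.rad k).c ≤ (D.rad k).N p) :
    (D.rad k).β p < (D.rad k).N p :=
  ((D.rad k).β_lt (D.ne_of_one_lt ((D.one_lt_c k).trans_le hp))).trans_le
    ((D.rad k).one_add_δ_lt_c.le.trans hp)

theorem mem_body_of_one_lt {p : E n} (hp : p ∈ P.piece 0) (h : ∀ k, 1 < (D.rad k).N p) :
    p ∈ P.body := by
  refine ⟨hp, ?_⟩
  simp only [mem_iUnion, not_exists]
  exact fun k hk => D.notMem_piece (h k) (interior_subset hk)

/-- A point in the collar of `Pₖ` but outside `Pₖ` is outside of all holes. -/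
theorem one_lt_of_collar {k : Fin s} {p : E n} (hp : (D.rad k).N p < (D.rad k).c)
    (h : 1 < (D.rad k).N p) (l : Fin s) : 1 < (D.rad l).N p := by
  by_cases hl : l = k
  · rwa [hl]
  · exact (D.one_lt_c l).trans_le (D.disjoint k l p (Ne.symm hl) hp)

variable (lam : P.Facet → Fin n → ℤ)

/-- The homeomorphism from the outer polytope without the points `xₖ` onto the complement of the
holes. -/
def outerHomeo : BaseHomeo (P.summand 0) (P.restrict lam 0) P lam where
  toFun := D.outer
  invFun := D.outerInv
  source := {p | ∀ k, p ≠ x k}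
  target := {q | ∀ k, (D.rad k).β q < (D.rad k).N q}
  isOpen_source := by
    have : {p | ∀ k, p ≠ x k} = ⋂ k, {x k}ᶜ := by ext p; simp
    rw [this]
    exact isOpen_iInter_of_finite fun k => isOpen_compl_singleton
  isOpen_target := by
    have : {q | ∀ k, (D.rad k).β q < (D.rad k).N q} =
      ⋂ k, {q | (D.rad k).β q < (D.rad k).N q} := by ext p; simp
    rw [this]
    exact isOpen_iInter_of_finite fun k => (D.rad k).isOpen_β_lt
  continuousOn_toFun := D.continuousOn_outer.mono inter_subset_right
  continuousOn_invFun := D.continuousOn_outerInv.mono fun q hq k =>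
    (D.rad k).ne_center_of_β_lt (hq.2 k)
  map_source := by
    rintro p ⟨hpb, hp⟩
    rw [summand_body] at hpb
    by_cases h : ∃ k, (D.rad k).N p < (D.rad k).c
    · obtain ⟨k, hk⟩ := h
      rw [D.outer_of_lt hk]
      have h1 := (D.rad k).N_outer_lt (hp k) hk
      have h2 := (D.rad k).β_lt_N_outer (hp k)
      have h3 := D.one_lt_of_collar h1 (((D.rad k).one_lt_β _).trans h2)
      refine ⟨D.mem_body_of_one_lt (interior_subset (D.mem_interior k _ h1)) h3, fun l => ?_⟩
      by_cases hl : l = k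
      · subst hl; exact h2
      · exact D.β_lt_of_c_le (D.disjoint k l _ (Ne.symm hl) h1)
    · push Not at h
      rw [D.outer_of_le h]
      exact ⟨D.mem_body_of_one_lt hpb fun k => (D.one_lt_c k).trans_le (h k),
        fun k => D.β_lt_of_c_le (h k)⟩
  map_target := by
    rintro q ⟨hqb, hq⟩
    rw [summand_body]
    by_cases h : ∃ k, (D.rad k).N q < (D.rad k).c
    · obtain ⟨k, hk⟩ := h
      rw [D.outerInv_of_lt hk]
      have h1 := (D.rad k).N_outerInv_lt (hq k) hk
      refine ⟨interior_subset (D.mem_interior k _ h1), fun l => ?_⟩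
      by_cases hl : l = k
      · subst hl; exact (D.rad l).outerInv_ne (hq l)
      · exact D.ne_of_one_lt ((D.one_lt_c l).trans_le (D.disjoint k l _ (Ne.symm hl) h1))
    · push Not at h
      rw [D.outerInv_of_le h]
      exact ⟨hqb.1, fun k => (D.rad k).ne_center_of_β_lt (hq k)⟩
  left_inv := by
    rintro p ⟨hpb, hp⟩
    by_cases h : ∃ k, (D.rad k).N p < (D.rad k).c
    · obtain ⟨k, hk⟩ := h
      rw [D.outer_of_lt hk, D.outerInv_of_lt ((D.rad k).N_outer_lt (hp k) hk),
        (D.rad k).outerInv_outer (hp k)]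
    · push Not at h
      rw [D.outer_of_le h, D.outerInv_of_le h]
  right_inv := by
    rintro q ⟨hqb, hq⟩
    by_cases h : ∃ k, (D.rad k).N q < (D.rad k).c
    · obtain ⟨k, hk⟩ := h
      rw [D.outerInv_of_lt hk, D.outer_of_lt ((D.rad k).N_outerInv_lt (hq k) hk),
        (D.rad k).outer_outerInv (hq k)]
    · push Not at h
      rw [D.outerInv_of_le h, D.outer_of_le h]
  -- In a collar both `p` and its image are interior to the outer polytope, and the image is off the
  -- holes, so both modules vanish. Elsewhere the map is the identity and no hole contains `p`.
  faceModule_eq := by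
    rintro p ⟨hpb, hp⟩
    by_cases h : ∃ k, (D.rad k).N p < (D.rad k).c
    · obtain ⟨k, hk⟩ := h
      rw [D.outer_of_lt hk]
      have h1 := (D.rad k).N_outer_lt (hp k) hk
      have h2 := (D.rad k).β_lt_N_outer (hp k)
      have h3 := D.one_lt_of_collar h1 (((D.rad k).one_lt_β _).trans h2)
      rw [P.summand_faceModule_eq_bot lam (D.mem_interior k p hk),
        P.faceModule_eq_bot_of_interior lam (D.mem_interior k _ h1) fun l => D.notMem_piece (h3 l)]
    · push Not at h
      rw [D.outer_of_le h]
      exact P.faceModule_eq_summand lam (P.isFacet_of_notMem_hole fun k =>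
        D.notMem_piece ((D.one_lt_c k).trans_le (h k)))

theorem ne_of_mem_hole (D : CollarData P x) {k : Fin s} {p : E n} (hp : p ∈ P.piece k.succ) (hpk : p ≠ x k)
    (l : Fin s) : p ≠ x l := by
  by_cases hl : l = k
  · rwa [hl]
  · have h1 : (D.rad k).N p < (D.rad k).c :=
      (((D.rad k).N_le_one_iff p).2 hp).trans_lt (D.one_lt_c k)
    exact D.ne_of_one_lt ((D.one_lt_c l).trans_le (D.disjoint k l p (Ne.symm hl) h1))

theorem inner_lt_c {k : Fin s} {p : E n} (hp : p ∈ P.piece k.succ) (hpk : p ≠ x k) :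
    (D.rad k).N ((D.rad k).inner p) < (D.rad k).c :=
  ((D.rad k).N_inner_lt hp hpk).trans (D.rad k).one_add_δ_lt_c

/-- The homeomorphism from `Pₖ` without `xₖ` onto a collar of the hole. -/
def innerHomeo (k : Fin s) : BaseHomeo (P.summand k.succ) (P.restrict lam k.succ) P lam where
  toFun := (D.rad k).inner
  invFun := (D.rad k).innerInv
  source := {p | ∀ k, p ≠ x k}
  target := {q | (D.rad k).N q < 1 + (D.rad k).δ}
  isOpen_source := (D.outerHomeo lam).isOpen_source
  isOpen_target := isOpen_lt (D.rad k).continuous_N continuous_const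
  continuousOn_toFun := (D.rad k).continuousOn_inner.mono fun p hp => hp.2 k
  continuousOn_invFun := (D.rad k).continuousOn_innerInv.mono fun q hq => by
    have hq1 : 1 ≤ (D.rad k).N q := by
      by_contra h
      exact hq.1.2 (mem_iUnion.2 ⟨k, ((D.rad k).N_lt_one_iff q).1 (not_le.1 h)⟩)
    exact (D.rad k).ne_center_of_N_pos (zero_lt_one.trans_le hq1)
  map_source := by
    rintro p ⟨hpb, hp⟩
    rw [summand_body] at hpb
    have h1 := D.inner_lt_c hpb (hp k)
    refine ⟨⟨interior_subset (D.mem_interior k _ h1), ?_⟩, (D.rad k).N_inner_lt hpb (hp k)⟩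
    simp only [mem_iUnion, not_exists]
    intro l hl
    by_cases hlk : l = k
    · subst hlk
      exact not_le.2 (((D.rad l).N_lt_one_iff _).2 hl) ((D.rad l).one_le_N_inner hpb (hp l))
    · exact D.notMem_piece ((D.one_lt_c l).trans_le (D.disjoint k l _ (Ne.symm hlk) h1))
        (interior_subset hl)
  map_target := by
    rintro q ⟨hqb, hq⟩
    have hq1 : 1 ≤ (D.rad k).N q := by
      by_contra h
      exact hqb.2 (mem_iUnion.2 ⟨k, ((D.rad k).N_lt_one_iff q).1 (not_le.1 h)⟩)
    rw [summand_body]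
    have h1 := (D.rad k).innerInv_mem hq1 hq
    exact ⟨h1, D.ne_of_mem_hole h1 ((D.rad k).innerInv_ne hq1 hq)⟩
  left_inv := by
    rintro p ⟨hpb, hp⟩
    rw [summand_body] at hpb
    exact (D.rad k).innerInv_inner hpb (hp k)
  right_inv := by
    rintro q ⟨hqb, hq⟩
    have hq1 : 1 ≤ (D.rad k).N q := by
      by_contra h
      exact hqb.2 (mem_iUnion.2 ⟨k, ((D.rad k).N_lt_one_iff q).1 (not_le.1 h)⟩)
    exact (D.rad k).inner_innerInv hq1 hq
  -- Boundary points of the hole are fixed and see only its facets; interior points go to points on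
  -- no facet.
  faceModule_eq := by
    rintro p ⟨hpb, hp⟩
    rw [summand_body] at hpb
    have h1 := D.inner_lt_c hpb (hp k)
    rcases eq_or_lt_of_le (((D.rad k).N_le_one_iff p).2 hpb) with hN | hN
    · rw [(D.rad k).inner_eq_self hN]
      exact P.faceModule_eq_summand lam (P.isFacet_of_mem_hole hpb)
    · have h2 : 1 < (D.rad k).N ((D.rad k).inner p) := by
        rw [(D.rad k).N_inner hpb (hp k)]
        have := mul_pos (D.rad k).δ_pos (sub_pos.2 hN)
        linarith
      rw [P.summand_faceModule_eq_bot lam (((D.rad k).N_lt_one_iff p).1 hN),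
        P.faceModule_eq_bot_of_interior lam (D.mem_interior k _ h1)
          fun l => D.notMem_piece (D.one_lt_of_collar h1 h2 l)]

/-- The homeomorphisms of `Pₖ`, without the points `xₗ`, onto parts of `P`, for all `k`. -/
def homeo (k : Fin (s + 1)) : BaseHomeo (P.summand k) (P.restrict lam k) P lam :=
  Fin.cases (D.outerHomeo lam) (D.innerHomeo lam) k

theorem homeo_source (k : Fin (s + 1)) : (D.homeo lam k).source = {p | ∀ l, p ≠ x l} := by
  induction k using Fin.cases with
  | zero => rfl
  | succ k => rfl

/-- A collar reaches up to gauge `1 + δ`, whereas the image of `outer` already begins at `β < 1 +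
δ`. -/
theorem homeo_cover (q : E n) : ∃ k, q ∈ (D.homeo lam k).target := by
  by_cases h : ∃ k, (D.rad k).N q < 1 + (D.rad k).δ
  · obtain ⟨k, hk⟩ := h
    exact ⟨k.succ, hk⟩
  · push Not at h
    refine ⟨0, fun k => ?_⟩
    have h1 : 0 < (D.rad k).N q := by linarith [h k, (D.rad k).δ_pos]
    exact ((D.rad k).β_lt ((D.rad k).ne_center_of_N_pos h1)).trans_le (h k)

/-- Only points off the facets of the piece are moved, and their images stay off them. -/
theorem mem_facet_iff_homeo (k : Fin (s + 1)) {p : E n} (hp : p ∈ P.piece k)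
    (hpx : ∀ l, p ≠ x l) {F : Set (E n)} (hF : IsFacet (P.piece k) F) :
    p ∈ F ↔ (D.homeo lam k).toFun p ∈ F := by
  induction k using Fin.cases with
  | zero =>
    change p ∈ F ↔ D.outer p ∈ F
    by_cases h : ∃ k, (D.rad k).N p < (D.rad k).c
    · obtain ⟨k, hk⟩ := h
      rw [D.outer_of_lt hk]
      have h1 := (D.rad k).N_outer_lt (hpx k) hk
      exact iff_of_false (notMem_facet_of_interior (P.simple 0) hF (D.mem_interior k _ hk))
        (notMem_facet_of_interior (P.simple 0) hF (D.mem_interior k _ h1))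
    · push Not at h
      rw [D.outer_of_le h]
  | succ k =>
    change p ∈ F ↔ (D.rad k).inner p ∈ F
    rcases eq_or_lt_of_le (((D.rad k).N_le_one_iff p).2 hp) with hN | hN
    · rw [(D.rad k).inner_eq_self hN]
    · refine iff_of_false (notMem_facet_of_interior (P.simple _) hF
        (((D.rad k).N_lt_one_iff p).1 hN)) fun h => ?_
      refine D.notMem_piece (k := k) ?_ (facet_subset (P.simple _) hF h)
      rw [(D.rad k).N_inner hp (hpx k)]
      have := mul_pos (D.rad k).δ_pos (sub_pos.2 hN)
      linarith

/-- The overlaps of the images of `outer` and `inner`. -/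
theorem eq_of_outer_eq_inner {k : Fin s} {p p' : E n} (hpx : ∀ l, p ≠ x l)
    (hp' : p' ∈ P.piece k.succ) (hpx' : p' ≠ x k) (h : D.outer p = (D.rad k).inner p') :
    ‖p' - x k‖ < (D.rad k).ε ∧
      p = x k + (((D.rad k).ε - ‖p' - x k‖) / ‖p' - x k‖) • (p' - x k) := by
  have h1 := D.inner_lt_c hp' hpx'
  have h2 : (D.rad k).N p < (D.rad k).c := by
    by_contra hcon
    by_cases hl : ∃ l, (D.rad l).N p < (D.rad l).c
    · obtain ⟨l, hl⟩ := hl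
      have hlk : l ≠ k := by rintro rfl; exact hcon hl
      rw [D.outer_of_lt hl] at h
      have h3 := (D.rad l).N_outer_lt (hpx l) hl
      have h4 := D.disjoint l k _ hlk h3
      rw [h] at h4
      exact not_lt.2 h4 h1
    · push Not at hl
      rw [D.outer_of_le hl] at h
      rw [h] at hcon
      exact hcon h1
  rw [D.outer_of_lt h2] at h
  exact (D.rad k).eq_of_outer_eq_inner (hpx k) hp' hpx' h

/-- The factor 2 in `ε_mul_N_le` bounds the gauge by `1 / 2` on the closed ball. -/
theorem ε_mem_interior {k : Fin s} {v : E n} (hv : ‖v‖ ≤ (D.rad k).ε) :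
    x k + v ∈ interior (P.piece k.succ) := by
  rw [← (D.rad k).N_lt_one_iff]
  have h1 := (D.rad k).ε_mul_N_le (x k + v)
  rw [add_sub_cancel_left] at h1
  have h2 := (D.rad k).ε_pos
  by_contra h
  nlinarith [mul_le_mul_of_nonneg_left (not_lt.1 h) h2.le]

theorem outer_eq_inner {k : Fin s} {v : E n} (hv0 : v ≠ 0) (hv : ‖v‖ < (D.rad k).ε) :
    D.outer (x k + (((D.rad k).ε - ‖v‖) / ‖v‖) • v) = (D.rad k).inner (x k + v) := by
  rw [← (D.rad k).outer_eq_inner hv0 hv]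
  refine D.outer_of_lt (lt_of_lt_of_le ?_ (D.one_lt_c k).le)
  rw [(D.rad k).N_lt_one_iff]
  refine D.ε_mem_interior ?_
  have hvn : 0 < ‖v‖ := norm_pos_iff.2 hv0
  rw [norm_smul, Real.norm_of_nonneg (div_nonneg (sub_nonneg.2 hv.le) hvn.le),
    div_mul_cancel₀ _ hvn.ne']
  linarith

end CollarData

end PolytopeWithHoles

/-! ### The radial inversion -/

section Inversion

variable {n : ℕ}

/-- The reflection in the last coordinate. -/
def lastReflection (n : ℕ) : E n →L[ℝ] E n := LinearMap.toContinuousLinearMap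
  { toFun := fun p => WithLp.toLp 2 fun i : Fin n => if (i : ℕ) + 1 = n then -p i else p i
    map_add' := fun p q => by
      ext i; by_cases h : (i : ℕ) + 1 = n <;> simp [h, add_comm]
    map_smul' := fun r p => by
      ext i; by_cases h : (i : ℕ) + 1 = n <;> simp [h] }

theorem lastReflection_apply (p : E n) (i : Fin n) :
    lastReflection n p i = if (i : ℕ) + 1 = n then -p i else p i := rfl

theorem norm_lastReflection (p : E n) : ‖lastReflection n p‖ = ‖p‖ := by
  rw [EuclideanSpace.norm_eq, EuclideanSpace.norm_eq]
  congr 1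
  refine Finset.sum_congr rfl fun i _ => ?_
  rw [lastReflection_apply]
  split_ifs <;> simp

theorem lastReflection_lastReflection (p : E n) : lastReflection n (lastReflection n p) = p := by
  ext i
  rw [lastReflection_apply, lastReflection_apply]
  split_ifs <;> simp

theorem det_lastReflection (hn : 1 ≤ n) : (lastReflection n).det = -1 := by
  set d : Fin n → ℝ := fun i => if (i : ℕ) + 1 = n then -1 else 1 with hd
  have h := LinearMap.det_conj (Matrix.toLin' (Matrix.diagonal d))
    (WithLp.linearEquiv 2 ℝ (Fin n → ℝ)).symm
  rw [LinearMap.det_toLin', Matrix.det_diagonal] at h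
  have h1 : (lastReflection n : E n →ₗ[ℝ] E n) =
      ((WithLp.linearEquiv 2 ℝ (Fin n → ℝ)).symm : (Fin n → ℝ) →ₗ[ℝ] E n) ∘ₗ
        Matrix.toLin' (Matrix.diagonal d) ∘ₗ
        ((WithLp.linearEquiv 2 ℝ (Fin n → ℝ)).symm.symm : E n →ₗ[ℝ] (Fin n → ℝ)) := by
    ext p i
    by_cases hi : (i : ℕ) + 1 = n <;>
      simp [lastReflection_apply, hi, hd, Matrix.mulVec_diagonal]
  rw [ContinuousLinearMap.det, h1]
  refine h.trans ?_
  rw [Finset.prod_eq_single (⟨n - 1, by omega⟩ : Fin n)]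
  · simp [hd, Nat.sub_add_cancel hn]
  · intro i _ hi
    rw [hd]
    refine if_neg fun h => hi (Fin.ext ?_)
    simp only
    omega
  · simp

theorem radialInversion_eq (p : E n) :
    radialInversion p = ((1 - ‖p‖) / ‖p‖) • lastReflection n p := rfl

theorem norm_radialInversion {p : E n} (h0 : 0 < ‖p‖) (h1 : ‖p‖ < 1) :
    ‖radialInversion p‖ = 1 - ‖p‖ := by
  rw [radialInversion_eq, norm_smul, norm_lastReflection,
    Real.norm_of_nonneg (div_nonneg (by linarith) h0.le), div_mul_cancel₀ _ h0.ne']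

theorem radialInversion_radialInversion {p : E n} (h0 : 0 < ‖p‖) (h1 : ‖p‖ < 1) :
    radialInversion (radialInversion p) = p := by
  rw [radialInversion_eq, norm_radialInversion h0 h1, radialInversion_eq, map_smul,
    lastReflection_lastReflection, smul_smul]
  have h2 : 1 - ‖p‖ ≠ 0 := by linarith
  have : (1 - (1 - ‖p‖)) / (1 - ‖p‖) * ((1 - ‖p‖) / ‖p‖) = 1 := by
    field_simp
    ring
  rw [this, one_smul]

theorem contDiffAt_inversionFactor {p : E n} (h0 : p ≠ 0) :
    ContDiffAt ℝ ∞ (fun p : E n => (1 - ‖p‖) / ‖p‖) p :=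
  (contDiffAt_const.sub (contDiffAt_norm ℝ h0)).div (contDiffAt_norm ℝ h0) (norm_ne_zero_iff.2 h0)

theorem contDiffAt_radialInversion {p : E n} (h0 : p ≠ 0) : ContDiffAt ℝ ∞ radialInversion p :=
  (contDiffAt_inversionFactor h0).smul (lastReflection n).contDiff.contDiffAt

/-- The radial inversion preserves orientation. -/
theorem det_fderiv_radialInversion (hn : 1 ≤ n) {p : E n} (h0 : 0 < ‖p‖) (h1 : ‖p‖ < 1) :
    0 < (fderiv ℝ radialInversion p).det := by
  have hp0 : p ≠ 0 := norm_pos_iff.1 h0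
  set c : E n → ℝ := fun p => (1 - ‖p‖) / ‖p‖ with hc
  have hcp : 0 < c p := div_pos (by linarith) h0
  have hcd : HasFDerivAt c (fderiv ℝ c p) p :=
    ((contDiffAt_inversionFactor hp0).differentiableAt (by simp)).hasFDerivAt
  set φ := fderiv ℝ c p with hφ
  -- Only the radial derivative of the scaling factor enters the determinant; it comes from `c (t •
  -- p) = 1 / (t‖p‖) - 1`.
  have hφp : φ p = -1 / ‖p‖ := by
    have hline : HasDerivAt (fun t : ℝ => t • p) p 1 := by
      simpa using (hasDerivAt_id (1 : ℝ)).smul_const p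
    have e1 : HasDerivAt (fun t : ℝ => c (t • p)) (φ p) 1 := by
      have hcd' : HasFDerivAt c φ ((1 : ℝ) • p) := by rwa [one_smul]
      exact hcd'.comp_hasDerivAt (1 : ℝ) hline
    have e2 : HasDerivAt (fun t : ℝ => t⁻¹ * ‖p‖⁻¹ - 1) (-1 / ‖p‖) 1 := by
      refine (((hasDerivAt_inv (one_ne_zero (α := ℝ))).mul_const ‖p‖⁻¹).sub_const 1).congr_deriv ?_
      rw [one_pow, inv_one, neg_one_mul, neg_div, one_div]
    have e3 : (fun t : ℝ => c (t • p)) =ᶠ[𝓝 1] fun t : ℝ => t⁻¹ * ‖p‖⁻¹ - 1 := by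
      filter_upwards [lt_mem_nhds (one_pos (α := ℝ))] with t ht
      have ht' : t ≠ 0 := ht.ne'
      simp only [hc, norm_smul, Real.norm_of_nonneg ht.le]
      field_simp
    exact e1.unique (e2.congr_of_eventuallyEq e3)
  have hρ : HasFDerivAt (fun p : E n => c p • p)
      (c p • ContinuousLinearMap.id ℝ (E n) + φ.smulRight p) p := hcd.smul (hasFDerivAt_id p)
  have hg : HasFDerivAt radialInversion ((lastReflection n).comp
      (c p • ContinuousLinearMap.id ℝ (E n) + φ.smulRight p)) p := by
    refine ((lastReflection n).hasFDerivAt.comp p hρ).congr_of_eventuallyEq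
      (Filter.Eventually.of_forall fun q => ?_)
    simp only [Function.comp_apply, map_smul]
    rfl
  rw [hg.fderiv, ContinuousLinearMap.det_comp', det_lastReflection hn]
  -- A scalar plus a rank one map: after division by `c p`, the determinant is 1 plus the value of
  -- the functional at `p`.
  have hdet : (c p • ContinuousLinearMap.id ℝ (E n) + φ.smulRight p).det =
      c p ^ n * (1 + (c p)⁻¹ * φ p) := by
    have h2 : ((c p • ContinuousLinearMap.id ℝ (E n) + φ.smulRight p : E n →L[ℝ] E n) :
        E n →ₗ[ℝ] E n) = c p • LinearMap.transvection ((c p)⁻¹ • (φ : E n →ₗ[ℝ] ℝ)) p := by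
      refine LinearMap.ext fun v => ?_
      rw [LinearMap.smul_apply, LinearMap.transvection.apply, LinearMap.smul_apply, smul_add,
        smul_smul, smul_eq_mul, mul_inv_cancel_left₀ hcp.ne']
      rfl
    rw [ContinuousLinearMap.det, h2, LinearMap.det_smul, LinearMap.transvection.det]
    simp
  rw [hdet, hφp]
  -- The negative sign is the reversal of the radius; the reflection cancels it.
  have h3 : 1 + (c p)⁻¹ * (-1 / ‖p‖) = -(c p)⁻¹ := by
    have h4 : 1 - ‖p‖ ≠ 0 := by linarith
    simp only [hc]
    field_simp
    ring
  rw [h3]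
  have := mul_pos (pow_pos hcp n) (inv_pos.2 hcp)
  linarith

/-- The product of the radial inversion and the identity of the torus, in coordinates. -/
def inversionCoord (w : Cn n) : Cn n :=
  (splitEquiv n).symm (radialInversion (rePart w), fun i => (w i).im)

@[simp]
theorem rePart_inversionCoord (w : Cn n) : rePart (inversionCoord w) = radialInversion (rePart w) :=
  congrArg Prod.fst ((splitEquiv n).apply_symm_apply (radialInversion (rePart w), fun i => (w i).im))

@[simp]
theorem angle_inversionCoord (w : Cn n) : angle (inversionCoord w) = angle w := rfl

theorem orientedAt_inversionCoord (hn : 1 ≤ n) {w : Cn n} (h0 : 0 < ‖rePart w‖)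
    (h1 : ‖rePart w‖ < 1) : OrientedAt n (inversionCoord : Cn n → Cn n) w := by
  set S : Cn n ≃L[ℝ] E n × (Fin n → ℝ) := (splitEquiv n).toContinuousLinearEquiv with hS
  have hp0 : rePart w ≠ 0 := norm_pos_iff.1 h0
  have hform : (inversionCoord : Cn n → Cn n) = S.symm ∘ Prod.map radialInversion id ∘ S := rfl
  have hcd : ContDiffAt ℝ ∞ (inversionCoord : Cn n → Cn n) w := by
    rw [hform]
    refine S.symm.contDiff.contDiffAt.comp w (ContDiffAt.comp w ?_ S.contDiff.contDiffAt)
    exact ContDiffAt.prodMap' (p := S w) (contDiffAt_radialInversion hp0) contDiffAt_id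
  refine orientedAt_of_fderiv hcd ?_
  have hfd : HasFDerivAt (inversionCoord : Cn n → Cn n)
      (sep (fderiv ℝ radialInversion (rePart w)) (ContinuousLinearMap.id ℝ (Fin n → ℝ))) w := by
    have h2 : HasFDerivAt (Prod.map (radialInversion : E n → E n) (id : (Fin n → ℝ) → (Fin n → ℝ)))
        ((fderiv ℝ radialInversion (rePart w)).prodMap (ContinuousLinearMap.id ℝ (Fin n → ℝ)))
        (S w) :=
      HasFDerivAt.prodMap (S w)
        ((contDiffAt_radialInversion hp0).differentiableAt (by simp)).hasFDerivAt (hasFDerivAt_id _)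
    have h3 := S.symm.hasFDerivAt.comp w (h2.comp w S.hasFDerivAt)
    rw [hform]
    exact h3
  rw [hfd.fderiv, det_sep]
  have : (ContinuousLinearMap.id ℝ (Fin n → ℝ)).det = 1 := LinearMap.det_id
  rw [this, mul_one]
  exact det_fderiv_radialInversion hn h0 h1

theorem exists_coord (t : Torus n) (p : E n) : ∃ w : Cn n, angle w = t ∧ rePart w = p := by
  obtain ⟨q, hq⟩ := torusProj_surjective t
  exact ⟨fun i => ⟨p i, q i⟩, hq, rfl⟩

end Inversion

namespace PolytopeWithHoles

/-! ### Tubes around orbits -/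

section Tubes

variable {n s s' : ℕ}

/-- An equivariant map which is the radial inversion in terms of tubes preserves orientation. -/
theorem OrbitTube.orientedAt (hn : 1 ≤ n) {Q : PolytopeWithHoles n s} {mu : Q.Facet → Fin n → ℤ}
    {Q' : PolytopeWithHoles n s'} {mu' : Q'.Facet → Fin n → ℤ}
    [ChartedSpace (Cn n) (Q.TorusSpace mu)] [ChartedSpace (Cn n) (Q'.TorusSpace mu')]
    [IsManifold 𝓘(ℝ, Cn n) ∞ (Q.TorusSpace mu)]
    {y y' : E n} (T : OrbitTube Q mu y) (T' : OrbitTube Q' mu' y')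
    {f : Q.TorusSpace mu → Q'.TorusSpace mu'}
    (hf : ∀ t p, 0 < ‖p‖ → ‖p‖ < 1 → f (T.toFun t p) = T'.toFun t (radialInversion p))
    {t : Torus n} {p : E n} (h0 : 0 < ‖p‖) (h1 : ‖p‖ < 1) : OrientedAt n f (T.toFun t p) := by
  obtain ⟨w, rfl, rfl⟩ := exists_coord t p
  have hopen : IsOpen {w : Cn n | ‖rePart w‖ < 1} :=
    isOpen_lt (continuous_rePart.norm) continuous_const
  have hT : OrientedAt n (fun w : Cn n => T.toFun (angle w) (rePart w)) w :=
    ⟨T.smooth.contMDiffAt (hopen.mem_nhds h1), T.orientation_preserving w h1⟩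
  have hg : ‖rePart (inversionCoord w)‖ < 1 := by
    rw [rePart_inversionCoord, norm_radialInversion h0 h1]; linarith
  have hT' : OrientedAt n (fun w : Cn n => T'.toFun (angle w) (rePart w)) (inversionCoord w) :=
    ⟨T'.smooth.contMDiffAt (hopen.mem_nhds hg), T'.orientation_preserving _ hg⟩
  -- The tube `T` is an oriented local diffeomorphism, so it suffices to examine `f ∘ T`, which is
  -- `T'` after the inversion.
  refine OrientedAt.of_comp (h := fun w : Cn n => T.toFun (angle w) (rePart w)) hT
    ((hT'.comp (orientedAt_inversionCoord hn h0 h1)).congr ?_)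
  have hn0 : ∀ᶠ w' in 𝓝 w, 0 < ‖rePart w'‖ :=
    continuous_rePart.norm.continuousAt.eventually_const_lt h0
  filter_upwards [hn0, hopen.mem_nhds h1] with w' h2 h3
  simp only [Function.comp_apply, rePart_inversionCoord, angle_inversionCoord]
  exact hf _ _ h2 h3

theorem HasStandardInterior.point {Q : PolytopeWithHoles n s} {mu : Q.Facet → Fin n → ℤ}
    [Nonempty (Q.TorusSpace mu)] [ChartedSpace (Cn n) (Q.TorusSpace mu)] {ε : ℝ}
    (h : Q.HasStandardInterior mu ε) {w : Cn n} (hw : rePart w ∈ interior Q.body) :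
    ContMDiffAt 𝓘(ℝ, Cn n) 𝓘(ℝ, Cn n) ∞ (fun w => Q.point mu (angle w) (rePart w)) w ∧
      0 < ε * jacobian n (fun w => Q.point mu (angle w) (rePart w)) w := by
  obtain ⟨ψ, h1, h2, h3⟩ := h
  have hopen : IsOpen {w : Cn n | rePart w ∈ interior Q.body} :=
    isOpen_interior.preimage continuous_rePart
  have heq : (fun w => Q.point mu (angle w) (rePart w)) =ᶠ[𝓝 w] ψ := by
    filter_upwards [hopen.mem_nhds hw] with w' hw'
    rw [h1 w' (interior_subset hw'), Q.point_of_mem mu (interior_subset hw')]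
  refine ⟨(h2.contMDiffAt (hopen.mem_nhds hw)).congr_of_eventuallyEq heq, ?_⟩
  rw [jacobian_congr heq]
  exact h3 w hw

theorem rePart_sep_add (f : E n →L[ℝ] E n) (w : Cn n) (y : E n) :
    rePart (sep f (ContinuousLinearMap.id ℝ (Fin n → ℝ)) w + fun i => (y i : ℂ)) =
      y + f (rePart w) := by
  ext i
  simp [rePart, sep_apply, add_comm]

theorem angle_sep_add (f : E n →L[ℝ] E n) (w : Cn n) (y : E n) :
    angle (sep f (ContinuousLinearMap.id ℝ (Fin n → ℝ)) w + fun i => (y i : ℂ)) = angle w := by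
  unfold angle
  congr 1
  ext i
  simp [sep_apply]

/-- The tube `(t, p) ↦ [t, y + r R(p)]` in a quasitoric manifold. -/
def standardTube {Q : PolytopeWithHoles n 0} {mu : Q.Facet → Fin n → ℤ}
    [Nonempty (Q.TorusSpace mu)] [ChartedSpace (Cn n) (Q.TorusSpace mu)] {ε : ℝ}
    (h : Q.HasStandardInterior mu ε) (y : E n) {r : ℝ} (hr : 0 < r)
    (hball : ∀ v, ‖v‖ ≤ r → y + v ∈ interior Q.body) (R : E n →L[ℝ] E n)
    (hR : ∀ v, ‖R v‖ = ‖v‖) (hdet : 0 < ε * R.det) : OrbitTube Q mu y :=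
  have hmem : ∀ p, ‖p‖ < 1 → y + r • R p ∈ interior Q.body := fun p hp => by
    refine hball _ ?_
    rw [norm_smul, hR, Real.norm_of_nonneg hr.le]
    nlinarith
  have key : ∀ w : Cn n, ‖rePart w‖ < 1 →
      ContMDiffAt 𝓘(ℝ, Cn n) 𝓘(ℝ, Cn n) ∞
        (fun w : Cn n => Q.point mu (angle w) (y + r • R (rePart w))) w ∧
      0 < jacobian n (fun w : Cn n => Q.point mu (angle w) (y + r • R (rePart w))) w := by
    intro w hw
    set S := sep (r • R) (ContinuousLinearMap.id ℝ (Fin n → ℝ)) with hS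
    set T : Cn n → Cn n := fun w => S w + fun i => (y i : ℂ) with hT
    have hform : (fun w : Cn n => Q.point mu (angle w) (y + r • R (rePart w))) =
        (fun w => Q.point mu (angle w) (rePart w)) ∘ T := by
      funext w
      simp only [hT, hS, Function.comp_apply, rePart_sep_add, angle_sep_add, smul_apply]
    have hTw : rePart (T w) ∈ interior Q.body := by
      rw [hT, rePart_sep_add]; exact hmem _ hw
    obtain ⟨h1, h2⟩ := h.point hTw
    have hTd : HasFDerivAt T S w := S.hasFDerivAt.add_const _
    have hTc : ContMDiffAt 𝓘(ℝ, Cn n) 𝓘(ℝ, Cn n) ∞ T w :=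
      (S.contDiff.add contDiff_const).contMDiff.contMDiffAt
    have hTj : jacobian n T w = r ^ n * R.det := by
      rw [jacobian_eq_det_fderiv, hTd.fderiv, hS, det_sep]
      have e1 : (ContinuousLinearMap.id ℝ (Fin n → ℝ)).det = 1 := LinearMap.det_id
      have e2 : (r • R).det = LinearMap.det (r • (R : E n →ₗ[ℝ] E n)) := rfl
      rw [e1, mul_one, e2, LinearMap.det_smul]
      simp
    rw [hform, jacobian_comp h1 hTc, hTj]
    refine ⟨h1.comp w hTc, ?_⟩
    set j := jacobian n (fun w => Q.point mu (angle w) (rePart w)) (T w)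
    have h3 := mul_pos (mul_pos h2 hdet) (pow_pos hr n)
    -- The sign of `ε` occurs twice, in the Jacobian of the standard coordinates and in the
    -- determinant of `R`, and cancels.
    have h4 : 0 < ε * ε * (j * (r ^ n * R.det)) := by
      calc 0 < ε * j * (ε * R.det) * r ^ n := h3
        _ = _ := by ring
    exact pos_of_mul_pos_right h4 (mul_self_nonneg ε)
  { toFun := fun t p => Q.point mu t (y + r • R p)
    injective := by
      intro t u p q hp hq heq
      have h1 := hmem p hp
      rw [Q.point_eq_point_iff mu (interior_subset h1) (interior_subset (hmem q hq))] at heq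
      obtain ⟨h2, h3⟩ := heq
      have hbot : Q.faceModule mu (y + r • R p) = ⊥ :=
        Q.faceModule_eq_bot_of_interior mu (Q.body_eq_piece ▸ h1) fun k => k.elim0
      rw [hbot, subtorus_bot, AddSubgroup.mem_bot, sub_eq_zero] at h3
      refine ⟨h3, ?_⟩
      have h4 : R p = R q := smul_right_injective _ hr.ne' (add_left_cancel h2)
      have h5 : ‖p - q‖ = 0 := by rw [← hR, map_sub, h4, sub_self, norm_zero]
      exact sub_eq_zero.1 (norm_eq_zero.1 h5)
    equivariant := fun t u p hp => (Q.vadd_point mu (interior_subset (hmem p hp))).symm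
    center := fun t => by
      rw [Q.orbitMap_point mu (interior_subset (hmem 0 (by simp))), map_zero, smul_zero, add_zero]
    smooth := fun w hw => (key w hw).1.contMDiffWithinAt
    orientation_preserving := fun w hw => (key w hw).2 }

end Tubes

end PolytopeWithHoles

namespace PolytopeWithHoles

/-! ### The fiber sum decomposition -/

variable {n s : ℕ} {P : PolytopeWithHoles n s} {lam : P.Facet → Fin n → ℤ} {x : Fin s → E n}

namespace CollarData

variable (D : CollarData P x)

theorem ne_add {k : Fin s} {v : E n} (h0 : v ≠ 0) (hv : ‖v‖ ≤ (D.rad k).ε) (l : Fin s) :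
    x k + v ≠ x l :=
  D.ne_of_mem_hole (interior_subset (D.ε_mem_interior hv)) (by simpa using h0) l

theorem norm_smul_le {k : Fin s} {p : E n} (hp : ‖p‖ < 1) :
    ‖(D.rad k).ε • p‖ < (D.rad k).ε := by
  rw [norm_smul, Real.norm_of_nonneg (D.rad k).ε_pos.le]
  have := (D.rad k).ε_pos
  nlinarith

theorem add_mem_base {k : Fin s} {p : E n} (hp0 : 0 < ‖p‖) (hp : ‖p‖ < 1) :
    x k + (D.rad k).ε • p ∈ (P.summand 0).body ∩ (D.homeo lam 0).source := by
  rw [summand_body, homeo_source]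
  have h := D.norm_smul_le (k := k) hp
  exact ⟨interior_subset (P.hole_subset k (interior_subset (D.ε_mem_interior h.le))),
    D.ne_add (smul_ne_zero (D.rad k).ε_pos.ne' (norm_pos_iff.1 hp0)) h.le⟩

theorem add_mem_hole {k : Fin s} {p : E n} (hp0 : 0 < ‖p‖) (hp : ‖p‖ < 1) :
    x k + (D.rad k).ε • p ∈ (P.summand k.succ).body ∩ (D.homeo lam k.succ).source := by
  rw [summand_body, homeo_source]
  have h := D.norm_smul_le (k := k) hp
  exact ⟨interior_subset (D.ε_mem_interior h.le),
    D.ne_add (smul_ne_zero (D.rad k).ε_pos.ne' (norm_pos_iff.1 hp0)) h.le⟩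

/-- The two images lie over the disjoint collars of different holes. -/
theorem lift_ne_lift
    [∀ k, Nonempty ((P.summand k).TorusSpace (P.restrict lam k))] [Nonempty (P.TorusSpace lam)]
    {k l : Fin s} (hkl : k ≠ l)
    {m : (P.summand k.succ).TorusSpace (P.restrict lam k.succ)}
    (hm : m ∈ (P.summand k.succ).punctured (P.restrict lam k.succ) x)
    {m' : (P.summand l.succ).TorusSpace (P.restrict lam l.succ)}
    (hm' : m' ∈ (P.summand l.succ).punctured (P.restrict lam l.succ) x) :
    (D.homeo lam k.succ).lift m ≠ (D.homeo lam l.succ).lift m' := by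
  intro h
  have h2 := (D.homeo lam k.succ).orbitMap_lift hm
  rw [h, (D.homeo lam l.succ).orbitMap_lift hm'] at h2
  have hmem := (P.summand k.succ).orbitMap_mem (P.restrict lam k.succ) m
  have hmem' := (P.summand l.succ).orbitMap_mem (P.restrict lam l.succ) m'
  rw [summand_body] at hmem hmem'
  have h3 := D.inner_lt_c hmem (hm k)
  have h4 := D.inner_lt_c hmem' (hm' l)
  have h5 := D.disjoint k l _ hkl h3
  change (D.rad l).inner _ = (D.rad k).inner _ at h2
  rw [← h2] at h5
  exact not_lt.2 h5 h4

section Tubes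

variable [∀ k, ChartedSpace (Cn n) ((P.summand k).TorusSpace (P.restrict lam k))]
  [∀ k, Nonempty ((P.summand k).TorusSpace (P.restrict lam k))]

/-- The tubes in `M₀`. -/
def baseTube (h : (P.summand 0).HasStandardInterior (P.restrict lam 0) 1) (k : Fin s) :
    OrbitTube (P.summand 0) (P.restrict lam 0) (x k) :=
  standardTube h (x k) (D.rad k).ε_pos
    (fun _ hv => by
      rw [summand_body]
      exact interior_mono ((P.hole_subset k).trans interior_subset) (D.ε_mem_interior hv))
    (ContinuousLinearMap.id ℝ (E n)) (fun _ => rfl)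
    (by rw [one_mul]; exact one_pos.trans_eq LinearMap.det_id.symm)

/-- The tubes in `Mₖ`. -/
def holeTube (hn : 1 ≤ n) (k : Fin s)
    (h : (P.summand k.succ).HasStandardInterior (P.restrict lam k.succ) (-1)) :
    OrbitTube (P.summand k.succ) (P.restrict lam k.succ) (x k) :=
  standardTube h (x k) (D.rad k).ε_pos
    (fun _ hv => by rw [summand_body]; exact D.ε_mem_interior hv)
    -- The reflection makes the tube oriented although the orientation over the hole is the opposite
    -- one.
    (lastReflection n) norm_lastReflection (by rw [det_lastReflection hn]; norm_num)

variable (hn : 1 ≤ n) (h0 : (P.summand 0).HasStandardInterior (P.restrict lam 0) 1)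
  (h1 : ∀ k : Fin s, (P.summand k.succ).HasStandardInterior (P.restrict lam k.succ) (-1))

theorem baseTube_apply (k : Fin s) (t : Torus n) (p : E n) : (D.baseTube h0 k).toFun t p =
    (P.summand 0).point (P.restrict lam 0) t (x k + (D.rad k).ε • p) := rfl

theorem holeTube_apply (k : Fin s) (t : Torus n) (p : E n) : (D.holeTube hn k (h1 k)).toFun t p =
    (P.summand k.succ).point (P.restrict lam k.succ) t (x k + (D.rad k).ε • lastReflection n p) :=
  rfl

variable [Nonempty (P.TorusSpace lam)]

/-- The reflection in the hole tube matches the one in the radial inversion. With `v = ε R(p)`,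
where `R` is this reflection, the claim is the identity between `outer` and `inner` on the ball of
radius `ε`. -/
theorem lift_baseTube (k : Fin s) (t : Torus n) {p : E n} (hp0 : 0 < ‖p‖) (hp : ‖p‖ < 1) :
    (D.homeo lam 0).lift ((D.baseTube h0 k).toFun t (radialInversion p)) =
      (D.homeo lam k.succ).lift ((D.holeTube hn k (h1 k)).toFun t p) := by
  have hg := norm_radialInversion hp0 hp
  have hR := norm_lastReflection p
  rw [baseTube_apply, holeTube_apply,
    (D.homeo lam 0).lift_point (D.add_mem_base (by linarith) (by linarith)),
    (D.homeo lam k.succ).lift_point (D.add_mem_hole (by rwa [hR]) (by rwa [hR]))]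
  refine congrArg (P.point lam t) ?_
  have hε := (D.rad k).ε_pos
  have hv0 : (D.rad k).ε • lastReflection n p ≠ 0 :=
    smul_ne_zero hε.ne' (norm_pos_iff.1 (by rwa [hR]))
  have key := D.outer_eq_inner hv0 (D.norm_smul_le (by rwa [hR]))
  refine Eq.trans (congrArg D.outer ?_) key
  rw [radialInversion_eq, norm_smul, hR, Real.norm_of_nonneg hε.le, smul_smul, smul_smul]
  congr 2
  field_simp

/-- Equality of the base points forces the hole point into the ball of radius `ε`, so `m'` is in the
hole tube. The corresponding point of the base tube has the same image as `m`, and injectivity of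
the outer lift identifies them. -/
theorem exists_of_lift_eq (k : Fin s) {m : (P.summand 0).TorusSpace (P.restrict lam 0)}
    (hm : m ∈ (P.summand 0).punctured (P.restrict lam 0) x)
    {m' : (P.summand k.succ).TorusSpace (P.restrict lam k.succ)}
    (hm' : m' ∈ (P.summand k.succ).punctured (P.restrict lam k.succ) x)
    (h : (D.homeo lam 0).lift m = (D.homeo lam k.succ).lift m') :
    ∃ (t : Torus n) (p : E n), 0 < ‖p‖ ∧ ‖p‖ < 1 ∧
      m = (D.baseTube h0 k).toFun t (radialInversion p) ∧
        m' = (D.holeTube hn k (h1 k)).toFun t p := by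
  have hms : m ∈ (D.homeo lam 0).toOpenPartialHomeomorph.source := hm
  have hms' : (P.summand k.succ).orbitMap (P.restrict lam k.succ) m' ∈
    (D.homeo lam k.succ).source := hm'
  have h2 := (D.homeo lam 0).orbitMap_lift hms
  rw [h, (D.homeo lam k.succ).orbitMap_lift hms'] at h2
  have hmem := (P.summand k.succ).orbitMap_mem (P.restrict lam k.succ) m'
  rw [summand_body] at hmem
  obtain ⟨h3, -⟩ := D.eq_of_outer_eq_inner hm hmem (hm' k) h2.symm
  obtain ⟨t, p', hp', rfl⟩ := (P.summand k.succ).exists_point (P.restrict lam k.succ) m'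
  rw [(P.summand k.succ).orbitMap_point _ hp'] at h3
  have h4 := hm' k
  rw [(P.summand k.succ).orbitMap_point _ hp'] at h4
  have hε := (D.rad k).ε_pos
  -- The solution of `x k + ε R(p) = p'`, the reflection `R` being an involution.
  set p : E n := (D.rad k).ε⁻¹ • lastReflection n (p' - x k) with hp
  have hnorm : ‖p‖ = (D.rad k).ε⁻¹ * ‖p' - x k‖ := by
    rw [hp, norm_smul, norm_lastReflection, Real.norm_of_nonneg (inv_pos.2 hε).le]
  have hp0 : 0 < ‖p‖ := by
    rw [hnorm]; exact mul_pos (inv_pos.2 hε) (norm_pos_iff.2 (sub_ne_zero.2 h4))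
  have hp1 : ‖p‖ < 1 := by
    rw [hnorm, inv_mul_lt_iff₀ hε, mul_one]; exact h3
  have e : (P.summand k.succ).point (P.restrict lam k.succ) t p' =
      (D.holeTube hn k (h1 k)).toFun t p := by
    rw [holeTube_apply, hp, map_smul, lastReflection_lastReflection, smul_smul,
      mul_inv_cancel₀ hε.ne', one_smul, add_sub_cancel]
  refine ⟨t, p, hp0, hp1, ?_, e⟩
  have hg := norm_radialInversion hp0 hp1
  have hb : (D.baseTube h0 k).toFun t (radialInversion p) ∈
      (D.homeo lam 0).toOpenPartialHomeomorph.source := by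
    have := D.add_mem_base (lam := lam) (k := k) (p := radialInversion p) (by linarith) (by linarith)
    rw [baseTube_apply]
    change (P.summand 0).orbitMap (P.restrict lam 0) _ ∈ (D.homeo lam 0).source
    rw [(P.summand 0).orbitMap_point _ this.1]
    exact this.2
  refine (D.homeo lam 0).toOpenPartialHomeomorph.injOn hms hb ?_
  exact h.trans ((congrArg _ e).trans (D.lift_baseTube hn h0 h1 k t hp0 hp1).symm)

/-- The transition maps between the punctured summands preserve orientation. -/
theorem orientedAt_transition (D : CollarData P x) (hn : 1 ≤ n)
    (h0 : (P.summand 0).HasStandardInterior (P.restrict lam 0) 1)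
    (h1 : ∀ k : Fin s, (P.summand k.succ).HasStandardInterior (P.restrict lam k.succ) (-1))
    [∀ k, IsManifold 𝓘(ℝ, Cn n) ∞ ((P.summand k).TorusSpace (P.restrict lam k))]
    (k l : Fin (s + 1)) {m : (P.summand k).TorusSpace (P.restrict lam k)}
    (hm : m ∈ (D.homeo lam k).toOpenPartialHomeomorph.source)
    (hml : (D.homeo lam k).toOpenPartialHomeomorph m ∈
      (D.homeo lam l).toOpenPartialHomeomorph.target) :
    OrientedAt n ((D.homeo lam l).toOpenPartialHomeomorph.symm ∘
      (D.homeo lam k).toOpenPartialHomeomorph) m := by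
  set J := fun k => (D.homeo lam k).toOpenPartialHomeomorph with hJ
  by_cases hkl : k = l
  · subst hkl
    refine (OrientedAt.id m).congr ?_
    filter_upwards [(J k).open_source.mem_nhds hm] with m' hm'
    exact (J k).left_inv hm'
  have hm' : (J l).symm (J k m) ∈ (J l).source := (J l).map_target hml
  have hJm : J l ((J l).symm (J k m)) = J k m := (J l).right_inv hml
  have hps : ∀ k, (J k).source = (P.summand k).punctured (P.restrict lam k) x := fun k =>
    congrArg (fun S => (P.summand k).orbitMap (P.restrict lam k) ⁻¹' S) (D.homeo_source lam k)
  have hbase : ∀ (k : Fin s) t (p : E n), 0 < ‖p‖ → ‖p‖ < 1 →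
      (D.baseTube h0 k).toFun t p ∈ (J 0).source := by
    intro k t p hp0 hp1
    have := D.add_mem_base (lam := lam) (k := k) hp0 hp1
    rw [baseTube_apply]
    change (P.summand 0).orbitMap (P.restrict lam 0) _ ∈ (D.homeo lam 0).source
    rw [(P.summand 0).orbitMap_point _ this.1]
    exact this.2
  have hhole : ∀ (k : Fin s) t (p : E n), 0 < ‖p‖ → ‖p‖ < 1 →
      (D.holeTube hn k (h1 k)).toFun t p ∈ (J k.succ).source := by
    intro k t p hp0 hp1
    have hR := norm_lastReflection p
    have := D.add_mem_hole (lam := lam) (k := k) (p := lastReflection n p)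
      (by rwa [hR]) (by rwa [hR])
    rw [holeTube_apply]
    change (P.summand k.succ).orbitMap (P.restrict lam k.succ) _ ∈ (D.homeo lam k.succ).source
    rw [(P.summand k.succ).orbitMap_point _ this.1]
    exact this.2
  -- Between the outer piece and a hole the transition is, in tubes, the radial inversion; two
  -- different holes have no overlap.
  induction k using Fin.cases with
  | zero =>
    induction l using Fin.cases with
    | zero => exact absurd rfl hkl
    | succ l =>
      obtain ⟨t, p, hp0, hp1, e, -⟩ := D.exists_of_lift_eq hn h0 h1 l (m := m) hm hm' hJm.symm
      have hg := norm_radialInversion hp0 hp1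
      rw [e]
      refine (D.baseTube h0 l).orientedAt hn (D.holeTube hn l (h1 l)) (fun t p hp0 hp1 => ?_)
        (by linarith) (by linarith)
      have hg := norm_radialInversion hp0 hp1
      -- For this direction the gluing identity is applied at the inverted point, since the
      -- inversion is an involution.
      have := D.lift_baseTube hn h0 h1 l t (p := radialInversion p) (by linarith) (by linarith)
      rw [radialInversion_radialInversion hp0 hp1] at this
      refine (congrArg (J l.succ).symm this).trans ((J l.succ).left_inv ?_)
      exact hhole l t _ (by linarith) (by linarith)
  | succ k =>
    induction l using Fin.cases with
    | zero =>
      obtain ⟨t, p, hp0, hp1, -, e⟩ := D.exists_of_lift_eq hn h0 h1 k (m' := m) hm' hm hJm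
      rw [e]
      refine (D.holeTube hn k (h1 k)).orientedAt hn (D.baseTube h0 k) (fun t p hp0 hp1 => ?_)
        hp0 hp1
      have hg := norm_radialInversion hp0 hp1
      refine (congrArg (J 0).symm (D.lift_baseTube hn h0 h1 k t hp0 hp1).symm).trans
        ((J 0).left_inv ?_)
      exact hbase k t _ (by linarith) (by linarith)
    | succ l =>
      exact absurd hJm.symm (D.lift_ne_lift (fun h => hkl (congrArg Fin.succ h)) hm hm')

/-- A smooth structure on `M(P, λ)` for which it is the fiber sum. -/
theorem exists_fiberSum (D : CollarData P x) (hn : 1 ≤ n)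
    (h0 : (P.summand 0).HasStandardInterior (P.restrict lam 0) 1)
    (h1 : ∀ k : Fin s, (P.summand k.succ).HasStandardInterior (P.restrict lam k.succ) (-1))
    (hM : ∀ k, IsOrientedSmoothTorusManifold n ((P.summand k).TorusSpace (P.restrict lam k))) :
    ∃ _ : ChartedSpace (Cn n) (P.TorusSpace lam),
      IsOrientedSmoothTorusManifold n (P.TorusSpace lam) ∧ Nonempty (P.FiberSum lam x) := by
  have hsm := fun k => (hM k).smooth
  have hps : ∀ k, (D.homeo lam k).source = {p | ∀ l, p ≠ x l} := D.homeo_source lam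
  have hmem : ∀ k, ∀ m ∈ (P.summand k).punctured (P.restrict lam k) x,
      m ∈ (D.homeo lam k).toOpenPartialHomeomorph.source := fun k m hm => by
    change (P.summand k).orbitMap (P.restrict lam k) m ∈ (D.homeo lam k).source
    rw [hps]; exact hm
  have hmem' : ∀ k, ∀ m ∈ (D.homeo lam k).toOpenPartialHomeomorph.source,
      m ∈ (P.summand k).punctured (P.restrict lam k) x := fun k m hm => by
    change (P.summand k).orbitMap (P.restrict lam k) m ∈ (D.homeo lam k).source at hm
    rw [hps] at hm; exact hm
  obtain ⟨cs, hX, hJ⟩ := exists_glued (n := n) hsm (fun k => (hM k).oriented)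
    (fun k => (D.homeo lam k).toOpenPartialHomeomorph)
    (fun z => D.homeo_cover lam (P.orbitMap lam z))
    (fun k l m hm hml => D.orientedAt_transition hn h0 h1 k l hm hml)
    (fun k z => torusProj n z.1 +ᵥ z.2) (fun k => (hM k).smooth_action)
    (fun k q m hm => by
      change (P.summand k).orbitMap (P.restrict lam k) _ ∈ (D.homeo lam k).source
      rw [orbitMap_vadd]
      exact hm)
    (fun k q m hm => (D.homeo lam k).lift_vadd _ hm)
  refine ⟨cs, hX, ⟨{
    baseTube := D.baseTube h0
    holeTube := fun k => D.holeTube hn k (h1 k)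
    baseTube_disjoint := ?_
    incl := fun k => (D.homeo lam k).lift
    smooth := fun k m hm => (hJ k m (hmem k m hm)).1.contMDiffWithinAt
    orientation_preserving := fun k m hm => (hJ k m (hmem k m hm)).2
    injective := fun k m hm m' hm' h =>
      (D.homeo lam k).toOpenPartialHomeomorph.injOn (hmem k m hm) (hmem k m' hm') h
    equivariant := fun k m hm t => (D.homeo lam k).lift_vadd t (hmem k m hm)
    facet_iff := ?_
    cover := ?_
    glue := fun k t p hp0 hp1 => D.lift_baseTube hn h0 h1 k t hp0 hp1
    overlap := fun k m hm m' hm' h => D.exists_of_lift_eq hn h0 h1 k hm hm' h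
    separate := fun k l hkl m hm m' hm' => D.lift_ne_lift hkl hm hm' }⟩⟩
  · intro k l t u p q hkl hp hq h
    have hp' := interior_subset (D.ε_mem_interior (D.norm_smul_le (k := k) hp).le)
    have hq' := interior_subset (D.ε_mem_interior (D.norm_smul_le (k := l) hq).le)
    have hb : ∀ k : Fin s, P.piece k.succ ⊆ (P.summand 0).body := fun k => by
      rw [summand_body]; exact (P.hole_subset k).trans interior_subset
    rw [baseTube_apply, baseTube_apply,
      (P.summand 0).point_eq_point_iff _ (hb k hp') (hb l hq')] at h
    exact Set.disjoint_left.1 (P.hole_disjoint hkl) hp' (h.1 ▸ hq')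
  · intro k m hm F hF
    rw [(D.homeo lam k).orbitMap_lift (hmem k m hm)]
    refine D.mem_facet_iff_homeo lam k ?_ hm hF
    rw [← summand_body]
    exact (P.summand k).orbitMap_mem _ m
  · intro z
    obtain ⟨k, hk⟩ := D.homeo_cover lam (P.orbitMap lam z)
    have hk' : z ∈ (D.homeo lam k).toOpenPartialHomeomorph.target := hk
    exact ⟨k, _, hmem' k _ ((D.homeo lam k).toOpenPartialHomeomorph.map_target hk'),
      (D.homeo lam k).toOpenPartialHomeomorph.right_inv hk'⟩

end Tubes

end CollarData

end PolytopeWithHoles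

end HoledPolytope

end
-- The theorem
open HoledPolytope HoledPolytope.PolytopeWithHoles in
theorem lemma2p3 {n s : ℕ} (hn : 1 ≤ n) (P : PolytopeWithHoles n s)
    (lam : P.Facet → Fin n → ℤ) (hlam : P.IsCharacteristic lam) :
    (CompactSpace (P.TorusSpace lam) ∧ T2Space (P.TorusSpace lam) ∧
      SecondCountableTopology (P.TorusSpace lam) ∧
      ∃ _ : ChartedSpace (Cn n) (P.TorusSpace lam),
        IsOrientedSmoothTorusManifold n (P.TorusSpace lam)) ∧
    ∃ _ : ∀ k, ChartedSpace (Cn n) ((P.summand k).TorusSpace (P.restrict lam k)),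
      (∀ k, IsOrientedSmoothTorusManifold n ((P.summand k).TorusSpace (P.restrict lam k)) ∧
        (P.summand k).HasStandardInterior (P.restrict lam k) (if k = 0 then 1 else -1)) ∧
      ∀ x : Fin s → E n, (∀ k, x k ∈ interior (P.piece k.succ)) →
        ∃ _ : ChartedSpace (Cn n) (P.TorusSpace lam),
          IsOrientedSmoothTorusManifold n (P.TorusSpace lam) ∧ Nonempty (P.FiberSum lam x) := by
  have hne := P.nonempty_torusSpace lam hn
  have hnk := fun k => (P.summand k).nonempty_torusSpace (P.restrict lam k) hn
  have hε : ∀ k : Fin (s + 1), (if k = 0 then 1 else -1 : ℝ) ≠ 0 := fun k => by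
    split_ifs <;> norm_num
  -- The structures on the summands are fixed before the points `x` are given; only the one on `M(P,
  -- λ)` depends on `x`.
  choose cs hcs hstd using fun k => exists_quasitoric_structure hn (hlam.restrict k) (hε k)
  have key : ∀ x : Fin s → E n, (∀ k, x k ∈ interior (P.piece k.succ)) →
      ∃ _ : ChartedSpace (Cn n) (P.TorusSpace lam),
        IsOrientedSmoothTorusManifold n (P.TorusSpace lam) ∧ Nonempty (P.FiberSum lam x) := by
    intro x hx
    obtain ⟨D⟩ := exists_collarData hx
    exact D.exists_fiberSum hn (hstd 0) (fun k => hstd k.succ) hcs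
  have hcomp := P.compactSpace lam
  -- For the first part any centers serve.
  choose x hx using fun k : Fin s => (P.simple k.succ).interior_nonempty
  obtain ⟨c, hc, -⟩ := key x hx
  exact ⟨⟨hcomp, t2Space hn hlam,
    ChartedSpace.secondCountable_of_sigmaCompact (Cn n) (P.TorusSpace lam), c, hc⟩,
    cs, fun k => ⟨hcs k, hstd k⟩, key⟩
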